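/- Let $\pi_1(\mathcal B_4)=\langle x,y,z : yxy^{-1}=zxz^{-1}=x^{-1},\ zyz^{-1}=xy^{-1}\rangle$ be the fundamental group of the closed non-orientable flat 3-manifold $\mathcal B_4$, and let $\pi_1(\mathcal G_1)=\mathbb Z^3$, $\pi_1(\mathcal G_2)=\langle x,y,z : xyx^{-1}y^{-1}=1,\ zxz^{-1}=x^{-1},\ zyz^{-1}=y^{-1}\rangle$, $\pi_1(\mathcal B_1)=\langle x,y,z : xyx^{-1}y^{-1}=yzy^{-1}z^{-1}=1,\ zxz^{-1}=x^{-1}\rangle$, $\pi_1(\mathcal B_2)=\langle x,y,z : xyx^{-1}y^{-1}=1,\ zxz^{-1}=x^{-1},\ zyz^{-1}=xy\rangle$. For a positive integer $m$ put, with sums over all ordered triples $(a,b,c)$ of positive integers with product $m$, $$d_3(m)=\sum_{abc=m}1,\qquad \sigma_2(m)=\sum_{abc=m}a,\qquad \omega(m)=\sum_{abc=m}a^2b,$$ and let all three functions be $0$ at arguments that are not integers. For a positive integer $n$ let $c_{X,\mathcal B_4}(n)$ be the number of conjugacy classes of those subgroups of index $n$ in $\pi_1(\mathcal B_4)$ that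 are isomorphic to $\pi_1(X)$. Let $n\ge 1$ be an integer. Every subgroup of index $n$ in $\pi_1(\mathcal B_4)$ is isomorphic to $\pi_1(X)$ for some $X\in\{\mathcal G_1,\mathcal G_2,\mathcal B_1,\mathcal B_2,\mathcal B_4\}$, and the numbers $c_{X,\mathcal B_4}(n)$ are finite and given by $$\text{(i)}\quad c_{\mathcal G_1,\mathcal B_4}(n)=\tfrac14\Big(\omega(\tfrac n4)+3\sigma_2(\tfrac n4)+9\sigma_2(\tfrac n8)\Big),$$ $$\text{(ii)}\quad c_{\mathcal G_2,\mathcal B_4}(n)=\tfrac12\Big(\sigma_2(\tfrac n2)+2\sigma_2(\tfrac n4)-3\sigma_2(\tfrac n8)+d_3(\tfrac n2)-d_3(\tfrac n4)-3d_3(\tfrac n8)+5d_3(\tfrac n{16})-2d_3(\tfrac n{32})\Big),$$ $$\text{(iii)}\quad c_{\mathcal B_1,\mathcal B_4}(n)=\sigma_2(\tfrac n2)-\sigma_2(\tfrac n8)+d_3(\tfrac n2)-2d_3(\tfrac n4)+d_3(\tfrac n8),$$ $$\text{(iv)}\quad c_{\mathcal B_2,\mathcal B_4}(n)=2\sigma_2(\tfrac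 n4)-2\sigma_2(\tfrac n8)+d_3(\tfrac n4)-2d_3(\tfrac n8)+d_3(\tfrac n{16}),$$ $$\text{(v)}\quad c_{\mathcal B_4,\mathcal B_4}(n)=d_3(n)-3d_3(\tfrac n2)+3d_3(\tfrac n4)-d_3(\tfrac n8).$$ -/

import Mathlib

namespace FlatCoverings

/-! ### Arithmetic functions -/

/-- The number of ordered triples `(a, b, c)` of positive integers with `a * b * c = n`. -/
def d3 (n : ℕ) : ℕ := ∑ _f ∈ Nat.finMulAntidiag 3 n, 1

/-- The sum of `a` over all ordered triples `(a, b, c)` of positive integers with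
`a * b * c = n`. (This is not the sum of the squares of the divisors.) -/
def sigma2 (n : ℕ) : ℕ := ∑ f ∈ Nat.finMulAntidiag 3 n, f 0

/-- The sum of `a ^ 2 * b` over all ordered triples `(a, b, c)` of positive integers with
`a * b * c = n`. -/
def omega (n : ℕ) : ℕ := ∑ f ∈ Nat.finMulAntidiag 3 n, f 0 ^ 2 * f 1

/-- The value `f (n / k)`, understood as `0` when `n / k` is not an integer. -/
def atQuot (f : ℕ → ℕ) (n k : ℕ) : ℚ := if k ∣ n then (f (n / k) : ℚ) else 0

/-! ### Counting conjugacy classes of subgroups -/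

/-- The conjugacy class of a subgroup `Δ`: all the subgroups `g Δ g⁻¹`. -/
def conjClass {G : Type*} [Group G] (Δ : Subgroup G) : Set (Subgroup G) :=
  Set.range fun g : G => Δ.map (MulAut.conj g).toMonoidHom

/-- The set of the conjugacy classes of those subgroups of index `n` in `G` that are isomorphic
to `H`. -/
def conjClassesOfType (H G : Type*) [Group H] [Group G] (n : ℕ) : Set (Set (Subgroup G)) :=
  {C | ∃ Δ : Subgroup G, Δ.index = n ∧ Nonempty (Δ ≃* H) ∧ C = conjClass Δ}

/-- The number `c_{H,G}(n)` of conjugacy classes of subgroups of index `n` in `G` that are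
isomorphic to `H`. -/
noncomputable def numClasses (H G : Type*) [Group H] [Group G] (n : ℕ) : ℕ :=
  (conjClassesOfType H G n).ncard

/-! ### The fundamental groups of the flat manifolds -/

/-- The first free generator. -/
abbrev genX : FreeGroup (Fin 3) := FreeGroup.of 0
/-- The second free generator. -/
abbrev genY : FreeGroup (Fin 3) := FreeGroup.of 1
/-- The third free generator. -/
abbrev genZ : FreeGroup (Fin 3) := FreeGroup.of 2

/-- The relator `u * v⁻¹` of a relation `u = v`. -/
def relator (u v : FreeGroup (Fin 3)) : FreeGroup (Fin 3) := u * v⁻¹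

/-- The fundamental group `ℤ³` of the torus `G₁`. -/
abbrev PiG1 : Type := Multiplicative (Fin 3 → ℤ)

/-- `π₁(G₂) = ⟨x, y, z : xyx⁻¹y⁻¹ = 1, zxz⁻¹ = x⁻¹, zyz⁻¹ = y⁻¹⟩`. -/
abbrev PiG2 : Type := PresentedGroup
  ({relator (genX * genY * genX⁻¹ * genY⁻¹) 1,
    relator (genZ * genX * genZ⁻¹) genX⁻¹,
    relator (genZ * genY * genZ⁻¹) genY⁻¹} : Set (FreeGroup (Fin 3)))

/-- `π₁(B₁) = ⟨x, y, z : xyx⁻¹y⁻¹ = yzy⁻¹z⁻¹ = 1, zxz⁻¹ = x⁻¹⟩`. -/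
abbrev PiB1 : Type := PresentedGroup
  ({relator (genX * genY * genX⁻¹ * genY⁻¹) 1,
    relator (genY * genZ * genY⁻¹ * genZ⁻¹) 1,
    relator (genZ * genX * genZ⁻¹) genX⁻¹} : Set (FreeGroup (Fin 3)))

/-- `π₁(B₂) = ⟨x, y, z : xyx⁻¹y⁻¹ = 1, zxz⁻¹ = x⁻¹, zyz⁻¹ = xy⟩`. -/
abbrev PiB2 : Type := PresentedGroup
  ({relator (genX * genY * genX⁻¹ * genY⁻¹) 1,
    relator (genZ * genX * genZ⁻¹) genX⁻¹,
    relator (genZ * genY * genZ⁻¹) (genX * genY)} : Set (FreeGroup (Fin 3)))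

/-- `π₁(B₄) = ⟨x, y, z : yxy⁻¹ = zxz⁻¹ = x⁻¹, zyz⁻¹ = xy⁻¹⟩`. -/
abbrev PiB4 : Type := PresentedGroup
  ({relator (genY * genX * genY⁻¹) genX⁻¹,
    relator (genZ * genX * genZ⁻¹) genX⁻¹,
    relator (genZ * genY * genZ⁻¹) (genX * genY⁻¹)} : Set (FreeGroup (Fin 3)))

end FlatCoverings

/-! The group is modelled by triples `(A, b, c)`, filtered by the translations along x (`b = c = 0`)
inside the subgroup `c = 0` inside the whole group, with infinite cyclic quotients. A subgroup of
finite index meets this filtration in a triangular generating system `x ^ k`, `q = x ^ s * y ^ l`,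
`r = R t u m`. Its index is `k * l * m`, and `k, l, m` are invariant under conjugation
(`exists_eq_sub`, `IsHNF.index_eq`, `IsHNF.map_conj`, `IsHNF.params_unique`). Hence the classes of
index `n` can be counted separately for each ordered factorization `n = k * l * m`.

The isomorphism type is determined by the parities of `l`, `m`, `u` and, to tell `PiB1` from `PiB2`,
by whether a certain 2-torsion residue (`s` or `t` modulo `k`) is zero or `k / 2`; see
`IsGood.type_cases`. The five types exclude one another because they have 216, 24, 72, 36 and 12
homomorphisms to the cyclic group of order six.

For fixed `k, l, m`, conjugacy of two subgroups becomes a system of congruences between the data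
`(s, t, u)` (`IsHNF.map_conj_eq_iff` and the lemmas `IsGood.conjRel_iff_of_*`). Conjugation
translates or reflects residues, and when `k` is even a parity of `s` or `t` may have to be carried
along. Explicit representatives then give the number of classes. For the subgroups `ℤ³` conjugation
acts through a Klein four-group, and Burnside's lemma counts the orbits (`transversal_abelian`).

Each count is a polynomial in `k` and `l` whose coefficients are indicators of divisibility of `k`,
`l`, `m` by 2 and 4. Dividing the three factors by the prescribed divisors (`sum_ind_mul`) turns its
sum over all factorizations into values of `d3`, `sigma2` and `omega` at quotients of `n`. -/

namespace FlatCoverings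

/-! ### Signs -/

/-- The sign `(-1) ^ n` of an integer. -/
def sg (n : ℤ) : ℤ := if Even n then 1 else -1

theorem sg_even {n : ℤ} (h : Even n) : sg n = 1 := if_pos h

theorem sg_odd {n : ℤ} (h : Odd n) : sg n = -1 := if_neg (Int.not_even_iff_odd.2 h)

theorem sg_eq_one_or (n : ℤ) : sg n = 1 ∨ sg n = -1 := by
  rcases Int.even_or_odd n with h | h
  · exact Or.inl (sg_even h)
  · exact Or.inr (sg_odd h)

@[simp] theorem sg_zero : sg 0 = 1 := sg_even (by decide)

@[simp] theorem sg_one : sg 1 = -1 := sg_odd (by decide)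

theorem sg_add (a b : ℤ) : sg (a + b) = sg a * sg b := by
  rcases Int.even_or_odd a with ha | ha <;> rcases Int.even_or_odd b with hb | hb
  · rw [sg_even ha, sg_even hb, sg_even (ha.add hb)]; rfl
  · rw [sg_even ha, sg_odd hb, sg_odd (ha.add_odd hb)]; rfl
  · rw [sg_odd ha, sg_even hb, sg_odd (ha.add_even hb)]; rfl
  · rw [sg_odd ha, sg_odd hb, sg_even (ha.add_odd hb)]; rfl

@[simp] theorem sg_mul_self (a : ℤ) : sg a * sg a = 1 := by
  rcases sg_eq_one_or a with h | h <;> rw [h] <;> rfl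

@[simp] theorem sg_neg (a : ℤ) : sg (-a) = sg a := by
  simp [sg]

@[simp] theorem sg_sg_mul (a b : ℤ) : sg (sg a * b) = sg b := by
  rcases sg_eq_one_or a with h | h <;> simp [h]

/-! ### A model of the fundamental group of `B₄` -/

/-- The elements of the model group: the triple `(A, b, c)` stands for the isometry that acts on
the first coordinate of `ℝ³` by `t ↦ (-1) ^ (b + c) * t + A / 2`. -/
@[ext]
structure Model where
  /-- twice the translation part in the first coordinate -/
  A : ℤ
  /-- the exponent of `y` -/
  b : ℤ
  /-- the exponent of `z` -/
  c : ℤ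
  even_sub : Even (A - c)

namespace Model

theorem even_sg_mul_sub (e a : ℤ) : Even (sg e * a - a) := by
  rcases sg_eq_one_or e with h | h <;> rw [h]
  · simp
  · exact ⟨-a, by ring⟩

instance : Mul Model :=
  ⟨fun g h => ⟨g.A + sg (g.b + g.c) * h.A, g.b + sg g.c * h.b, g.c + h.c, by
    have := (g.even_sub.add h.even_sub).add (even_sg_mul_sub (g.b + g.c) h.A)
    rwa [show g.A - g.c + (h.A - h.c) + (sg (g.b + g.c) * h.A - h.A)
      = g.A + sg (g.b + g.c) * h.A - (g.c + h.c) by ring] at this⟩⟩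

instance : One Model := ⟨⟨0, 0, 0, by decide⟩⟩

instance : Inv Model :=
  ⟨fun g => ⟨-(sg (g.b + g.c) * g.A), -(sg g.c * g.b), -g.c, by
    have := (g.even_sub.add (even_sg_mul_sub (g.b + g.c) g.A)).neg
    rwa [show -(g.A - g.c + (sg (g.b + g.c) * g.A - g.A)) = -(sg (g.b + g.c) * g.A) - -g.c by
      ring] at this⟩⟩

@[simp] theorem mul_A (g h : Model) : (g * h).A = g.A + sg (g.b + g.c) * h.A := rfl
@[simp] theorem mul_b (g h : Model) : (g * h).b = g.b + sg g.c * h.b := rfl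
@[simp] theorem mul_c (g h : Model) : (g * h).c = g.c + h.c := rfl
@[simp] theorem one_A : (1 : Model).A = 0 := rfl
@[simp] theorem one_b : (1 : Model).b = 0 := rfl
@[simp] theorem one_c : (1 : Model).c = 0 := rfl
@[simp] theorem inv_A (g : Model) : (g⁻¹).A = -(sg (g.b + g.c) * g.A) := rfl
@[simp] theorem inv_b (g : Model) : (g⁻¹).b = -(sg g.c * g.b) := rfl
@[simp] theorem inv_c (g : Model) : (g⁻¹).c = -g.c := rfl

instance : Group Model := Group.ofLeftAxioms
  (fun g h k => by
    ext
    · simp only [mul_A, mul_b, mul_c, sg_add, sg_sg_mul]; ring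
    · simp only [mul_b, mul_c, sg_add]; ring
    · simp only [mul_c]; ring)
  (fun g => by ext <;> simp)
  (fun g => by ext <;> simp [sg_add])

/-- The homomorphism to `ℤ` given by the exponent of `z`. -/
def cHom : Model →* Multiplicative ℤ where
  toFun g := Multiplicative.ofAdd g.c
  map_one' := rfl
  map_mul' _ _ := rfl

@[simp] theorem zpow_c (g : Model) (n : ℤ) : (g ^ n).c = n * g.c := by
  have h := map_zpow cHom g n
  have h' := congrArg Multiplicative.toAdd h
  simpa [cHom] using h'

theorem zpow_b {g : Model} (hg : g.c = 0) (n : ℤ) : (g ^ n).b = n * g.b := by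
  induction n using Int.induction_on with
  | zero => simp
  | succ n ih => rw [zpow_add_one, mul_b, ih, zpow_c, hg]; simp; ring
  | pred n ih => rw [zpow_sub_one, mul_b, ih, zpow_c, inv_b, hg]; simp; ring

/-- When `b + c` is even, all powers of `g` preserve the x-direction, so their translation parts
simply add. -/
theorem zpow_A {g : Model} (hg : Even (g.b + g.c)) (n : ℤ) : (g ^ n).A = n * g.A := by
  have key : ∀ n : ℤ, sg ((g ^ n).b + (g ^ n).c) = 1 := by
    intro n
    induction n using Int.induction_on with
    | zero => simp
    | succ n ih => rw [zpow_add_one]; simp [sg_add] at ih ⊢; rw [← sg_even hg]; simp [sg_add];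
                   linear_combination (sg g.b * sg g.c) * ih
    | pred n ih => rw [zpow_sub_one]; simp [sg_add] at ih ⊢; rw [← sg_even hg]; simp [sg_add];
                   linear_combination (sg g.b * sg g.c) * ih
  induction n using Int.induction_on with
  | zero => simp
  | succ n ih => rw [zpow_add_one, mul_A, ih, key]; simp; ring
  | pred n ih => rw [zpow_sub_one, mul_A, ih, key, inv_A, sg_even hg]; simp; ring

end Model

/-! ### Normal forms in groups generated by three elements -/

/-- The element `g` normalizes `N`, so the join is a product set. Both inclusions are assumed
because in an infinite group `g N g⁻¹ ⊆ N` does not imply equality. -/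
theorem exists_mul_zpow_of_mem_sup {G : Type*} [Group G] {N : Subgroup G} {g : G}
    (hg : ∀ n ∈ N, g * n * g⁻¹ ∈ N) (hg' : ∀ n ∈ N, g⁻¹ * n * g ∈ N) {w : G}
    (hw : w ∈ N ⊔ Subgroup.zpowers g) : ∃ n ∈ N, ∃ j : ℤ, w = n * g ^ j := by
  have h1 : g ∈ Subgroup.normalizer (N : Set G) := by
    rw [Subgroup.mem_normalizer_iff]
    intro h
    refine ⟨hg h, fun hh => ?_⟩
    have := hg' _ hh
    simpa [mul_assoc] using this
  have h2 : Subgroup.zpowers g ≤ Subgroup.normalizer (N : Set G) := by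
    rwa [Subgroup.zpowers_le]
  have h3 : w ∈ ((N ⊔ Subgroup.zpowers g : Subgroup G) : Set G) := hw
  rw [Subgroup.coe_mul_of_right_le_normalizer_left _ _ h2] at h3
  obtain ⟨n, hn, m, ⟨j, rfl⟩, rfl⟩ := h3
  exact ⟨n, hn, j, rfl⟩

/-- If `q` and `r` normalize `⟨p⟩` and `r` normalizes `⟨p, q⟩`, then the elements of `⟨p, q, r⟩`
are the products `p ^ i * q ^ j * r ^ h`. -/
theorem exists_normal_form {G : Type*} [Group G] {p q r : G}
    (hqp : q * p * q⁻¹ = p ∨ q * p * q⁻¹ = p⁻¹) (hrp : r * p * r⁻¹ = p ∨ r * p * r⁻¹ = p⁻¹)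
    (hrq : ∃ i : ℤ, r * q * r⁻¹ = p ^ i * q ∨ r * q * r⁻¹ = p ^ i * q⁻¹) {w : G}
    (hw : w ∈ Subgroup.closure {p, q, r}) : ∃ i j h : ℤ, w = p ^ i * q ^ j * r ^ h := by
  have aux : ∀ s : G, (s * p * s⁻¹ = p ∨ s * p * s⁻¹ = p⁻¹) →
      (s⁻¹ * p * s = p ∨ s⁻¹ * p * s = p⁻¹) := by
    rintro s (h | h)
    · left; nth_rw 1 [← h]; group
    · right
      have h2 : p = s * p⁻¹ * s⁻¹ := by
        have := congrArg Inv.inv h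
        rw [inv_inv] at this
        exact this.symm.trans (by group)
      nth_rw 1 [h2]; group
  have conj_zpow : ∀ (s w : G) (i : ℤ), s * w ^ i * s⁻¹ = (s * w * s⁻¹) ^ i := by
    intro s w i; exact (conj_zpow).symm
  have hP : ∀ s : G, (s * p * s⁻¹ = p ∨ s * p * s⁻¹ = p⁻¹) →
      ∀ n ∈ Subgroup.zpowers p, s * n * s⁻¹ ∈ Subgroup.zpowers p := by
    rintro s hs n ⟨i, rfl⟩
    change s * p ^ i * s⁻¹ ∈ _
    rw [conj_zpow]
    apply Subgroup.zpow_mem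
    rcases hs with h | h <;> rw [h]
    · exact Subgroup.mem_zpowers p
    · exact inv_mem (Subgroup.mem_zpowers p)
  have hP' : ∀ s : G, (s * p * s⁻¹ = p ∨ s * p * s⁻¹ = p⁻¹) →
      ∀ n ∈ Subgroup.zpowers p, s⁻¹ * n * s ∈ Subgroup.zpowers p := by
    intro s hs n hn
    have := hP s⁻¹ (by simpa using aux s hs) n hn
    simpa using this
  set N := Subgroup.zpowers p ⊔ Subgroup.zpowers q with hN
  have hpN : p ∈ N := Subgroup.mem_sup_left (Subgroup.mem_zpowers p)
  have hqN : q ∈ N := Subgroup.mem_sup_right (Subgroup.mem_zpowers q)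
  have hNle : ∀ s : G, s * p * s⁻¹ ∈ N → s * q * s⁻¹ ∈ N → ∀ n ∈ N, s * n * s⁻¹ ∈ N := by
    intro s h1 h2
    have : N ≤ N.comap (MulAut.conj s).toMonoidHom := by
      rw [hN, sup_le_iff, Subgroup.zpowers_le, Subgroup.zpowers_le]
      exact ⟨h1, h2⟩
    exact fun n hn => this hn
  have hr1 : r * p * r⁻¹ ∈ N := by
    rcases hrp with h | h <;> rw [h]
    · exact hpN
    · exact inv_mem hpN
  have hr1' : r⁻¹ * p * r ∈ N := by
    rcases aux r hrp with h | h <;> rw [h]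
    · exact hpN
    · exact inv_mem hpN
  have hr2 : r * q * r⁻¹ ∈ N := by
    obtain ⟨i, h | h⟩ := hrq <;> rw [h]
    · exact mul_mem (zpow_mem hpN i) hqN
    · exact mul_mem (zpow_mem hpN i) (inv_mem hqN)
  have hr2' : r⁻¹ * q * r ∈ N := by
    have hpi : ∀ i : ℤ, r⁻¹ * p ^ i * r ∈ N := by
      intro i
      have := conj_zpow r⁻¹ p i
      rw [inv_inv] at this
      rw [this]
      exact zpow_mem hr1' i
    obtain ⟨i, h | h⟩ := hrq
    -- Conjugating the relation by `r⁻¹` gives `q = (r⁻¹ * p ^ i * r) * (r⁻¹ * q * r)`, which is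
    -- solved for the last factor.
    · have : r⁻¹ * q * r = (r⁻¹ * p ^ i * r)⁻¹ * q := by
        have h3 : q = r⁻¹ * (p ^ i * q) * r := by rw [← h]; group
        nth_rw 2 [h3]; group
      rw [this]; exact mul_mem (inv_mem (hpi i)) hqN
    · have : r⁻¹ * q * r = q⁻¹ * (r⁻¹ * p ^ i * r) := by
        have h3 : q = r⁻¹ * (p ^ i * q⁻¹) * r := by rw [← h]; group
        nth_rw 2 [h3]; group
      rw [this]; exact mul_mem (inv_mem hqN) (hpi i)
  have hclosure : Subgroup.closure {p, q, r} = N ⊔ Subgroup.zpowers r := by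
    rw [hN, Set.insert_eq, Set.insert_eq, Subgroup.closure_union, Subgroup.closure_union,
      ← Subgroup.zpowers_eq_closure, ← Subgroup.zpowers_eq_closure,
      ← Subgroup.zpowers_eq_closure, sup_assoc]
  rw [hclosure] at hw
  obtain ⟨n, hn, h, rfl⟩ := exists_mul_zpow_of_mem_sup (hNle r hr1 hr2)
    (by simpa using hNle r⁻¹ (by simpa using hr1') (by simpa using hr2')) hw
  obtain ⟨_, ⟨i, rfl⟩, j, rfl⟩ := exists_mul_zpow_of_mem_sup (hP q hqp) (hP' q hqp) hn
  exact ⟨i, j, h, rfl⟩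

/-! ### Recognizing the five groups by generators and relations -/

theorem range_toGroup {rels : Set (FreeGroup (Fin 3))} {G : Type*} [Group G] (v : Fin 3 → G)
    (h : ∀ w ∈ rels, FreeGroup.lift v w = 1) :
    (PresentedGroup.toGroup h).range = Subgroup.closure {v 0, v 1, v 2} := by
  rw [MonoidHom.range_eq_map, ← PresentedGroup.closure_range_of, MonoidHom.map_closure]
  congr 1
  ext g
  simp only [Set.mem_image, Set.mem_range, Set.mem_insert_iff, Set.mem_singleton_iff]
  constructor
  · rintro ⟨_, ⟨i, rfl⟩, rfl⟩
    rw [PresentedGroup.toGroup.of]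
    fin_cases i <;> simp
  · rintro (rfl | rfl | rfl)
    exacts [⟨_, ⟨0, rfl⟩, PresentedGroup.toGroup.of h⟩, ⟨_, ⟨1, rfl⟩, PresentedGroup.toGroup.of h⟩,
      ⟨_, ⟨2, rfl⟩, PresentedGroup.toGroup.of h⟩]

/-- The normal form describes every element of the presented group by three exponents, and the
independence of the images forces the exponents of a kernel element to vanish. Uniqueness of the
normal form in the presented group is thus not needed in advance. -/
theorem toGroup_injective {rels : Set (FreeGroup (Fin 3))} {G : Type*} [Group G] (v : Fin 3 → G)
    (h : ∀ w ∈ rels, FreeGroup.lift v w = 1)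
    (nf : ∀ w : PresentedGroup rels, ∃ i j l : ℤ, w = PresentedGroup.of 0 ^ i *
      PresentedGroup.of 1 ^ j * PresentedGroup.of 2 ^ l)
    (ind : ∀ i j l : ℤ, v 0 ^ i * v 1 ^ j * v 2 ^ l = 1 → i = 0 ∧ j = 0 ∧ l = 0) :
    Function.Injective (PresentedGroup.toGroup h) := by
  rw [injective_iff_map_eq_one]
  intro w hw
  obtain ⟨i, j, l, rfl⟩ := nf w
  simp only [map_mul, map_zpow, PresentedGroup.toGroup.of] at hw
  obtain ⟨rfl, rfl, rfl⟩ := ind i j l hw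
  simp

theorem closure_of_eq_top (rels : Set (FreeGroup (Fin 3))) :
    Subgroup.closure ({PresentedGroup.of 0, PresentedGroup.of 1, PresentedGroup.of 2} :
      Set (PresentedGroup rels)) = ⊤ := by
  rw [← PresentedGroup.closure_range_of]
  congr 1
  ext g
  simp only [Set.mem_range, Set.mem_insert_iff, Set.mem_singleton_iff, Fin.exists_fin_succ,
    Fin.exists_fin_zero, eq_comm]
  simp

theorem presented_normal_form {rels : Set (FreeGroup (Fin 3))}
    (h1 : (PresentedGroup.of 1 * PresentedGroup.of 0 * (PresentedGroup.of 1)⁻¹ :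
        PresentedGroup rels) = PresentedGroup.of 0 ∨
      (PresentedGroup.of 1 * PresentedGroup.of 0 * (PresentedGroup.of 1)⁻¹ :
        PresentedGroup rels) = (PresentedGroup.of 0)⁻¹)
    (h2 : (PresentedGroup.of 2 * PresentedGroup.of 0 * (PresentedGroup.of 2)⁻¹ :
        PresentedGroup rels) = PresentedGroup.of 0 ∨
      (PresentedGroup.of 2 * PresentedGroup.of 0 * (PresentedGroup.of 2)⁻¹ :
        PresentedGroup rels) = (PresentedGroup.of 0)⁻¹)
    (h3 : ∃ i : ℤ, (PresentedGroup.of 2 * PresentedGroup.of 1 * (PresentedGroup.of 2)⁻¹ :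
        PresentedGroup rels) = PresentedGroup.of 0 ^ i * PresentedGroup.of 1 ∨
      (PresentedGroup.of 2 * PresentedGroup.of 1 * (PresentedGroup.of 2)⁻¹ :
        PresentedGroup rels) = PresentedGroup.of 0 ^ i * (PresentedGroup.of 1)⁻¹)
    (w : PresentedGroup rels) : ∃ i j l : ℤ, w = PresentedGroup.of 0 ^ i *
      PresentedGroup.of 1 ^ j * PresentedGroup.of 2 ^ l :=
  exists_normal_form h1 h2 h3 (by rw [closure_of_eq_top]; exact Subgroup.mem_top w)

theorem presented_rel {rels : Set (FreeGroup (Fin 3))} {u v : FreeGroup (Fin 3)}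
    (h : relator u v ∈ rels) : PresentedGroup.mk rels u = PresentedGroup.mk rels v :=
  PresentedGroup.mk_eq_mk_of_mul_inv_mem h

theorem nonempty_mulEquiv_closure {rels : Set (FreeGroup (Fin 3))} {G : Type*} [Group G]
    (v : Fin 3 → G) (h : ∀ w ∈ rels, FreeGroup.lift v w = 1)
    (nf : ∀ w : PresentedGroup rels, ∃ i j l : ℤ, w = PresentedGroup.of 0 ^ i *
      PresentedGroup.of 1 ^ j * PresentedGroup.of 2 ^ l)
    (ind : ∀ i j l : ℤ, v 0 ^ i * v 1 ^ j * v 2 ^ l = 1 → i = 0 ∧ j = 0 ∧ l = 0)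
    {Δ : Subgroup G} (hΔ : Δ = Subgroup.closure {v 0, v 1, v 2}) :
    Nonempty (Δ ≃* PresentedGroup rels) := by
  rw [← range_toGroup v h] at hΔ
  subst hΔ
  exact ⟨(MonoidHom.ofInjective (toGroup_injective v h nf ind)).symm⟩

theorem piG2_normal_form (w : PiG2) : ∃ i j l : ℤ, w = PresentedGroup.of 0 ^ i *
    PresentedGroup.of 1 ^ j * PresentedGroup.of 2 ^ l := by
  apply presented_normal_form
  · left
    have := presented_rel (rels := ({relator (genX * genY * genX⁻¹ * genY⁻¹) 1,
      relator (genZ * genX * genZ⁻¹) genX⁻¹,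
      relator (genZ * genY * genZ⁻¹) genY⁻¹} : Set (FreeGroup (Fin 3)))) (.inl rfl)
    simp only [map_mul, map_inv, map_one] at this
    rw [mul_inv_eq_one, mul_inv_eq_iff_eq_mul] at this
    exact mul_inv_eq_iff_eq_mul.2 this.symm
  · right
    exact presented_rel (.inr (.inl rfl))
  · refine ⟨0, .inr ?_⟩
    rw [zpow_zero, one_mul]
    exact presented_rel (.inr (.inr rfl))

theorem piB1_normal_form (w : PiB1) : ∃ i j l : ℤ, w = PresentedGroup.of 0 ^ i *
    PresentedGroup.of 1 ^ j * PresentedGroup.of 2 ^ l := by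
  apply presented_normal_form
  · left
    have := presented_rel (rels := ({relator (genX * genY * genX⁻¹ * genY⁻¹) 1,
      relator (genY * genZ * genY⁻¹ * genZ⁻¹) 1,
      relator (genZ * genX * genZ⁻¹) genX⁻¹} : Set (FreeGroup (Fin 3)))) (.inl rfl)
    simp only [map_mul, map_inv, map_one] at this
    rw [mul_inv_eq_one, mul_inv_eq_iff_eq_mul] at this
    exact mul_inv_eq_iff_eq_mul.2 this.symm
  · right
    exact presented_rel (.inr (.inr rfl))
  · refine ⟨0, .inl ?_⟩
    rw [zpow_zero, one_mul]
    have := presented_rel (rels := ({relator (genX * genY * genX⁻¹ * genY⁻¹) 1,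
      relator (genY * genZ * genY⁻¹ * genZ⁻¹) 1,
      relator (genZ * genX * genZ⁻¹) genX⁻¹} : Set (FreeGroup (Fin 3)))) (.inr (.inl rfl))
    simp only [map_mul, map_inv, map_one] at this
    rw [mul_inv_eq_one, mul_inv_eq_iff_eq_mul] at this
    exact mul_inv_eq_iff_eq_mul.2 this.symm

theorem piB2_normal_form (w : PiB2) : ∃ i j l : ℤ, w = PresentedGroup.of 0 ^ i *
    PresentedGroup.of 1 ^ j * PresentedGroup.of 2 ^ l := by
  apply presented_normal_form
  · left
    have := presented_rel (rels := ({relator (genX * genY * genX⁻¹ * genY⁻¹) 1,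
      relator (genZ * genX * genZ⁻¹) genX⁻¹,
      relator (genZ * genY * genZ⁻¹) (genX * genY)} : Set (FreeGroup (Fin 3)))) (.inl rfl)
    simp only [map_mul, map_inv, map_one] at this
    rw [mul_inv_eq_one, mul_inv_eq_iff_eq_mul] at this
    exact mul_inv_eq_iff_eq_mul.2 this.symm
  · right
    exact presented_rel (.inr (.inl rfl))
  · refine ⟨1, .inl ?_⟩
    rw [zpow_one]
    exact presented_rel (.inr (.inr rfl))

theorem piB4_normal_form (w : PiB4) : ∃ i j l : ℤ, w = PresentedGroup.of 0 ^ i *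
    PresentedGroup.of 1 ^ j * PresentedGroup.of 2 ^ l := by
  apply presented_normal_form
  · right
    exact presented_rel (.inl rfl)
  · right
    exact presented_rel (.inr (.inl rfl))
  · refine ⟨1, .inr ?_⟩
    rw [zpow_one]
    exact presented_rel (.inr (.inr rfl))

section Recognition

variable {G : Type*} [Group G] {Δ : Subgroup G} {a b c : G}

theorem nonempty_mulEquiv_piG2 (h1 : a * b = b * a) (h2 : c * a * c⁻¹ = a⁻¹)
    (h3 : c * b * c⁻¹ = b⁻¹)
    (ind : ∀ i j l : ℤ, a ^ i * b ^ j * c ^ l = 1 → i = 0 ∧ j = 0 ∧ l = 0)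
    (hΔ : Δ = Subgroup.closure {a, b, c}) : Nonempty (Δ ≃* PiG2) := by
  refine nonempty_mulEquiv_closure ![a, b, c] ?_ piG2_normal_form ind hΔ
  rintro w (rfl | rfl | rfl)
  · simp [relator, h1]
  · simp [relator, h2]
  · simp [relator, h3]

theorem nonempty_mulEquiv_piB1 (h1 : a * b = b * a) (h2 : b * c = c * b)
    (h3 : c * a * c⁻¹ = a⁻¹)
    (ind : ∀ i j l : ℤ, a ^ i * b ^ j * c ^ l = 1 → i = 0 ∧ j = 0 ∧ l = 0)
    (hΔ : Δ = Subgroup.closure {a, b, c}) : Nonempty (Δ ≃* PiB1) := by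
  refine nonempty_mulEquiv_closure ![a, b, c] ?_ piB1_normal_form ind hΔ
  rintro w (rfl | rfl | rfl)
  · simp [relator, h1]
  · simp [relator, h2]
  · simp [relator, h3]

theorem nonempty_mulEquiv_piB2 (h1 : a * b = b * a) (h2 : c * a * c⁻¹ = a⁻¹)
    (h3 : c * b * c⁻¹ = a * b)
    (ind : ∀ i j l : ℤ, a ^ i * b ^ j * c ^ l = 1 → i = 0 ∧ j = 0 ∧ l = 0)
    (hΔ : Δ = Subgroup.closure {a, b, c}) : Nonempty (Δ ≃* PiB2) := by
  refine nonempty_mulEquiv_closure ![a, b, c] ?_ piB2_normal_form ind hΔ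
  rintro w (rfl | rfl | rfl)
  · simp [relator, h1]
  · simp [relator, h2]
  · simp [relator, h3]

theorem nonempty_mulEquiv_piB4 (h1 : b * a * b⁻¹ = a⁻¹) (h2 : c * a * c⁻¹ = a⁻¹)
    (h3 : c * b * c⁻¹ = a * b⁻¹)
    (ind : ∀ i j l : ℤ, a ^ i * b ^ j * c ^ l = 1 → i = 0 ∧ j = 0 ∧ l = 0)
    (hΔ : Δ = Subgroup.closure {a, b, c}) : Nonempty (Δ ≃* PiB4) := by
  refine nonempty_mulEquiv_closure ![a, b, c] ?_ piB4_normal_form ind hΔ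
  rintro w (rfl | rfl | rfl)
  · simp [relator, h1]
  · simp [relator, h2]
  · simp [relator, h3]

/-- `PiG1` is not given by a presentation, so the isomorphism is written out on exponent vectors. -/
theorem nonempty_mulEquiv_piG1 (h1 : a * b = b * a) (h2 : a * c = c * a) (h3 : b * c = c * b)
    (ind : ∀ i j l : ℤ, a ^ i * b ^ j * c ^ l = 1 → i = 0 ∧ j = 0 ∧ l = 0)
    (hΔ : Δ = Subgroup.closure {a, b, c}) : Nonempty (Δ ≃* PiG1) := by
  let φ : PiG1 →* G :=
    { toFun := fun f => a ^ (f.toAdd 0) * b ^ (f.toAdd 1) * c ^ (f.toAdd 2)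
      map_one' := by simp
      map_mul' := by
        intro f g
        have e1 : ∀ i j : ℤ, a ^ i * b ^ j = b ^ j * a ^ i := fun i j =>
          (Commute.zpow_zpow h1 i j)
        have e2 : ∀ i j : ℤ, a ^ i * c ^ j = c ^ j * a ^ i := fun i j =>
          (Commute.zpow_zpow h2 i j)
        have e3 : ∀ i j : ℤ, b ^ i * c ^ j = c ^ j * b ^ i := fun i j =>
          (Commute.zpow_zpow h3 i j)
        simp only [toAdd_mul, Pi.add_apply, zpow_add]
        calc _ = a ^ f.toAdd 0 * (a ^ g.toAdd 0 * b ^ f.toAdd 1) * b ^ g.toAdd 1 *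
              c ^ f.toAdd 2 * c ^ g.toAdd 2 := by simp only [mul_assoc]
          _ = a ^ f.toAdd 0 * b ^ f.toAdd 1 * a ^ g.toAdd 0 * (b ^ g.toAdd 1 *
              c ^ f.toAdd 2) * c ^ g.toAdd 2 := by rw [e1]; simp only [mul_assoc]
          _ = a ^ f.toAdd 0 * b ^ f.toAdd 1 * (a ^ g.toAdd 0 * c ^ f.toAdd 2) * b ^ g.toAdd 1 *
              c ^ g.toAdd 2 := by rw [e3]; simp only [mul_assoc]
          _ = _ := by rw [e2]; simp only [mul_assoc] }
  have hinj : Function.Injective φ := by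
    rw [injective_iff_map_eq_one]
    intro f hf
    obtain ⟨h0, h1, h2⟩ := ind _ _ _ hf
    apply Multiplicative.toAdd.injective
    ext i
    fin_cases i
    exacts [h0, h1, h2]
  have hr : φ.range = Δ := by
    rw [hΔ]
    apply le_antisymm
    · rintro _ ⟨f, rfl⟩
      have ha : a ∈ Subgroup.closure {a, b, c} := Subgroup.subset_closure (by simp)
      have hb : b ∈ Subgroup.closure {a, b, c} := Subgroup.subset_closure (by simp)
      have hc : c ∈ Subgroup.closure {a, b, c} := Subgroup.subset_closure (by simp)
      exact mul_mem (mul_mem (zpow_mem ha _) (zpow_mem hb _)) (zpow_mem hc _)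
    · rw [Subgroup.closure_le]
      rintro _ (rfl | rfl | rfl)
      · exact ⟨Multiplicative.ofAdd ![1, 0, 0], by simp [φ]⟩
      · exact ⟨Multiplicative.ofAdd ![0, 1, 0], by simp [φ]⟩
      · exact ⟨Multiplicative.ofAdd ![0, 0, 1], by simp [φ]⟩
  rw [← hr]
  exact ⟨(MonoidHom.ofInjective hinj).symm⟩

end Recognition

/-! ### The five groups are pairwise non-isomorphic -/

/-- The number of homomorphisms to the cyclic group of order six. -/
noncomputable def numCharacters (H : Type*) [Group H] : ℕ := Nat.card (H →* Multiplicative (ZMod 6))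

/-- The abelianizations of the five groups are `ℤ³`, `ℤ ⊕ (ℤ/2)²`, `ℤ² ⊕ ℤ/2`, `ℤ²` and `ℤ ⊕ ℤ/4`.
Characters of order 3 detect the rank and those of order 2 detect the 2-torsion as well. Neither
prime alone separates the groups, but order six does. -/
theorem numCharacters_congr {H K : Type*} [Group H] [Group K] (e : H ≃* K) :
    numCharacters H = numCharacters K :=
  Nat.card_congr ⟨fun f => f.comp e.symm.toMonoidHom, fun f => f.comp e.toMonoidHom,
    fun f => by ext; simp, fun f => by ext; simp⟩

theorem numCharacters_presentedGroup (rels : Set (FreeGroup (Fin 3))) :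
    numCharacters (PresentedGroup rels) = Nat.card {v : Fin 3 → Multiplicative (ZMod 6) //
      ∀ w ∈ rels, FreeGroup.lift v w = 1} := by
  refine Nat.card_congr ⟨fun f => ⟨fun i => f (PresentedGroup.of i), fun w hw => ?_⟩,
    fun v => PresentedGroup.toGroup v.2, fun f => ?_, fun v => ?_⟩
  · have : FreeGroup.lift (fun i => f (PresentedGroup.of i)) = f.comp (PresentedGroup.mk rels) := by
      ext; simp [PresentedGroup.of]
    rw [this, MonoidHom.comp_apply, PresentedGroup.one_of_mem hw, map_one]
  · ext; simp
  · ext; simp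

theorem numCharacters_piG1 : numCharacters PiG1 = 216 := by
  have e : (PiG1 →* Multiplicative (ZMod 6)) ≃ (Fin 3 → ZMod 6) :=
    (AddMonoidHom.toMultiplicative (α := Fin 3 → ℤ) (β := ZMod 6)).symm.trans
      ((addMonoidHomLequivInt ℤ (A := Fin 3 → ℤ) (B := ZMod 6)).toEquiv.trans
        ((Pi.basisFun ℤ (Fin 3)).constr ℤ).symm.toEquiv)
  rw [numCharacters, Nat.card_congr e]
  simp

theorem numCharacters_piG2 : numCharacters PiG2 = 24 := by
  have : ∀ v : Fin 3 → Multiplicative (ZMod 6),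
      (∀ w ∈ ({relator (genX * genY * genX⁻¹ * genY⁻¹) 1, relator (genZ * genX * genZ⁻¹) genX⁻¹,
        relator (genZ * genY * genZ⁻¹) genY⁻¹} : Set (FreeGroup (Fin 3))),
        FreeGroup.lift v w = 1) ↔ v 0 ^ 2 = 1 ∧ v 1 ^ 2 = 1 := by
    intro v
    simp only [relator, Set.mem_insert_iff, Set.mem_singleton_iff, forall_eq_or_imp, forall_eq,
      map_mul, map_inv, map_one, FreeGroup.lift_apply_of]
    generalize v 0 = a
    generalize v 1 = b
    generalize v 2 = c
    -- What remains is an assertion about the 216 triples of residues modulo 6.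
    revert a b c
    decide +kernel
  rw [numCharacters_presentedGroup]
  simp_rw [this]
  rw [Nat.card_eq_fintype_card]
  decide +kernel

theorem numCharacters_piB1 : numCharacters PiB1 = 72 := by
  have : ∀ v : Fin 3 → Multiplicative (ZMod 6),
      (∀ w ∈ ({relator (genX * genY * genX⁻¹ * genY⁻¹) 1,
        relator (genY * genZ * genY⁻¹ * genZ⁻¹) 1,
        relator (genZ * genX * genZ⁻¹) genX⁻¹} : Set (FreeGroup (Fin 3))),
        FreeGroup.lift v w = 1) ↔ v 0 ^ 2 = 1 := by
    intro v
    simp only [relator, Set.mem_insert_iff, Set.mem_singleton_iff, forall_eq_or_imp, forall_eq,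
      map_mul, map_inv, map_one, FreeGroup.lift_apply_of]
    generalize v 0 = a
    generalize v 1 = b
    generalize v 2 = c
    revert a b c
    decide +kernel
  rw [numCharacters_presentedGroup]
  simp_rw [this]
  rw [Nat.card_eq_fintype_card]
  decide +kernel

theorem numCharacters_piB2 : numCharacters PiB2 = 36 := by
  have : ∀ v : Fin 3 → Multiplicative (ZMod 6),
      (∀ w ∈ ({relator (genX * genY * genX⁻¹ * genY⁻¹) 1, relator (genZ * genX * genZ⁻¹) genX⁻¹,
        relator (genZ * genY * genZ⁻¹) (genX * genY)} : Set (FreeGroup (Fin 3))),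
        FreeGroup.lift v w = 1) ↔ v 0 = 1 := by
    intro v
    simp only [relator, Set.mem_insert_iff, Set.mem_singleton_iff, forall_eq_or_imp, forall_eq,
      map_mul, map_inv, map_one, FreeGroup.lift_apply_of]
    generalize v 0 = a
    generalize v 1 = b
    generalize v 2 = c
    revert a b c
    decide +kernel
  rw [numCharacters_presentedGroup]
  simp_rw [this]
  rw [Nat.card_eq_fintype_card]
  decide +kernel

theorem numCharacters_piB4 : numCharacters PiB4 = 12 := by
  have : ∀ v : Fin 3 → Multiplicative (ZMod 6),
      (∀ w ∈ ({relator (genY * genX * genY⁻¹) genX⁻¹, relator (genZ * genX * genZ⁻¹) genX⁻¹,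
        relator (genZ * genY * genZ⁻¹) (genX * genY⁻¹)} : Set (FreeGroup (Fin 3))),
        FreeGroup.lift v w = 1) ↔ v 0 ^ 2 = 1 ∧ v 1 ^ 2 = v 0 := by
    intro v
    simp only [relator, Set.mem_insert_iff, Set.mem_singleton_iff, forall_eq_or_imp, forall_eq,
      map_mul, map_inv, FreeGroup.lift_apply_of]
    generalize v 0 = a
    generalize v 1 = b
    generalize v 2 = c
    revert a b c
    decide +kernel
  rw [numCharacters_presentedGroup]
  simp_rw [this]
  rw [Nat.card_eq_fintype_card]
  decide +kernel

namespace Model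

/-! ### Triangular generating systems of subgroups of the model -/

/-- The translation `x ^ k`. -/
def P (k : ℤ) : Model := ⟨2 * k, 0, 0, ⟨k, by ring⟩⟩

/-- The element `x ^ s * y ^ l`. -/
def Q (s l : ℤ) : Model := ⟨2 * s, l, 0, ⟨s, by ring⟩⟩

/-- The general element with exponent `m` of `z`. -/
def R (t u m : ℤ) : Model := ⟨2 * t + m % 2, u, m, by
  rw [Int.even_iff]; omega⟩

@[simp] theorem P_A (k : ℤ) : (P k).A = 2 * k := rfl
@[simp] theorem P_b (k : ℤ) : (P k).b = 0 := rfl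
@[simp] theorem P_c (k : ℤ) : (P k).c = 0 := rfl
@[simp] theorem Q_A (s l : ℤ) : (Q s l).A = 2 * s := rfl
@[simp] theorem Q_b (s l : ℤ) : (Q s l).b = l := rfl
@[simp] theorem Q_c (s l : ℤ) : (Q s l).c = 0 := rfl
@[simp] theorem R_A (t u m : ℤ) : (R t u m).A = 2 * t + m % 2 := rfl
@[simp] theorem R_b (t u m : ℤ) : (R t u m).b = u := rfl
@[simp] theorem R_c (t u m : ℤ) : (R t u m).c = m := rfl

theorem P_zpow (k n : ℤ) : P k ^ n = P (n * k) := by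
  ext
  · rw [zpow_A (by simp)]; simp; ring
  · rw [zpow_b (by simp)]; simp
  · rw [zpow_c]; simp

theorem conj_A (g h : Model) :
    (g * h * g⁻¹).A = g.A * (1 - sg (h.b + h.c)) + sg (g.b + g.c) * h.A := by
  simp only [mul_A, mul_b, mul_c, inv_A, sg_add, sg_sg_mul]
  linear_combination (-g.A * sg h.b * sg h.c) * sg_mul_self g.b +
    (-g.A * sg h.b * sg h.c * sg g.b * sg g.b) * sg_mul_self g.c

theorem conj_b (g h : Model) : (g * h * g⁻¹).b = g.b * (1 - sg h.c) + sg g.c * h.b := by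
  simp only [mul_b, mul_c, inv_b, sg_add]
  linear_combination (-g.b * sg h.c) * sg_mul_self g.c

theorem conj_c (g h : Model) : (g * h * g⁻¹).c = h.c := by simp

/-- If the `z`-exponents of `g` and `h` vanish modulo the same element and the `y`-exponents
agree, then `g * h⁻¹` is a translation in the direction of `x`. -/
theorem mul_inv_A {g h : Model} (hb : g.b = h.b) (hc : g.c = h.c) : (g * h⁻¹).A = g.A - h.A := by
  simp only [mul_A, inv_A, hb, hc]
  linear_combination (-h.A) * sg_mul_self (h.b + h.c)

theorem mul_inv_b {g h : Model} (hc : g.c = h.c) : (g * h⁻¹).b = g.b - h.b := by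
  simp only [mul_b, inv_b, hc]
  linear_combination (-h.b) * sg_mul_self h.c

theorem mul_inv_c (g h : Model) : (g * h⁻¹).c = g.c - h.c := by
  simp [sub_eq_add_neg]

theorem eq_P_of {g : Model} {k : ℤ} (hb : g.b = 0) (hc : g.c = 0) (hA : 2 * k ∣ g.A) :
    ∃ i : ℤ, g = P k ^ i := by
  obtain ⟨i, hi⟩ := hA
  refine ⟨i, ?_⟩
  rw [P_zpow]
  ext
  · rw [hi, P_A]; ring
  · simp [hb]
  · simp [hc]

theorem independent {k : ℤ} {q r : Model} (hk : k ≠ 0) (hqb : q.b ≠ 0) (hqc : q.c = 0)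
    (hrc : r.c ≠ 0) (i j h : ℤ) (e : P k ^ i * q ^ j * r ^ h = 1) : i = 0 ∧ j = 0 ∧ h = 0 := by
  have hc := congrArg Model.c e
  simp [hqc] at hc
  obtain rfl : h = 0 := hc.resolve_right hrc
  have hb := congrArg Model.b e
  rw [P_zpow] at hb
  simp [zpow_b hqc] at hb
  obtain rfl : j = 0 := hb.resolve_right hqb
  have hA := congrArg Model.A e
  rw [P_zpow] at hA
  simp at hA
  exact ⟨hA.resolve_right hk, rfl, rfl⟩

end Model

open Model

/-- The elements `x ^ k`, `q` and `r` form a triangular generating system of `Δ`. -/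
structure IsHNF (Δ : Subgroup Model) (k l m : ℕ) (q r : Model) : Prop where
  k_pos : 0 < k
  l_pos : 0 < l
  m_pos : 0 < m
  q_b : q.b = l
  q_c : q.c = 0
  r_c : r.c = m
  p_mem : P k ∈ Δ
  q_mem : q ∈ Δ
  r_mem : r ∈ Δ
  c_dvd : ∀ g ∈ Δ, (m : ℤ) ∣ g.c
  b_dvd : ∀ g ∈ Δ, g.c = 0 → (l : ℤ) ∣ g.b
  A_dvd : ∀ g ∈ Δ, g.c = 0 → g.b = 0 → 2 * (k : ℤ) ∣ g.A

theorem exists_pos_generator (H : AddSubgroup ℤ) {a : ℤ} (ha : a ∈ H) (h0 : a ≠ 0) :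
    ∃ m : ℕ, 0 < m ∧ (m : ℤ) ∈ H ∧ ∀ x ∈ H, (m : ℤ) ∣ x := by
  obtain ⟨g, hg⟩ := Int.subgroup_cyclic H
  rw [← AddSubgroup.zmultiples_eq_closure] at hg
  refine ⟨g.natAbs, ?_, ?_, ?_⟩
  · rw [Int.natAbs_pos]
    rintro rfl
    rw [hg] at ha
    simp at ha
    exact h0 ha
  · have : g ∈ H := by rw [hg]; exact AddSubgroup.mem_zmultiples g
    rcases Int.natAbs_eq g with h | h
    · rwa [← h]
    · have h2 := neg_mem this
      rwa [h, neg_neg] at h2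
  · intro x hx
    rw [hg, Int.mem_zmultiples_iff] at hx
    exact Int.natAbs_dvd.2 hx

namespace IsHNF

variable {Δ Δ' : Subgroup Model} {k l m k' l' m' : ℕ} {q r q' r' : Model}

/-- The subgroups `C`, `B`, `A` of `ℤ` are the images of `Δ` in the three cyclic quotients of the
filtration. Finite index makes each of them nonzero, since `Δ` contains a positive power of each of
x, y and z. -/
theorem exists_of_index_ne_zero (hΔ : Δ.index ≠ 0) : ∃ k l m q r, IsHNF Δ k l m q r := by
  let C : AddSubgroup ℤ :=
    { carrier := {c | ∃ g ∈ Δ, g.c = c}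
      add_mem' := by
        rintro _ _ ⟨g, hg, rfl⟩ ⟨h, hh, rfl⟩
        exact ⟨g * h, mul_mem hg hh, rfl⟩
      zero_mem' := ⟨1, one_mem _, rfl⟩
      neg_mem' := by
        rintro _ ⟨g, hg, rfl⟩
        exact ⟨g⁻¹, inv_mem hg, rfl⟩ }
  let B : AddSubgroup ℤ :=
    { carrier := {b | ∃ g ∈ Δ, g.c = 0 ∧ g.b = b}
      add_mem' := by
        rintro _ _ ⟨g, hg, hgc, rfl⟩ ⟨h, hh, hhc, rfl⟩
        exact ⟨g * h, mul_mem hg hh, by simp [hgc, hhc], by simp [hgc]⟩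
      zero_mem' := ⟨1, one_mem _, rfl, rfl⟩
      neg_mem' := by
        rintro _ ⟨g, hg, hgc, rfl⟩
        exact ⟨g⁻¹, inv_mem hg, by simp [hgc], by simp [hgc]⟩ }
  let A : AddSubgroup ℤ :=
    { carrier := {a | ∃ g ∈ Δ, g.c = 0 ∧ g.b = 0 ∧ g.A = 2 * a}
      add_mem' := by
        rintro a b ⟨g, hg, hgc, hgb, hgA⟩ ⟨h, hh, hhc, hhb, hhA⟩
        exact ⟨g * h, mul_mem hg hh, by simp [hgc, hhc], by simp [hgb, hhb],
          by simp [hgb, hgc, hgA, hhA]; ring⟩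
      zero_mem' := ⟨1, one_mem _, rfl, rfl, rfl⟩
      neg_mem' := by
        rintro a ⟨g, hg, hgc, hgb, hgA⟩
        exact ⟨g⁻¹, inv_mem hg, by simp [hgc], by simp [hgb], by simp [hgb, hgc, hgA]⟩ }
  obtain ⟨a, ha0, -, ha⟩ := Subgroup.exists_pow_mem_of_index_ne_zero hΔ (P 1)
  obtain ⟨b, hb0, -, hb⟩ := Subgroup.exists_pow_mem_of_index_ne_zero hΔ (Q 0 1)
  obtain ⟨c, hc0, -, hc⟩ := Subgroup.exists_pow_mem_of_index_ne_zero hΔ (R 0 0 1)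
  rw [← zpow_natCast] at ha hb hc
  obtain ⟨m, hm0, ⟨r, hr, hrc⟩, hm⟩ := exists_pos_generator C (a := c)
    ⟨_, hc, by rw [zpow_c]; simp⟩ (by exact_mod_cast hc0.ne')
  obtain ⟨l, hl0, ⟨q, hq, hqc, hqb⟩, hl⟩ := exists_pos_generator B (a := b)
    ⟨_, hb, by rw [zpow_c]; simp, by rw [zpow_b (by simp)]; simp⟩ (by exact_mod_cast hb0.ne')
  obtain ⟨k, hk0, ⟨p, hp, hpc, hpb, hpA⟩, hk⟩ := exists_pos_generator A (a := a)
    ⟨_, ha, by rw [P_zpow]; simp, by rw [P_zpow]; simp, by rw [P_zpow]; simp⟩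
    (by exact_mod_cast ha0.ne')
  refine ⟨k, l, m, q, r, hk0, hl0, hm0, hqb, hqc, hrc, ?_, hq, hr, fun g hg => hm _ ⟨g, hg, rfl⟩,
    fun g hg hgc => hl _ ⟨g, hg, hgc, rfl⟩, fun g hg hgc hgb => ?_⟩
  · convert hp
    ext
    · simp [hpA]
    · simp [hpb]
    · simp [hpc]
  · have h2 := g.even_sub
    rw [hgc, sub_zero] at h2
    obtain ⟨a, ha⟩ := h2.two_dvd
    rw [ha]
    exact mul_dvd_mul_left 2 (hk a ⟨g, hg, hgc, hgb, ha⟩)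

theorem mem_iff_of_b_c_eq_zero (h : IsHNF Δ k l m q r) {w : Model} (hb : w.b = 0) (hc : w.c = 0) :
    w ∈ Δ ↔ 2 * (k : ℤ) ∣ w.A := by
  refine ⟨fun hw => h.A_dvd w hw hc hb, fun hw => ?_⟩
  obtain ⟨i, rfl⟩ := eq_P_of hb hc hw
  exact zpow_mem h.p_mem i

theorem mem_iff_of_b_c_eq (h : IsHNF Δ k l m q r) {v w : Model} (hv : v ∈ Δ) (hb : w.b = v.b)
    (hc : w.c = v.c) : w ∈ Δ ↔ 2 * (k : ℤ) ∣ w.A - v.A := by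
  rw [← mul_inv_A hb hc, ← h.mem_iff_of_b_c_eq_zero (by rw [mul_inv_b hc, hb, sub_self])
    (by rw [mul_inv_c, hc, sub_self])]
  exact (Subgroup.mul_mem_cancel_right Δ (inv_mem hv)).symm

/-- An element of `Δ` with the same z-exponent as `r` differs from it by an element with `c = 0`.
Its y-exponent then fixes the number `j` of factors `q`, and what is left is a translation along x.
-/
theorem mem_iff_of_c_eq (h : IsHNF Δ k l m q r) {w : Model} (hc : w.c = m) :
    w ∈ Δ ↔ ∃ j : ℤ, w.b = r.b + j * l ∧ 2 * (k : ℤ) ∣ w.A - (q ^ j * r).A := by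
  have hb : ∀ j : ℤ, (q ^ j * r).b = r.b + j * l := by
    intro j
    simp [zpow_b h.q_c, h.q_c, h.q_b, add_comm]
  have hcj : ∀ j : ℤ, (q ^ j * r).c = m := by
    intro j
    simp [h.q_c, h.r_c]
  have hmem : ∀ j : ℤ, q ^ j * r ∈ Δ := fun j => mul_mem (zpow_mem h.q_mem j) h.r_mem
  constructor
  · intro hw
    obtain ⟨j, hj⟩ := h.b_dvd _ (mul_mem hw (inv_mem h.r_mem))
      (by rw [mul_inv_c, hc, h.r_c, sub_self])
    rw [mul_inv_b (by rw [hc, h.r_c])] at hj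
    have hwb : w.b = r.b + j * l := by linear_combination hj
    exact ⟨j, hwb, (h.mem_iff_of_b_c_eq (hmem j) (by rw [hwb, hb]) (by rw [hc, hcj])).1 hw⟩
  · rintro ⟨j, hwb, hA⟩
    exact (h.mem_iff_of_b_c_eq (hmem j) (by rw [hwb, hb]) (by rw [hc, hcj])).2 hA

/-- Division by `m`, `l` and `k` in turn: powers of `r`, of `q` and of `x ^ k` are split off from an
element of `Δ` until nothing remains. -/
theorem eq_closure (h : IsHNF Δ k l m q r) : Δ = Subgroup.closure {P k, q, r} := by
  apply le_antisymm
  · intro g hg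
    obtain ⟨a, ha⟩ := h.c_dvd g hg
    have h1 : g * (r ^ a)⁻¹ ∈ Δ := mul_mem hg (inv_mem (zpow_mem h.r_mem a))
    have c1 : (g * (r ^ a)⁻¹).c = 0 := by rw [mul_inv_c, zpow_c, h.r_c, ha]; ring
    obtain ⟨j, hj⟩ := h.b_dvd _ h1 c1
    have h2 : g * (r ^ a)⁻¹ * (q ^ j)⁻¹ ∈ Δ := mul_mem h1 (inv_mem (zpow_mem h.q_mem j))
    have c2 : (g * (r ^ a)⁻¹).c = (q ^ j).c := by rw [c1, zpow_c, h.q_c, mul_zero]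
    have b2 : (g * (r ^ a)⁻¹).b = (q ^ j).b := by rw [hj, zpow_b h.q_c, h.q_b]; ring
    obtain ⟨i, hi⟩ := eq_P_of (by rw [mul_inv_b c2, b2, sub_self])
      (by rw [mul_inv_c, c2, sub_self])
      (h.A_dvd _ h2 (by rw [mul_inv_c, c2, sub_self]) (by rw [mul_inv_b c2, b2, sub_self]))
    have : g = P k ^ i * q ^ j * r ^ a := by rw [← hi]; group
    rw [this]
    exact mul_mem (mul_mem (zpow_mem (Subgroup.subset_closure (by simp)) _)
      (zpow_mem (Subgroup.subset_closure (by simp)) _))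
      (zpow_mem (Subgroup.subset_closure (by simp)) _)
  · rw [Subgroup.closure_le]
    rintro _ (rfl | rfl | rfl)
    exacts [h.p_mem, h.q_mem, h.r_mem]

theorem params_unique (h : IsHNF Δ k l m q r) (h' : IsHNF Δ k' l' m' q' r') :
    k = k' ∧ l = l' ∧ m = m' := by
  refine ⟨Nat.dvd_antisymm ?_ ?_, Nat.dvd_antisymm ?_ ?_, Nat.dvd_antisymm ?_ ?_⟩
  · have := h.A_dvd _ h'.p_mem rfl rfl
    rw [P_A] at this
    exact_mod_cast Int.dvd_of_mul_dvd_mul_left two_ne_zero this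
  · have := h'.A_dvd _ h.p_mem rfl rfl
    rw [P_A] at this
    exact_mod_cast Int.dvd_of_mul_dvd_mul_left two_ne_zero this
  · have := h.b_dvd _ h'.q_mem h'.q_c
    rw [h'.q_b] at this
    exact_mod_cast this
  · have := h'.b_dvd _ h.q_mem h.q_c
    rw [h.q_b] at this
    exact_mod_cast this
  · have := h.c_dvd _ h'.r_mem
    rw [h'.r_c] at this
    exact_mod_cast this
  · have := h'.c_dvd _ h.r_mem
    rw [h.r_c] at this
    exact_mod_cast this

/-- With equal parameters an inclusion is already an equality: the generators of the smaller
subgroup form a triangular system of the larger one as well. -/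
theorem eq_iff (h : IsHNF Δ k l m q r) (h' : IsHNF Δ' k l m q' r') :
    Δ = Δ' ↔ q ∈ Δ' ∧ r ∈ Δ' := by
  refine ⟨by rintro rfl; exact ⟨h.q_mem, h.r_mem⟩, fun ⟨hq, hr⟩ => ?_⟩
  have hle : Δ ≤ Δ' := by
    rw [h.eq_closure, Subgroup.closure_le]
    rintro _ (rfl | rfl | rfl)
    exacts [h'.p_mem, hq, hr]
  have h2 : IsHNF Δ' k l m q r :=
    { h' with q_b := h.q_b, q_c := h.q_c, r_c := h.r_c, q_mem := hq, r_mem := hr }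
  rw [h.eq_closure, h2.eq_closure]

/-- Conjugation acts on each cyclic quotient of the filtration by a sign, so the parameters survive.
The exponent `sg g.c` compensates the sign on the y-exponent, which has to be `l` and not `-l`. -/
theorem map_conj (h : IsHNF Δ k l m q r) (g : Model) :
    IsHNF (Δ.map (MulAut.conj g).toMonoidHom) k l m ((g * q * g⁻¹) ^ sg g.c) (g * r * g⁻¹) where
  k_pos := h.k_pos
  l_pos := h.l_pos
  m_pos := h.m_pos
  q_b := by
    rw [zpow_b (by rw [conj_c, h.q_c]), conj_b, h.q_c, sg_zero, h.q_b]
    linear_combination (l : ℤ) * sg_mul_self g.c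
  q_c := by rw [zpow_c, conj_c, h.q_c, mul_zero]
  r_c := by rw [conj_c, h.r_c]
  p_mem := by
    refine ⟨P k ^ sg (g.b + g.c), zpow_mem h.p_mem _, ?_⟩
    change g * _ * g⁻¹ = _
    rw [P_zpow]
    ext
    · rw [conj_A]; simp; linear_combination (2 * k : ℤ) * sg_mul_self (g.b + g.c)
    · rw [conj_b]; simp
    · rw [conj_c]; simp
  q_mem := zpow_mem (Subgroup.mem_map_of_mem (MulAut.conj g).toMonoidHom h.q_mem) _
  r_mem := ⟨r, h.r_mem, rfl⟩
  c_dvd := by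
    rintro _ ⟨w, hw, rfl⟩
    change _ ∣ (g * w * g⁻¹).c
    rw [conj_c]; exact h.c_dvd w hw
  b_dvd := by
    rintro _ ⟨w, hw, rfl⟩ hc
    change (g * w * g⁻¹).c = 0 at hc
    change _ ∣ (g * w * g⁻¹).b
    rw [conj_c] at hc
    rw [conj_b, hc, sg_zero, sub_self, mul_zero, zero_add]
    exact Dvd.dvd.mul_left (h.b_dvd w hw hc) _
  A_dvd := by
    rintro _ ⟨w, hw, rfl⟩ hc hb
    change (g * w * g⁻¹).c = 0 at hc
    change (g * w * g⁻¹).b = 0 at hb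
    change _ ∣ (g * w * g⁻¹).A
    rw [conj_c] at hc
    rw [conj_b, hc, sg_zero, sub_self, mul_zero, zero_add] at hb
    have hb' : w.b = 0 := by
      rcases sg_eq_one_or g.c with e | e <;> rw [e] at hb <;> linarith
    rw [conj_A, hc, hb', add_zero, sg_zero, sub_self, mul_zero, zero_add]
    exact Dvd.dvd.mul_left (h.A_dvd w hw hc hb') _

/-- By `eq_iff` it suffices to test whether the two conjugated generators lie in `Δ'`. All later
conjugacy criteria are specializations of these congruences. -/
theorem map_conj_eq_iff (h : IsHNF Δ k l m q r) (h' : IsHNF Δ' k l m q' r') (g : Model) :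
    Δ.map (MulAut.conj g).toMonoidHom = Δ' ↔
      2 * (k : ℤ) ∣ ((g * q * g⁻¹) ^ sg g.c).A - q'.A ∧
      ∃ j : ℤ, g.b * (1 - sg m) + sg g.c * r.b = r'.b + j * l ∧
        2 * (k : ℤ) ∣ g.A * (1 - sg (r.b + m)) + sg (g.b + g.c) * r.A - (q' ^ j * r').A := by
  have hg := h.map_conj g
  rw [hg.eq_iff h', h'.mem_iff_of_b_c_eq h'.q_mem (by rw [hg.q_b, h'.q_b])
    (by rw [hg.q_c, h'.q_c]), h'.mem_iff_of_c_eq hg.r_c, conj_b, conj_A, h.r_c]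

/-- The criterion for conjugacy by `g` when the `y`-exponent of the second generator is even. -/
theorem map_conj_eq_iff_of_even (h : IsHNF Δ k l m q r) (h' : IsHNF Δ' k l m q' r')
    (hl : Even (l : ℤ)) (g : Model) :
    Δ.map (MulAut.conj g).toMonoidHom = Δ' ↔
      2 * (k : ℤ) ∣ sg g.b * q.A - q'.A ∧
      ∃ j : ℤ, g.b * (1 - sg m) + sg g.c * r.b = r'.b + j * l ∧
        2 * (k : ℤ) ∣ g.A * (1 - sg (r.b + m)) + sg (g.b + g.c) * r.A - (j * q'.A + r'.A) := by
  rw [h.map_conj_eq_iff h']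
  have e1 : ((g * q * g⁻¹) ^ sg g.c).A = sg g.b * q.A := by
    rw [zpow_A, conj_A, h.q_b, h.q_c, add_zero, sg_even hl, sg_add]
    · linear_combination sg g.b * q.A * sg_mul_self g.c
    · rw [conj_b, conj_c, h.q_c, h.q_b]
      simp [hl]
  have e2 : ∀ j : ℤ, (q' ^ j * r').A = j * q'.A + r'.A := by
    intro j
    rw [mul_A, zpow_A (by rw [h'.q_b, h'.q_c, add_zero]; exact hl), zpow_b h'.q_c, zpow_c, h'.q_c,
      h'.q_b, sg_even (by simp [hl]), one_mul]
  rw [e1]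
  simp_rw [e2]

/-- The criterion for conjugacy by `g` when the `y`-exponent of the second generator is odd. -/
theorem map_conj_eq_iff_of_odd (h : IsHNF Δ k l m q r) (h' : IsHNF Δ' k l m q' r')
    (hl : Odd (l : ℤ)) (hr : Even r.b) (hr' : Even r'.b) (g : Model) :
    Δ.map (MulAut.conj g).toMonoidHom = Δ' ↔
      2 * (k : ℤ) ∣ 2 * g.A + sg (g.b + g.c) * q.A - q'.A ∧
      ∃ j : ℤ, g.b * (1 - sg m) + sg g.c * r.b = r'.b + 2 * j * l ∧
        2 * (k : ℤ) ∣ g.A * (1 - sg m) + sg (g.b + g.c) * r.A - r'.A := by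
  rw [h.map_conj_eq_iff h']
  -- An element with odd `b + c` reverses the x-direction, and then its inverse has the same `A`; so
  -- the exponent `sg g.c` has no effect on `A`.
  have e1 : ((g * q * g⁻¹) ^ sg g.c).A = 2 * g.A + sg (g.b + g.c) * q.A := by
    rcases sg_eq_one_or g.c with e | e <;> rw [e]
    · rw [zpow_one, conj_A, h.q_b, h.q_c, add_zero, sg_odd hl]; ring
    · rw [zpow_neg_one, inv_A, conj_A, conj_b, conj_c, h.q_b, h.q_c, e, sg_zero, sub_self,
        mul_zero, zero_add, add_zero, add_zero, neg_one_mul, sg_neg, sg_odd hl]; ring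
  -- For odd `l` the x-part of `q' ^ 2` cancels, so even powers of `q'` do not contribute to `A`.
  have e2 : ∀ j : ℤ, (q' ^ (2 * j) * r').A = r'.A := by
    intro j
    rw [zpow_mul, show q' ^ (2 : ℤ) = Q 0 (2 * l) by
      rw [zpow_ofNat, pow_two]
      ext
      · simp [h'.q_b, h'.q_c, sg_odd hl]
      · simp [h'.q_b, h'.q_c]; ring
      · simp [h'.q_c]]
    rw [mul_A, zpow_A (by simp), zpow_b (by simp), zpow_c, sg_even (by simp)]
    simp
  rw [e1, sg_add r.b, sg_even hr, one_mul]
  refine and_congr_right fun _ => ⟨?_, ?_⟩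
  · rintro ⟨j, hj, hA⟩
    -- In the equation for the y-exponents all terms but `j * l` are even, and `l` is odd.
    have hj2 : Even j := by
      have h1 : Even (j * (l : ℤ)) := by
        have h2 : Even (g.b * (1 - sg m)) := by
          rcases sg_eq_one_or m with e | e <;> rw [e] <;> simp
        have h3 : j * (l : ℤ) = g.b * (1 - sg m) + sg g.c * r.b - r'.b := by rw [hj]; ring
        rw [h3]
        exact (h2.add (hr.mul_left _)).sub hr'
      rw [Int.even_mul] at h1
      exact h1.resolve_right (Int.not_even_iff_odd.2 hl)
    obtain ⟨i, rfl⟩ := hj2.two_dvd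
    rw [e2] at hA
    exact ⟨i, hj, hA⟩
  · rintro ⟨j, hj, hA⟩
    exact ⟨2 * j, hj, by rw [e2]; exact hA⟩

end IsHNF

namespace IsHNF

variable {Δ : Subgroup Model} {k l m : ℕ} {q r : Model}

/-! ### The index -/

/-- Representatives of the left cosets. -/
def cosetRep (i j h : ℤ) : Model := ⟨2 * i + h % 2, j, h, by rw [Int.even_iff]; omega⟩

theorem inv_mul_A (g g' : Model) :
    (g⁻¹ * g').A = sg (g.b + g.c) * (g'.A - g.A) := by
  simp [sg_add]; ring

theorem inv_mul_b (g g' : Model) :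
    (g⁻¹ * g').b = sg g.c * (g'.b - g.b) := by
  simp; ring

theorem eq_of_dvd_sub_of_lt {n : ℕ} {a b : ℤ} (h : (n : ℤ) ∣ a - b) (ha : 0 ≤ a) (ha' : a < n)
    (hb : 0 ≤ b) (hb' : b < n) : a = b := by
  have := Int.eq_zero_of_abs_lt_dvd h (by rw [abs_lt]; constructor <;> linarith)
  linarith

theorem dvd_of_dvd_sg_mul {n a e : ℤ} (h : n ∣ sg e * a) : n ∣ a := by
  rcases sg_eq_one_or e with h' | h' <;> rw [h'] at h
  · simpa using h
  · simpa using h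

/-- The left cosets correspond to a `k × l × m` box of exponents. Reading off `c`, then `b`, then
`A` separates the representatives, and right multiplication by powers of `r`, `q` and `x ^ k` moves
any element into the box. -/
theorem index_eq (h : IsHNF Δ k l m q r) : Δ.index = k * l * m := by
  have hk : (0 : ℤ) < k := by exact_mod_cast h.k_pos
  have hl : (0 : ℤ) < l := by exact_mod_cast h.l_pos
  have hm : (0 : ℤ) < m := by exact_mod_cast h.m_pos
  let f : Fin k × Fin l × Fin m → Model ⧸ Δ := fun t =>
    QuotientGroup.mk (cosetRep (t.1 : ℕ) (t.2.1 : ℕ) (t.2.2 : ℕ))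
  have hf : Function.Bijective f := by
    constructor
    · rintro ⟨i, j, c⟩ ⟨i', j', c'⟩ e
      have hmem := QuotientGroup.eq.1 e
      set g := cosetRep (i : ℕ) (j : ℕ) (c : ℕ) with hg
      set g' := cosetRep (i' : ℕ) (j' : ℕ) (c' : ℕ) with hg'
      have e1 : g.c = g'.c := by
        have := h.c_dvd _ hmem
        rw [mul_c, inv_c, neg_add_eq_sub] at this
        exact (eq_of_dvd_sub_of_lt this (by simp [hg', cosetRep]) (by simp [hg', cosetRep])
          (by simp [hg, cosetRep]) (by simp [hg, cosetRep])).symm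
      have e0 : (g⁻¹ * g').c = 0 := by rw [mul_c, inv_c, e1]; ring
      have e2 : g.b = g'.b := by
        have := h.b_dvd _ hmem e0
        rw [inv_mul_b] at this
        exact (eq_of_dvd_sub_of_lt (dvd_of_dvd_sg_mul this) (by simp [hg', cosetRep])
          (by simp [hg', cosetRep]) (by simp [hg, cosetRep]) (by simp [hg, cosetRep])).symm
      have e3 : (i : ℤ) = i' := by
        have := h.A_dvd _ hmem e0 (by rw [inv_mul_b, e2]; ring)
        rw [inv_mul_A] at this
        have h2 : g'.A - g.A = 2 * ((i' : ℤ) - i) := by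
          have : (c : ℤ) = c' := e1
          simp [hg, hg', cosetRep, this]; ring
        have h3 := dvd_of_dvd_sg_mul this
        rw [h2] at h3
        exact (eq_of_dvd_sub_of_lt (Int.dvd_of_mul_dvd_mul_left two_ne_zero h3) (by simp)
          (by simp) (by simp) (by simp)).symm
      have e1' : (c : ℤ) = c' := e1
      have e2' : (j : ℤ) = j' := e2
      simp only [Prod.mk.injEq, Fin.ext_iff]
      exact ⟨by exact_mod_cast e3, by exact_mod_cast e2', by exact_mod_cast e1'⟩
    · intro w
      obtain ⟨g, rfl⟩ := QuotientGroup.mk_surjective w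
      obtain ⟨g₁, hg₁, hc⟩ : ∃ g₁ : Model, g⁻¹ * g₁ ∈ Δ ∧ g₁.c = g.c % m := by
        refine ⟨g * r ^ (-(g.c / m)), by simpa using zpow_mem h.r_mem _, ?_⟩
        rw [mul_c, zpow_c, h.r_c]
        linarith [Int.emod_add_mul_ediv g.c m]
      obtain ⟨g₂, hg₂, hc₂, hb₂⟩ : ∃ g₂ : Model, g⁻¹ * g₂ ∈ Δ ∧ g₂.c = g.c % m ∧
          g₂.b = g₁.b % l := by
        -- A factor `q` on the right changes `b` by `sg g₁.c * l`; the sign in the exponent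
        -- compensates this.
        refine ⟨g₁ * q ^ (-(sg g₁.c * (g₁.b / l))), ?_, ?_, ?_⟩
        · rw [← mul_assoc]; exact mul_mem hg₁ (zpow_mem h.q_mem _)
        · rw [mul_c, zpow_c, h.q_c, hc]; ring
        · rw [mul_b, zpow_b h.q_c, h.q_b]
          linear_combination -Int.emod_add_mul_ediv g₁.b l - (g₁.b / l) * l * sg_mul_self g₁.c
      have he := g₂.even_sub
      obtain ⟨a, ha⟩ : ∃ a, g₂.A = 2 * a + g₂.c % 2 := by
        rw [Int.even_iff] at he
        exact ⟨g₂.A / 2, by omega⟩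
      have h₃ : cosetRep (a % k) (g₁.b % l) (g.c % m) =
          g₂ * P k ^ (-(sg (g₂.b + g₂.c) * (a / k))) := by
        rw [P_zpow]
        ext
        · rw [mul_A, P_A, ha, hc₂]
          simp only [cosetRep]
          linear_combination 2 * Int.emod_add_mul_ediv a k +
            2 * (a / k) * k * sg_mul_self (g₂.b + g.c % m)
        · simp [cosetRep, hb₂]
        · simp [cosetRep, hc₂]
      refine ⟨⟨⟨(a % k).toNat, ?_⟩, ⟨(g₁.b % l).toNat, ?_⟩, ⟨(g.c % m).toNat, ?_⟩⟩, ?_⟩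
      · have := Int.emod_lt_of_pos a hk; have := Int.emod_nonneg a hk.ne'; omega
      · have := Int.emod_lt_of_pos g₁.b hl; have := Int.emod_nonneg g₁.b hl.ne'; omega
      · have := Int.emod_lt_of_pos g.c hm; have := Int.emod_nonneg g.c hm.ne'; omega
      · have := Int.emod_nonneg a hk.ne'
        have := Int.emod_nonneg g₁.b hl.ne'
        have := Int.emod_nonneg g.c hm.ne'
        simp only [f]
        rw [Int.toNat_of_nonneg ‹_›, Int.toNat_of_nonneg ‹_›, Int.toNat_of_nonneg ‹_›, h₃]
        refine (QuotientGroup.eq.2 ?_).symm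
        rw [← mul_assoc]
        exact mul_mem hg₂ (zpow_mem h.p_mem _)
  rw [Subgroup.index, ← Nat.card_congr (Equiv.ofBijective f hf)]
  simp [mul_assoc]

/-! ### The relations between the generators -/

/-- The element `(r * q * r⁻¹) ^ sg m` of `Δ` has the same `b` and `c` as `q`, so the two differ by
a power of `x ^ k`. Comparing their `A` gives the congruence; the same argument serves for odd `l`.
-/
theorem relation_of_even (h : IsHNF Δ k l m q r) (hl : Even (l : ℤ)) :
    2 * (k : ℤ) ∣ (sg r.b - 1) * q.A := by
  have hmem : (r * q * r⁻¹) ^ sg m ∈ Δ :=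
    zpow_mem (mul_mem (mul_mem h.r_mem h.q_mem) (inv_mem h.r_mem)) _
  have hc : (r * q * r⁻¹).c = 0 := by rw [conj_c, h.q_c]
  rw [h.mem_iff_of_b_c_eq h.q_mem ?_ ?_] at hmem
  · rw [zpow_A, conj_A, h.q_b, h.q_c, add_zero, sg_even hl, sg_add, h.r_c] at hmem
    · convert hmem using 1
      linear_combination (-sg r.b * q.A) * sg_mul_self m
    · rw [hc, conj_b, h.q_c, h.q_b]
      simp [hl]
  · rw [zpow_b hc, conj_b, h.q_c, sg_zero, h.r_c, h.q_b]
    linear_combination (l : ℤ) * sg_mul_self m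
  · rw [zpow_c, hc, mul_zero, h.q_c]

theorem relation_of_odd (h : IsHNF Δ k l m q r) (hl : Odd (l : ℤ)) (hr : Even r.b) :
    2 * (k : ℤ) ∣ 2 * r.A - (1 - sg m) * q.A := by
  have hmem : (r * q * r⁻¹) ^ sg m ∈ Δ :=
    zpow_mem (mul_mem (mul_mem h.r_mem h.q_mem) (inv_mem h.r_mem)) _
  have hc : (r * q * r⁻¹).c = 0 := by rw [conj_c, h.q_c]
  rw [h.mem_iff_of_b_c_eq h.q_mem ?_ ?_] at hmem
  · convert hmem using 1
    rcases sg_eq_one_or m with e | e <;> rw [e]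
    · rw [zpow_one, conj_A, h.q_b, h.q_c, h.r_c, add_zero, sg_odd hl, sg_add, sg_even hr, e]; ring
    · rw [zpow_neg_one, inv_A, conj_A, conj_b, conj_c, h.q_b, h.q_c, h.r_c, sg_add r.b,
        sg_even hr, e, sg_zero, sub_self,
        mul_zero, zero_add, add_zero, add_zero, neg_one_mul, sg_neg, sg_odd hl]; ring
  · rw [zpow_b hc, conj_b, h.q_c, sg_zero, h.r_c, h.q_b]
    linear_combination (l : ℤ) * sg_mul_self m
  · rw [zpow_c, hc, mul_zero, h.q_c]

end IsHNF

theorem conj_P (g : Model) (k : ℤ) :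
    g * P k * g⁻¹ = P k ∨ g * P k * g⁻¹ = (P k)⁻¹ := by
  rcases sg_eq_one_or (g.b + g.c) with e | e
  · left
    ext
    · rw [conj_A, e]; simp
    · rw [conj_b]; simp
    · simp
  · right
    ext
    · rw [conj_A, e]; simp
    · rw [conj_b]; simp
    · simp

/-- Converse to the relations above. Every element normalizes the group generated by `x ^ k`, so the
one congruence on `r * q * r⁻¹` is enough for a normal form `P k ^ i * q ^ j * r ^ h`, and the
closure contains no elements that would make the parameters smaller. -/
theorem isHNF_closure {k l m : ℕ} {q r : Model} (hk : 0 < k) (hl : 0 < l) (hm : 0 < m)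
    (hqb : q.b = l) (hqc : q.c = 0) (hrc : r.c = m)
    (hrq : 2 * (k : ℤ) ∣ ((r * q * r⁻¹) * (q ^ sg m)⁻¹).A) :
    IsHNF (Subgroup.closure {P k, q, r}) k l m q r := by
  have hc : (r * q * r⁻¹).c = (q ^ sg m).c := by rw [conj_c, zpow_c, hqc, mul_zero]
  have hnf : ∀ w ∈ Subgroup.closure {P k, q, r}, ∃ i j h : ℤ, w = P k ^ i * q ^ j * r ^ h := by
    intro w hw
    refine exists_normal_form (conj_P q k) (conj_P r k) ?_ hw
    have hb : (r * q * r⁻¹).b = (q ^ sg m).b := by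
      rw [conj_b, zpow_b hqc, hqc, sg_zero, hrc, sub_self, mul_zero, zero_add]
    obtain ⟨i, hi⟩ := eq_P_of (by rw [mul_inv_b hc, hb, sub_self])
      (by rw [mul_inv_c, hc, sub_self]) hrq
    refine ⟨i, ?_⟩
    rw [mul_inv_eq_iff_eq_mul] at hi
    rcases sg_eq_one_or m with e | e <;> rw [e] at hi
    · rw [zpow_one] at hi; exact .inl hi
    · rw [zpow_neg_one] at hi; exact .inr hi
  refine ⟨hk, hl, hm, hqb, hqc, hrc, Subgroup.subset_closure (by simp),
    Subgroup.subset_closure (by simp), Subgroup.subset_closure (by simp), ?_, ?_, ?_⟩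
  · intro w hw
    obtain ⟨i, j, h, rfl⟩ := hnf w hw
    simp [hqc, hrc]
  · intro w hw hwc
    obtain ⟨i, j, h, rfl⟩ := hnf w hw
    simp [hqc, hrc] at hwc
    obtain rfl : h = 0 := hwc.resolve_right hm.ne'
    rw [P_zpow]
    simp [zpow_b hqc, hqb]
  · intro w hw hwc hwb
    obtain ⟨i, j, h, rfl⟩ := hnf w hw
    simp [hqc, hrc] at hwc
    obtain rfl : h = 0 := hwc.resolve_right hm.ne'
    rw [P_zpow] at hwb
    simp [zpow_b hqc, hqb] at hwb
    obtain rfl : j = 0 := hwb.resolve_right hl.ne'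
    rw [P_zpow]
    simp
    exact ⟨i, by ring⟩

/-! ### Subgroups given by integral data -/

/-- The subgroup generated by `x ^ k`, `x ^ s * y ^ l` and the element `R t u m`,
where `d = (s, t, u)`. -/
def sub (k l m : ℕ) (d : ℤ × ℤ × ℤ) : Subgroup Model :=
  Subgroup.closure {P k, Q d.1 l, R d.2.1 d.2.2 m}

/-- The condition on the data under which the generators of `sub k l m d` satisfy relations that
make the system triangular. -/
structure IsGood (k l m : ℕ) (d : ℤ × ℤ × ℤ) : Prop where
  k_pos : 0 < k
  l_pos : 0 < l
  m_pos : 0 < m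
  of_even : Even (l : ℤ) → (k : ℤ) ∣ (sg d.2.2 - 1) * d.1
  -- Evenness of `d.2.2` is a normalization: for odd `l`, replacing `r` by `q * r` changes the
  -- parity of its y-exponent.
  of_odd : Odd (l : ℤ) → Even d.2.2 ∧ (k : ℤ) ∣ 2 * d.2.1 + (m : ℤ) % 2 - (1 - sg m) * d.1

theorem IsGood.isHNF {k l m : ℕ} {d : ℤ × ℤ × ℤ} (h : IsGood k l m d) :
    IsHNF (sub k l m d) k l m (Q d.1 l) (R d.2.1 d.2.2 m) := by
  refine isHNF_closure h.k_pos h.l_pos h.m_pos rfl rfl rfl ?_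
  rw [mul_inv_A (by rw [conj_b, zpow_b rfl]; simp) (by rw [conj_c, zpow_c]; simp), conj_A]
  rcases Int.even_or_odd (l : ℤ) with hl | hl
  · rw [zpow_A (by simpa using hl)]
    have h1 := dvd_mul_of_dvd_left (mul_dvd_mul_left 2 (h.of_even hl)) (sg m)
    refine Eq.subst (motive := fun z => 2 * (k : ℤ) ∣ z) ?_ h1
    simp [sg_even hl, sg_add]
    ring
  · obtain ⟨hu, h1⟩ := h.of_odd hl
    have h2 := mul_dvd_mul_left 2 h1
    refine Eq.subst (motive := fun z => 2 * (k : ℤ) ∣ z) ?_ h2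
    rcases sg_eq_one_or m with e | e <;> rw [e]
    · simp [sg_odd hl, sg_add, e, sg_even hu]; ring
    · rw [zpow_neg_one]
      simp [sg_odd hl, sg_add, e, sg_even hu]; ring

theorem exists_eq_sub {Δ : Subgroup Model} (hΔ : Δ.index ≠ 0) :
    ∃ k l m d, IsGood k l m d ∧ Δ = sub k l m d ∧ Δ.index = k * l * m := by
  obtain ⟨k, l, m, q, r, h⟩ := IsHNF.exists_of_index_ne_zero hΔ
  obtain ⟨r', h', hr'⟩ : ∃ r', IsHNF Δ k l m q r' ∧ (Odd (l : ℤ) → Even r'.b) := by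
    by_cases hc : Odd (l : ℤ) → Even r.b
    · exact ⟨r, h, hc⟩
    · push Not at hc
      obtain ⟨hl, hr⟩ := hc
      refine ⟨q * r, { h with r_c := ?_, r_mem := mul_mem h.q_mem h.r_mem }, fun _ => ?_⟩
      · rw [mul_c, h.q_c, h.r_c, zero_add]
      · rw [mul_b, h.q_c, h.q_b, sg_zero, one_mul]
        exact hl.add_odd (Int.not_even_iff_odd.1 hr)
  have hq := q.even_sub
  rw [h.q_c, sub_zero] at hq
  obtain ⟨s, hs⟩ := hq.two_dvd
  obtain ⟨t, ht⟩ : ∃ t, r'.A = 2 * t + (m : ℤ) % 2 := by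
    have := r'.even_sub
    rw [h'.r_c, Int.even_iff] at this
    exact ⟨r'.A / 2, by omega⟩
  have eq : q = Q s l := by
    ext
    exacts [hs, h.q_b, h.q_c]
  have er : r' = R t r'.b m := by
    ext
    exacts [ht, rfl, h'.r_c]
  refine ⟨k, l, m, (s, t, r'.b), ⟨h.k_pos, h.l_pos, h.m_pos, fun hl => ?_, fun hl => ⟨hr' hl, ?_⟩⟩,
    ?_, h.index_eq⟩
  · have := h'.relation_of_even hl
    rw [hs, mul_left_comm] at this
    exact Int.dvd_of_mul_dvd_mul_left two_ne_zero this
  · have := h'.relation_of_odd hl (hr' hl)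
    rw [hs, ht, mul_left_comm, ← mul_sub] at this
    exact Int.dvd_of_mul_dvd_mul_left two_ne_zero this
  · rw [h'.eq_closure, sub]
    simp only
    rw [← eq, ← er]

/-! ### The model is the fundamental group of `B₄` -/

/-- The whole model has the triangular system `x, y, z` with parameters `1, 1, 1`, so the
recognition criterion for `PiB4` applies to it. -/
theorem nonempty_model_mulEquiv : Nonempty (PiB4 ≃* Model) := by
  have h : IsHNF (⊤ : Subgroup Model) 1 1 1 (Q 0 1) (R 0 0 1) := by
    refine ⟨one_pos, one_pos, one_pos, rfl, rfl, rfl, Subgroup.mem_top _, Subgroup.mem_top _,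
      Subgroup.mem_top _, fun g _ => by simp, fun g _ _ => by simp, fun g _ hc _ => ?_⟩
    have := g.even_sub
    rw [hc, sub_zero] at this
    simpa using this.two_dvd
  have := nonempty_mulEquiv_piB4 (Δ := (⊤ : Subgroup Model)) (a := P 1) (b := Q 0 1)
    (c := R 0 0 1) (by ext <;> simp) (by ext <;> simp) (by ext <;> simp)
    (independent one_ne_zero (by simp) rfl (by simp)) (by simpa using h.eq_closure)
  exact ⟨(this.some.symm).trans Subgroup.topEquiv⟩

namespace IsHNF

variable {Δ : Subgroup Model} {k l m : ℕ} {s s' t t' u : ℤ} {q r : Model}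

/-! ### The isomorphism type of a subgroup -/

/-- A generator may be multiplied by a power of `x ^ k`. This serves to turn congruences modulo `k`
into the exact relations of a presentation. -/
theorem congr_s (h : IsHNF Δ k l m (Q s l) r) (hs : (k : ℤ) ∣ s' - s) :
    IsHNF Δ k l m (Q s' l) r :=
  { h with
    q_b := rfl
    q_c := rfl
    q_mem := by
      rw [h.mem_iff_of_b_c_eq (w := Q s' l) h.q_mem rfl rfl, Q_A, Q_A, ← mul_sub]
      exact mul_dvd_mul_left 2 hs }

theorem congr_t (h : IsHNF Δ k l m q (R t u m)) (ht : (k : ℤ) ∣ t' - t) :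
    IsHNF Δ k l m q (R t' u m) :=
  { h with
    r_c := rfl
    r_mem := by
      rw [h.mem_iff_of_b_c_eq (w := R t' u m) h.r_mem rfl rfl, R_A, R_A,
        add_sub_add_right_eq_sub, ← mul_sub]
      exact mul_dvd_mul_left 2 ht }

theorem P_mul_comm (k : ℤ) {g : Model} (hg : Even (g.b + g.c)) : P k * g = g * P k := by
  ext
  · simp [sg_even hg]; ring
  · simp
  · simp

theorem closure_swap {G : Type*} [Group G] (a b c : G) :
    Subgroup.closure {a, b, c} = Subgroup.closure {a, c, b} := by
  rw [Set.pair_comm b c]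

theorem independent_swap (h : IsHNF Δ k l m q r) (i j n : ℤ) (e : P k ^ i * r ^ j * q ^ n = 1) :
    i = 0 ∧ j = 0 ∧ n = 0 := by
  have hk : (k : ℤ) ≠ 0 := by exact_mod_cast h.k_pos.ne'
  have hc := congrArg Model.c e
  simp [h.q_c, h.r_c] at hc
  obtain rfl : j = 0 := hc.resolve_right h.m_pos.ne'
  obtain ⟨hi, hn, -⟩ := independent hk (q := q) (r := r) (by simp [h.q_b, h.l_pos.ne']) h.q_c
    (by simp [h.r_c, h.m_pos.ne']) i n 0 (by simpa using e)
  exact ⟨hi, rfl, hn⟩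

theorem independent_of (h : IsHNF Δ k l m q r) (i j n : ℤ) (e : P k ^ i * q ^ j * r ^ n = 1) :
    i = 0 ∧ j = 0 ∧ n = 0 :=
  independent (by exact_mod_cast h.k_pos.ne') (by simp [h.q_b, h.l_pos.ne']) h.q_c
    (by simp [h.r_c, h.m_pos.ne']) i j n e

theorem type_G1 (h : IsHNF Δ k l m (Q s l) (R t u m)) (hl : Even (l : ℤ)) (hm : Even (m : ℤ))
    (hu : Even u) : Nonempty (Δ ≃* PiG1) := by
  refine nonempty_mulEquiv_piG1 (P_mul_comm k (by simpa using hl))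
    (P_mul_comm k (by simpa using hu.add hm)) ?_ h.independent_of h.eq_closure
  ext
  · simp [sg_even, hl, hu.add hm]; ring
  · simp [sg_even hm]; ring
  · simp

theorem type_G2 (h : IsHNF Δ k l m (Q s l) (R t u m)) (hl : Even (l : ℤ)) (hm : Odd (m : ℤ))
    (hu : Even u) : Nonempty (Δ ≃* PiG2) := by
  refine nonempty_mulEquiv_piG2 (P_mul_comm k (by simpa using hl)) ?_ ?_
    h.independent_of h.eq_closure
  · ext
    · rw [conj_A]; simp [sg_odd (hu.add_odd hm)]
    · rw [conj_b]; simp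
    · simp
  · ext
    · rw [conj_A]; simp [sg_odd (hu.add_odd hm), sg_even hl]
    · rw [conj_b]; simp [sg_odd hm]
    · simp

theorem type_B1_of_even_of_even (h : IsHNF Δ k l m (Q s l) (R t u m)) (hl : Even (l : ℤ))
    (hm : Even (m : ℤ)) (hu : Odd u) (hs : (k : ℤ) ∣ s) : Nonempty (Δ ≃* PiB1) := by
  replace h := h.congr_s (s' := 0) (by simpa using hs)
  refine nonempty_mulEquiv_piB1 (P_mul_comm k (by simpa using hl)) ?_ ?_
    h.independent_of h.eq_closure
  · ext
    · simp [sg_even hl]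
    · simp [sg_even hm]; ring
    · simp
  · ext
    · rw [conj_A]; simp [sg_odd (hu.add_even hm)]
    · rw [conj_b]; simp
    · simp

/-- Here `2 * s` is an odd multiple of `k`, so `k` is even and `s` is the residue `k / 2`. -/
theorem exists_half (hs : (k : ℤ) ∣ 2 * s) (hs' : ¬ (k : ℤ) ∣ s) :
    ∃ i : ℤ, (k : ℤ) = 2 * i ∧ (k : ℤ) ∣ i - s := by
  obtain ⟨j, hj⟩ := hs
  rcases Int.even_or_odd j with ⟨a, rfl⟩ | ⟨a, rfl⟩
  · exact absurd ⟨a, by linarith⟩ hs'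
  · exact ⟨s - k * a, by linarith, ⟨-a, by ring⟩⟩

theorem type_B2_of_even_of_even (h : IsHNF Δ k l m (Q s l) (R t u m)) (hl : Even (l : ℤ))
    (hm : Even (m : ℤ)) (hu : Odd u) (hs : (k : ℤ) ∣ 2 * s) (hs' : ¬ (k : ℤ) ∣ s) :
    Nonempty (Δ ≃* PiB2) := by
  obtain ⟨i, hi, hd⟩ := exists_half hs hs'
  -- The relation `r * q * r⁻¹ = x ^ k * q` requires `-s = k + s`, hence the representative `-k / 2`
  -- rather than `k / 2`.
  replace h := h.congr_s (s' := -i) (by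
    have : -i - s = (i - s) - k := by rw [hi]; ring
    rw [this]; exact dvd_sub_self_right.2 hd)
  refine nonempty_mulEquiv_piB2 (P_mul_comm k (by simpa using hl)) ?_ ?_
    h.independent_of h.eq_closure
  · ext
    · rw [conj_A]; simp [sg_odd (hu.add_even hm)]
    · rw [conj_b]; simp
    · simp
  · ext
    · rw [conj_A]; simp [sg_odd (hu.add_even hm), sg_even hl, hi]; ring
    · rw [conj_b]; simp [sg_even hm]
    · simp

/-- Now `q` reverses the x-direction and `r` does not, so the roles change: `r` is the `y` and `q`
the `z` of the presentation. The same holds for `type_B2_of_odd_of_even`. -/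
theorem type_B1_of_odd_of_even (h : IsHNF Δ k l m (Q s l) (R t u m)) (hl : Odd (l : ℤ))
    (hm : Even (m : ℤ)) (hu : Even u) (ht : (k : ℤ) ∣ t) : Nonempty (Δ ≃* PiB1) := by
  replace h := h.congr_t (t' := 0) (by simpa using ht)
  refine nonempty_mulEquiv_piB1 (P_mul_comm k (by simpa using hu.add hm)) ?_ ?_
    h.independent_swap (by rw [closure_swap]; exact h.eq_closure)
  · ext
    · simp [sg_odd hl, sg_even (hu.add hm), Int.even_iff.1 hm]
    · simp [sg_even hm]; ring
    · simp
  · ext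
    · rw [conj_A]; simp [sg_odd hl]
    · rw [conj_b]; simp
    · simp

theorem type_B2_of_odd_of_even (h : IsHNF Δ k l m (Q s l) (R t u m)) (hl : Odd (l : ℤ))
    (hm : Even (m : ℤ)) (hu : Even u) (ht : (k : ℤ) ∣ 2 * t) (ht' : ¬ (k : ℤ) ∣ t) :
    Nonempty (Δ ≃* PiB2) := by
  obtain ⟨i, hi, hd⟩ := exists_half ht ht'
  replace h := h.congr_t (t' := -i) (by
    have : -i - t = (i - t) - k := by rw [hi]; ring
    rw [this]; exact dvd_sub_self_right.2 hd)
  refine nonempty_mulEquiv_piB2 (P_mul_comm k (by simpa using hu.add hm)) ?_ ?_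
    h.independent_swap (by rw [closure_swap]; exact h.eq_closure)
  · ext
    · rw [conj_A]; simp [sg_odd hl]
    · rw [conj_b]; simp
    · simp
  · ext
    · rw [conj_A]; simp [sg_odd hl, sg_even (hu.add hm), Int.even_iff.1 hm, hi]; ring
    · rw [conj_b]; simp [sg_even hm]
    · simp

/-- Here `r` commutes with `x ^ k` and inverts `y ^ l`, so `y ^ l` takes the part of the generator
`x` of the presentation and `x ^ k` that of `y`. -/
theorem type_B1_of_even_of_odd (h : IsHNF Δ k l m (Q s l) (R t u m)) (hl : Even (l : ℤ))
    (hm : Odd (m : ℤ)) (hu : Odd u) (hs : (k : ℤ) ∣ s) : Nonempty (Δ ≃* PiB1) := by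
  replace h := h.congr_s (s' := 0) (by simpa using hs)
  have hPQ := P_mul_comm k (g := Q 0 l) (by simpa using hl)
  refine nonempty_mulEquiv_piB1 (a := Q 0 l) (b := P k) (c := R t u m) hPQ.symm
    (P_mul_comm k (by simpa using hu.add_odd hm)) ?_
    (fun i j n e => ?_) ?_
  · ext
    · rw [conj_A]; simp [sg_even hl]
    · rw [conj_b]; simp [sg_odd hm]
    · simp
  · rw [(Commute.zpow_zpow (show Commute (Q 0 l) (P k) from hPQ.symm) i j).eq] at e
    obtain ⟨h1, h2, h3⟩ := h.independent_of _ _ _ e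
    exact ⟨h2, h1, h3⟩
  · rw [h.eq_closure, Set.insert_comm]

theorem type_B2_of_even_of_odd (h : IsHNF Δ k l m (Q s l) (R t u m)) (hl : Even (l : ℤ))
    (hm : Odd (m : ℤ)) (hu : Odd u) (hs : (k : ℤ) ∣ 2 * s) (hs' : ¬ (k : ℤ) ∣ s) :
    Nonempty (Δ ≃* PiB2) := by
  obtain ⟨i, hi, hd⟩ := exists_half hs hs'
  replace h := h.congr_s hd
  have hPQ := P_mul_comm k (g := Q i l) (by simpa using hl)
  -- With `q = x ^ (k / 2) * y ^ l` this product is `y ^ (-2 * l)`. It plays the generator `x` of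
  -- the presentation, because `r * q * r⁻¹ = x ^ (k / 2) * y ^ (-l) = y ^ (-2 * l) * q`.
  have hx : P k * (Q i l) ^ (-2 : ℤ) = Q 0 (-2 * l) := by
    ext
    · rw [mul_A, zpow_A (by simpa using hl)]; simp [hi]
    · rw [mul_b, zpow_b rfl]; simp
    · rw [mul_c, zpow_c]; simp
  have h2l : sg (2 * l) = 1 := sg_even (by simp)
  refine nonempty_mulEquiv_piB2 (a := P k * (Q i l) ^ (-2 : ℤ)) (b := Q i l) (c := R t u m)
    ?_ ?_ ?_ (fun a b c e => ?_) ?_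
  · rw [hx]
    ext
    · simp [sg_even hl, h2l]
    · simp; ring
    · simp
  · rw [hx]
    ext
    · rw [conj_A]; simp [h2l]
    · rw [conj_b]; simp [sg_odd hm]
    · simp
  · rw [hx]
    ext
    · rw [conj_A]; simp [sg_even hl, sg_even (hu.add_odd hm), h2l]
    · rw [conj_b]; simp [sg_odd hm]; ring
    · simp
  · have hcomm : Commute (P k) ((Q i l) ^ (-2 : ℤ)) :=
      Commute.zpow_right (show Commute (P k) (Q i l) from hPQ) _
    rw [hcomm.mul_zpow, mul_assoc (P k ^ a), ← zpow_mul, ← zpow_add] at e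
    obtain ⟨rfl, h2, h3⟩ := h.independent_of _ _ _ e
    exact ⟨rfl, by simpa using h2, h3⟩
  · rw [h.eq_closure]
    have mem : ∀ (S : Set Model) (g : Model), g ∈ S → g ∈ Subgroup.closure S :=
      fun S g hg => Subgroup.subset_closure hg
    apply le_antisymm
    · rw [Subgroup.closure_le]
      rintro _ (rfl | rfl | rfl)
      · have h1 := mem {P k * (Q i l) ^ (-2 : ℤ), Q i l, R t u m} _ (.inl rfl)
        have h2 := mem {P k * (Q i l) ^ (-2 : ℤ), Q i l, R t u m} (Q i l) (by simp)
        have := mul_mem h1 (zpow_mem h2 2)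
        rwa [mul_assoc, ← zpow_add, neg_add_cancel, zpow_zero, mul_one] at this
      · exact mem _ _ (by simp)
      · exact mem _ _ (by simp)
    · rw [Subgroup.closure_le]
      rintro _ (rfl | rfl | rfl)
      · exact mul_mem (mem _ _ (by simp)) (zpow_mem (mem _ _ (by simp)) _)
      · exact mem _ _ (by simp)
      · exact mem _ _ (by simp)

theorem type_B4 (h : IsHNF Δ k l m (Q s l) (R t u m)) (hl : Odd (l : ℤ)) (hm : Odd (m : ℤ))
    (hu : Even u) (ht : (k : ℤ) ∣ 2 * t + 1 - 2 * s) : Nonempty (Δ ≃* PiB4) := by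
  obtain ⟨j, hj⟩ := ht
  -- The product `k * j` is the odd number `2 * t + 1 - 2 * s`.
  obtain ⟨a, rfl⟩ : Odd j := by
    by_contra hc
    rw [Int.not_odd_iff_even] at hc
    obtain ⟨b, rfl⟩ := hc
    have : (k : ℤ) * (b + b) = 2 * (k * b) := by ring
    omega
  -- For the new `t` the equation `k = 2 * t + 1 - 2 * s` holds exactly, and this is the relation `r
  -- * q * r⁻¹ = x ^ k * q⁻¹`.
  replace h := h.congr_t (t' := t - k * a) ⟨-a, by ring⟩
  have hj' : (k : ℤ) = 2 * (t - k * a) + 1 - 2 * s := by linear_combination -hj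
  refine nonempty_mulEquiv_piB4 ?_ ?_ ?_ h.independent_of h.eq_closure
  · ext
    · rw [conj_A]; simp [sg_odd hl]
    · rw [conj_b]; simp
    · simp
  · ext
    · rw [conj_A]; simp [sg_odd (hu.add_odd hm)]
    · rw [conj_b]; simp
    · simp
  · ext
    · rw [conj_A]
      simp [sg_odd hl, sg_odd (hu.add_odd hm), Int.odd_iff.1 hm]
      linear_combination (-2) * hj'
    · rw [conj_b]; simp [sg_odd hm]
    · simp

end IsHNF

namespace IsGood

variable {k l m : ℕ} {d : ℤ × ℤ × ℤ}

/-- The parities of `l` and `u + m` tell which of `q`, `r` reverse the x-direction, and the parity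
of `m` tells whether `r` reverses the y-direction. For even `l` and odd `u` goodness makes `s`
2-torsion modulo `k`; for odd `l` and even `m` it does so for `t`. The zero residue gives `PiB1` and
the nonzero one `PiB2`. -/
theorem type_cases (h : IsGood k l m d) :
    (Even l ∧ Even m ∧ Even d.2.2 ∧ Nonempty (sub k l m d ≃* PiG1)) ∨
    (Even l ∧ ¬ Even m ∧ Even d.2.2 ∧ Nonempty (sub k l m d ≃* PiG2)) ∨
    ((Even l ∧ ¬ Even d.2.2 ∧ (k : ℤ) ∣ d.1 ∨ ¬ Even l ∧ Even m ∧ (k : ℤ) ∣ d.2.1) ∧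
      Nonempty (sub k l m d ≃* PiB1)) ∨
    ((Even l ∧ ¬ Even d.2.2 ∧ ¬ (k : ℤ) ∣ d.1 ∨ ¬ Even l ∧ Even m ∧ ¬ (k : ℤ) ∣ d.2.1) ∧
      Nonempty (sub k l m d ≃* PiB2)) ∨
    (¬ Even l ∧ ¬ Even m ∧ Nonempty (sub k l m d ≃* PiB4)) := by
  have hN := h.isHNF
  by_cases hl : Even l
  · have hl' : Even (l : ℤ) := (Int.even_coe_nat l).2 hl
    by_cases hu : Even d.2.2
    · by_cases hm : Even m
      · exact .inl ⟨hl, hm, hu, hN.type_G1 hl' ((Int.even_coe_nat m).2 hm) hu⟩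
      · exact .inr (.inl ⟨hl, hm, hu, hN.type_G2 hl'
          (Int.not_even_iff_odd.1 (mt (Int.even_coe_nat m).1 hm)) hu⟩)
    · have hu' := Int.not_even_iff_odd.1 hu
      have h2 : (k : ℤ) ∣ 2 * d.1 := by
        have := h.of_even hl'
        rw [sg_odd hu'] at this
        have := this.neg_right
        rwa [show -((-1 - 1) * d.1) = 2 * d.1 by ring] at this
      by_cases hs : (k : ℤ) ∣ d.1
      · refine .inr (.inr (.inl ⟨.inl ⟨hl, hu, hs⟩, ?_⟩))
        by_cases hm : Even m
        · exact hN.type_B1_of_even_of_even hl' ((Int.even_coe_nat m).2 hm) hu' hs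
        · exact hN.type_B1_of_even_of_odd hl'
            (Int.not_even_iff_odd.1 (mt (Int.even_coe_nat m).1 hm)) hu' hs
      · refine .inr (.inr (.inr (.inl ⟨.inl ⟨hl, hu, hs⟩, ?_⟩)))
        by_cases hm : Even m
        · exact hN.type_B2_of_even_of_even hl' ((Int.even_coe_nat m).2 hm) hu' h2 hs
        · exact hN.type_B2_of_even_of_odd hl'
            (Int.not_even_iff_odd.1 (mt (Int.even_coe_nat m).1 hm)) hu' h2 hs
  · have hl' : Odd (l : ℤ) := Int.not_even_iff_odd.1 (mt (Int.even_coe_nat l).1 hl)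
    obtain ⟨hu, h1⟩ := h.of_odd hl'
    by_cases hm : Even m
    · have hm' : Even (m : ℤ) := (Int.even_coe_nat m).2 hm
      have h2 : (k : ℤ) ∣ 2 * d.2.1 := by
        rw [sg_even hm', Int.even_iff.1 hm'] at h1
        simpa using h1
      by_cases ht : (k : ℤ) ∣ d.2.1
      · exact .inr (.inr (.inl ⟨.inr ⟨hl, hm, ht⟩, hN.type_B1_of_odd_of_even hl' hm' hu ht⟩))
      · exact .inr (.inr (.inr (.inl ⟨.inr ⟨hl, hm, ht⟩,
          hN.type_B2_of_odd_of_even hl' hm' hu h2 ht⟩)))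
    · have hm' : Odd (m : ℤ) := Int.not_even_iff_odd.1 (mt (Int.even_coe_nat m).1 hm)
      refine .inr (.inr (.inr (.inr ⟨hl, hm, hN.type_B4 hl' hm' hu ?_⟩)))
      rw [sg_odd hm', Int.odd_iff.1 hm'] at h1
      rwa [sub_neg_eq_add, one_add_one_eq_two] at h1

theorem numCharacters_eq {H K L : Type*} [Group H] [Group K] [Group L]
    (h : Nonempty (H ≃* K)) (h' : Nonempty (H ≃* L)) : numCharacters K = numCharacters L :=
  numCharacters_congr (h.some.symm.trans h'.some)

/-- Any alternative of `type_cases` other than the expected one would make two groups with different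
character numbers isomorphic; so the implications there can be reversed. The same argument gives the
other four criteria. -/
theorem piG1_iff (h : IsGood k l m d) :
    Nonempty (sub k l m d ≃* PiG1) ↔ Even l ∧ Even m ∧ Even d.2.2 := by
  constructor
  · intro hX
    have := h.type_cases
    rcases this with ⟨h1, h2, h3, hY⟩ | ⟨h1, h2, h3, hY⟩ | ⟨-, hY⟩ | ⟨-, hY⟩ | ⟨h1, h2, hY⟩
    · exact ⟨h1, h2, h3⟩
    all_goals
      have := numCharacters_eq hX hY
      simp [numCharacters_piG1, numCharacters_piG2, numCharacters_piB1, numCharacters_piB2,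
        numCharacters_piB4] at this
  · have := h.type_cases
    tauto

theorem piG2_iff (h : IsGood k l m d) :
    Nonempty (sub k l m d ≃* PiG2) ↔ Even l ∧ ¬ Even m ∧ Even d.2.2 := by
  constructor
  · intro hX
    have := h.type_cases
    rcases this with ⟨h1, h2, h3, hY⟩ | ⟨h1, h2, h3, hY⟩ | ⟨-, hY⟩ | ⟨-, hY⟩ | ⟨h1, h2, hY⟩
    · have := numCharacters_eq hX hY
      simp [numCharacters_piG1, numCharacters_piG2] at this
    · exact ⟨h1, h2, h3⟩
    all_goals
      have := numCharacters_eq hX hY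
      simp [numCharacters_piG2, numCharacters_piB1, numCharacters_piB2,
        numCharacters_piB4] at this
  · have := h.type_cases
    tauto

theorem piB1_iff (h : IsGood k l m d) :
    Nonempty (sub k l m d ≃* PiB1) ↔
      Even l ∧ ¬ Even d.2.2 ∧ (k : ℤ) ∣ d.1 ∨ ¬ Even l ∧ Even m ∧ (k : ℤ) ∣ d.2.1 := by
  constructor
  · intro hX
    have := h.type_cases
    rcases this with ⟨h1, h2, h3, hY⟩ | ⟨h1, h2, h3, hY⟩ | ⟨h1, -⟩ | ⟨-, hY⟩ | ⟨h1, h2, hY⟩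
    · have := numCharacters_eq hX hY
      simp [numCharacters_piG1, numCharacters_piB1] at this
    · have := numCharacters_eq hX hY
      simp [numCharacters_piG2, numCharacters_piB1] at this
    · exact h1
    all_goals
      have := numCharacters_eq hX hY
      simp [numCharacters_piB1, numCharacters_piB2, numCharacters_piB4] at this
  · have := h.type_cases
    tauto

theorem piB2_iff (h : IsGood k l m d) :
    Nonempty (sub k l m d ≃* PiB2) ↔
      Even l ∧ ¬ Even d.2.2 ∧ ¬ (k : ℤ) ∣ d.1 ∨ ¬ Even l ∧ Even m ∧ ¬ (k : ℤ) ∣ d.2.1 := by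
  constructor
  · intro hX
    have := h.type_cases
    rcases this with ⟨h1, h2, h3, hY⟩ | ⟨h1, h2, h3, hY⟩ | ⟨-, hY⟩ | ⟨h1, -⟩ | ⟨h1, h2, hY⟩
    · have := numCharacters_eq hX hY
      simp [numCharacters_piG1, numCharacters_piB2] at this
    · have := numCharacters_eq hX hY
      simp [numCharacters_piG2, numCharacters_piB2] at this
    · have := numCharacters_eq hX hY
      simp [numCharacters_piB1, numCharacters_piB2] at this
    · exact h1
    · have := numCharacters_eq hX hY
      simp [numCharacters_piB2, numCharacters_piB4] at this
  · have := h.type_cases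
    tauto

theorem piB4_iff (h : IsGood k l m d) :
    Nonempty (sub k l m d ≃* PiB4) ↔ ¬ Even l ∧ ¬ Even m := by
  constructor
  · intro hX
    have := h.type_cases
    rcases this with ⟨h1, h2, h3, hY⟩ | ⟨h1, h2, h3, hY⟩ | ⟨-, hY⟩ | ⟨-, hY⟩ | ⟨h1, h2, hY⟩
    on_goal 5 => exact ⟨h1, h2⟩
    all_goals
      have := numCharacters_eq hX hY
      simp [numCharacters_piG1, numCharacters_piG2, numCharacters_piB1, numCharacters_piB2,
        numCharacters_piB4] at this
  · have := h.type_cases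
    tauto

end IsGood

/-! ### Reduction of the counting problem to transversals -/

theorem conjClass_eq_iff {G : Type*} [Group G] {Δ Δ' : Subgroup G} :
    conjClass Δ = conjClass Δ' ↔ ∃ g : G, Δ.map (MulAut.conj g).toMonoidHom = Δ' := by
  have comp : ∀ (g h : G) (Γ : Subgroup G), (Γ.map (MulAut.conj g).toMonoidHom).map
      (MulAut.conj h).toMonoidHom = Γ.map (MulAut.conj (h * g)).toMonoidHom := by
    intro g h Γ
    rw [Subgroup.map_map]
    congr 1
    ext w
    simp [mul_assoc]
  have one : ∀ Γ : Subgroup G, Γ.map (MulAut.conj (1 : G)).toMonoidHom = Γ := by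
    intro Γ
    ext w
    simp
  constructor
  · intro h
    have : Δ' ∈ conjClass Δ' := ⟨1, one _⟩
    rw [← h] at this
    exact this
  · rintro ⟨g, rfl⟩
    ext Γ
    constructor
    · rintro ⟨h, rfl⟩
      exact ⟨h * g⁻¹, by simp only [comp, inv_mul_cancel_right]⟩
    · rintro ⟨h, rfl⟩
      exact ⟨h * g, by simp only [comp]⟩

/-- A transversal for the conjugacy classes of those subgroups with parameters `k, l, m` that are
isomorphic to `H`. -/
structure IsTransversal (H : Type*) [Group H] (k l m : ℕ) (T : Finset (ℤ × ℤ × ℤ)) : Prop where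
  good : ∀ d ∈ T, IsGood k l m d
  iso : ∀ d ∈ T, Nonempty (sub k l m d ≃* H)
  exists_conj : ∀ d, IsGood k l m d → Nonempty (sub k l m d ≃* H) →
    ∃ r ∈ T, ∃ g : Model, (sub k l m d).map (MulAut.conj g).toMonoidHom = sub k l m r
  eq_of_conj : ∀ d ∈ T, ∀ d' ∈ T, ∀ g : Model,
    (sub k l m d).map (MulAut.conj g).toMonoidHom = sub k l m d' → d = d'

/-- Since `k, l, m` are conjugacy invariants whose product is the index, the transversals for the
different factorizations of `n` together represent every class exactly once. -/
theorem numClasses_model {H : Type*} [Group H] {n : ℕ} (hn : n ≠ 0) {N : ℕ → ℕ → ℕ → ℕ}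
    (h : ∀ k l m, 0 < k → 0 < l → 0 < m → ∃ T, IsTransversal H k l m T ∧ T.card = N k l m) :
    (conjClassesOfType H Model n).Finite ∧
      numClasses H Model n = ∑ f ∈ Nat.finMulAntidiag 3 n, N (f 0) (f 1) (f 2) := by
  have hpos : ∀ f ∈ Nat.finMulAntidiag 3 n, 0 < f 0 ∧ 0 < f 1 ∧ 0 < f 2 := fun f hf =>
    ⟨Nat.pos_of_ne_zero (Nat.ne_zero_of_mem_finMulAntidiag hf 0),
      Nat.pos_of_ne_zero (Nat.ne_zero_of_mem_finMulAntidiag hf 1),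
      Nat.pos_of_ne_zero (Nat.ne_zero_of_mem_finMulAntidiag hf 2)⟩
  have h' : ∀ f : Fin 3 → ℕ, ∃ T, f ∈ Nat.finMulAntidiag 3 n →
      IsTransversal H (f 0) (f 1) (f 2) T ∧ T.card = N (f 0) (f 1) (f 2) := by
    intro f
    by_cases hf : f ∈ Nat.finMulAntidiag 3 n
    · obtain ⟨h0, h1, h2⟩ := hpos f hf
      obtain ⟨T, hT⟩ := h _ _ _ h0 h1 h2
      exact ⟨T, fun _ => hT⟩
    · exact ⟨∅, fun hf' => absurd hf' hf⟩
  choose T hT using h'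
  let F : (Σ _ : Fin 3 → ℕ, ℤ × ℤ × ℤ) → Set (Subgroup Model) :=
    fun p => conjClass (sub (p.1 0) (p.1 1) (p.1 2) p.2)
  have himage : conjClassesOfType H Model n =
      F '' ((Nat.finMulAntidiag 3 n).sigma T : Finset (Σ _ : Fin 3 → ℕ, ℤ × ℤ × ℤ)) := by
    ext C
    simp only [Set.mem_image, Finset.mem_coe, Finset.mem_sigma]
    constructor
    · rintro ⟨Δ, hΔ, ⟨e⟩, rfl⟩
      obtain ⟨k, l, m, d, hd, rfl, hi⟩ := exists_eq_sub (by rw [hΔ]; exact hn)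
      have hf : ![k, l, m] ∈ Nat.finMulAntidiag 3 n := by
        rw [Nat.mem_finMulAntidiag]
        exact ⟨by simp [Fin.prod_univ_three, ← hΔ, hi], hn⟩
      obtain ⟨r, hr, g, hg⟩ := (hT _ hf).1.exists_conj d hd ⟨e⟩
      exact ⟨⟨![k, l, m], r⟩, ⟨hf, hr⟩, (conjClass_eq_iff.2 ⟨g, hg⟩).symm⟩
    · rintro ⟨⟨f, d⟩, ⟨hf, hd⟩, rfl⟩
      have hg := (hT f hf).1.good d hd
      refine ⟨_, ?_, (hT f hf).1.iso d hd, rfl⟩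
      rw [hg.isHNF.index_eq, ← Nat.prod_eq_of_mem_finMulAntidiag hf, Fin.prod_univ_three]
  have hinj : Set.InjOn F
      ((Nat.finMulAntidiag 3 n).sigma T : Finset (Σ _ : Fin 3 → ℕ, ℤ × ℤ × ℤ)) := by
    rintro ⟨f, d⟩ hd ⟨f', d'⟩ hd' e
    simp only [Finset.mem_coe, Finset.mem_sigma] at hd hd'
    obtain ⟨g, hg⟩ := conjClass_eq_iff.1 e
    have hN := ((hT f hd.1).1.good d hd.2).isHNF.map_conj g
    rw [hg] at hN
    obtain ⟨h0, h1, h2⟩ := hN.params_unique ((hT f' hd'.1).1.good d' hd'.2).isHNF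
    obtain rfl : f = f' := by
      ext i
      fin_cases i
      exacts [h0, h1, h2]
    rw [(hT f hd.1).1.eq_of_conj d hd.2 d' hd'.2 g hg]
  constructor
  · rw [himage]
    exact (Finset.finite_toSet _).image _
  · rw [numClasses, himage, hinj.ncard_image, Set.ncard_coe_finset, Finset.card_sigma]
    exact Finset.sum_congr rfl fun f hf => (hT f hf).2

theorem comap_map_conj {G K : Type*} [Group G] [Group K] (e : G ≃* K) (g : K) (Δ : Subgroup K) :
    (Δ.map (MulAut.conj g).toMonoidHom).comap e.toMonoidHom =
      (Δ.comap e.toMonoidHom).map (MulAut.conj (e.symm g)).toMonoidHom := by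
  ext w
  simp only [Subgroup.mem_comap, Subgroup.mem_map]
  constructor
  · rintro ⟨v, hv, hw⟩
    refine ⟨e.symm v, by simpa using hv, ?_⟩
    apply e.injective
    simpa using hw
  · rintro ⟨v, hv, rfl⟩
    exact ⟨e v, hv, by simp⟩

theorem conjClassesOfType_congr (H : Type*) {G K : Type*} [Group H] [Group G] [Group K]
    (e : G ≃* K) (n : ℕ) : conjClassesOfType H G n =
      (Set.image (Subgroup.comap e.toMonoidHom)) '' conjClassesOfType H K n := by
  have hclass : ∀ Δ : Subgroup K, Subgroup.comap e.toMonoidHom '' conjClass Δ =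
      conjClass (Δ.comap e.toMonoidHom) := by
    intro Δ
    ext Γ
    constructor
    · rintro ⟨_, ⟨g, rfl⟩, rfl⟩
      exact ⟨e.symm g, (comap_map_conj e g Δ).symm⟩
    · rintro ⟨g, rfl⟩
      exact ⟨_, ⟨e g, rfl⟩, by rw [comap_map_conj]; simp⟩
  have hiso : ∀ Δ : Subgroup K, Nonempty (Δ.comap e.toMonoidHom ≃* Δ) := fun Δ =>
    ⟨(MulEquiv.subgroupCongr (Subgroup.comap_equiv_eq_map_symm e Δ)).trans
      (e.symm.subgroupMap Δ).symm⟩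
  have hindex : ∀ Δ : Subgroup K, (Δ.comap e.toMonoidHom).index = Δ.index := fun Δ =>
    Subgroup.index_comap_of_surjective Δ e.surjective
  ext C
  constructor
  · rintro ⟨Δ, hΔ, ⟨f⟩, rfl⟩
    have hcc : (Δ.comap e.symm.toMonoidHom).comap e.toMonoidHom = Δ := by
      ext w; simp
    refine ⟨conjClass (Δ.comap e.symm.toMonoidHom), ⟨_, ?_, ?_, rfl⟩, by rw [hclass, hcc]⟩
    · rw [← hindex, hcc, hΔ]
    · have := hiso (Δ.comap e.symm.toMonoidHom)
      rw [hcc] at this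
      exact ⟨this.some.symm.trans f⟩
  · rintro ⟨_, ⟨Δ, hΔ, ⟨f⟩, rfl⟩, rfl⟩
    exact ⟨Δ.comap e.toMonoidHom, by rw [hindex, hΔ], ⟨(hiso Δ).some.trans f⟩, hclass Δ⟩

theorem numClasses_eq {H : Type*} [Group H] {n : ℕ} (hn : n ≠ 0) {N : ℕ → ℕ → ℕ → ℕ}
    (h : ∀ k l m, 0 < k → 0 < l → 0 < m → ∃ T, IsTransversal H k l m T ∧ T.card = N k l m) :
    (conjClassesOfType H PiB4 n).Finite ∧
      numClasses H PiB4 n = ∑ f ∈ Nat.finMulAntidiag 3 n, N (f 0) (f 1) (f 2) := by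
  obtain ⟨e⟩ := nonempty_model_mulEquiv
  obtain ⟨h1, h2⟩ := numClasses_model hn h
  constructor
  · rw [conjClassesOfType_congr H e]
    exact h1.image _
  · rw [← h2, numClasses, numClasses, conjClassesOfType_congr H e]
    refine Set.ncard_image_of_injective _ (Set.image_injective.2 ?_)
    exact Subgroup.comap_injective e.surjective

theorem type_of_index_ne_zero (Δ : Subgroup PiB4) (hΔ : Δ.index ≠ 0) :
    Nonempty (Δ ≃* PiG1) ∨ Nonempty (Δ ≃* PiG2) ∨ Nonempty (Δ ≃* PiB1) ∨
      Nonempty (Δ ≃* PiB2) ∨ Nonempty (Δ ≃* PiB4) := by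
  obtain ⟨e⟩ := nonempty_model_mulEquiv
  have f : Δ ≃* Δ.map e.toMonoidHom := e.subgroupMap Δ
  have hi : (Δ.map e.toMonoidHom).index ≠ 0 := by
    rwa [show (Δ.map e.toMonoidHom).index = Δ.index from Subgroup.index_map_equiv Δ e]
  obtain ⟨k, l, m, d, hd, h, -⟩ := exists_eq_sub hi
  rw [h] at f
  rcases hd.type_cases with ⟨-, -, -, ⟨g⟩⟩ | ⟨-, -, -, ⟨g⟩⟩ | ⟨-, ⟨g⟩⟩ | ⟨-, ⟨g⟩⟩ | ⟨-, -, ⟨g⟩⟩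
  exacts [.inl ⟨f.trans g⟩, .inr (.inl ⟨f.trans g⟩), .inr (.inr (.inl ⟨f.trans g⟩)),
    .inr (.inr (.inr (.inl ⟨f.trans g⟩))), .inr (.inr (.inr (.inr ⟨f.trans g⟩)))]

/-! ### Conjugacy as a system of congruences between the data -/

/-- Conjugacy of the subgroups given by two data. -/
def ConjRel (k l m : ℕ) (d d' : ℤ × ℤ × ℤ) : Prop :=
  ∃ g : Model, (sub k l m d).map (MulAut.conj g).toMonoidHom = sub k l m d'

theorem exists_model_iff {p : ℤ → ℤ → ℤ → Prop} :
    (∃ g : Model, p g.A g.b g.c) ↔ ∃ X Y Z : ℤ, Even (X - Z) ∧ p X Y Z :=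
  ⟨fun ⟨g, hg⟩ => ⟨g.A, g.b, g.c, g.even_sub, hg⟩, fun ⟨X, Y, Z, h, hp⟩ => ⟨⟨X, Y, Z, h⟩, hp⟩⟩

theorem two_mul_dvd_iff {k a b : ℤ} (h : b = 2 * a) : 2 * k ∣ b ↔ k ∣ a := by
  rw [h]
  exact Int.mul_dvd_mul_iff_left two_ne_zero

namespace IsGood

variable {k l m : ℕ} {d d' : ℤ × ℤ × ℤ}

theorem conj_iff_of_even (h : IsGood k l m d) (h' : IsGood k l m d') (hl : Even (l : ℤ))
    (g : Model) : (sub k l m d).map (MulAut.conj g).toMonoidHom = sub k l m d' ↔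
      (k : ℤ) ∣ sg g.b * d.1 - d'.1 ∧
      ∃ j : ℤ, g.b * (1 - sg m) + sg g.c * d.2.2 = d'.2.2 + j * l ∧
        2 * (k : ℤ) ∣ g.A * (1 - sg (d.2.2 + m)) + sg (g.b + g.c) * (2 * d.2.1 + (m : ℤ) % 2) -
          (j * (2 * d'.1) + (2 * d'.2.1 + (m : ℤ) % 2)) := by
  rw [h.isHNF.map_conj_eq_iff_of_even h'.isHNF hl]
  simp only [Q_A, R_A, R_b]
  rw [two_mul_dvd_iff (a := sg g.b * d.1 - d'.1) (by ring)]

theorem conj_iff_of_odd (h : IsGood k l m d) (h' : IsGood k l m d') (hl : Odd (l : ℤ))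
    (g : Model) : (sub k l m d).map (MulAut.conj g).toMonoidHom = sub k l m d' ↔
      (k : ℤ) ∣ g.A + sg (g.b + g.c) * d.1 - d'.1 ∧
      ∃ j : ℤ, g.b * (1 - sg m) + sg g.c * d.2.2 = d'.2.2 + 2 * j * l ∧
        2 * (k : ℤ) ∣ g.A * (1 - sg m) + sg (g.b + g.c) * (2 * d.2.1 + (m : ℤ) % 2) -
          (2 * d'.2.1 + (m : ℤ) % 2) := by
  rw [h.isHNF.map_conj_eq_iff_of_odd h'.isHNF hl (h.of_odd hl).1 (h'.of_odd hl).1]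
  simp only [Q_A, R_A, R_b]
  rw [two_mul_dvd_iff (a := g.A + sg (g.b + g.c) * d.1 - d'.1) (by ring)]

theorem dvd_sg_mul_sub_iff {k s s' : ℤ} (h : k ∣ 2 * s) (e : ℤ) :
    k ∣ sg e * s - s' ↔ k ∣ s - s' := by
  rcases sg_eq_one_or e with h' | h' <;> rw [h']
  · rw [one_mul]
  · rw [show -1 * s - s' = (s - s') - 2 * s by ring]
    exact (dvd_sub_left h)

theorem dvd_two_mul_s (h : IsGood k l m d) (hl : Even (l : ℤ)) (hu : Odd d.2.2) :
    (k : ℤ) ∣ 2 * d.1 := by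
  have := (h.of_even hl).neg_right
  rw [sg_odd hu] at this
  rwa [show -((-1 - 1) * d.1) = 2 * d.1 by ring] at this

theorem dvd_two_mul_t (h : IsGood k l m d) (hl : Odd (l : ℤ)) (hm : Even (m : ℤ)) :
    (k : ℤ) ∣ 2 * d.2.1 := by
  have := (h.of_odd hl).2
  rw [sg_even hm, Int.even_iff.1 hm] at this
  simpa using this

/-- Solving a congruence modulo `k` by an integer of given parity. -/
theorem exists_dvd_add_iff (k : ℕ) (Z a : ℤ) :
    (∃ X : ℤ, Even (X - Z) ∧ (k : ℤ) ∣ X + a) ↔ (Even k → Even (Z + a)) := by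
  constructor
  · rintro ⟨X, hX, hd⟩ hk
    have h1 : Even (X + a) := even_iff_two_dvd.2 (((Int.even_coe_nat k).2 hk).two_dvd.trans hd)
    rw [show Z + a = (X + a) - (X - Z) by ring]
    exact h1.sub hX
  · intro h
    by_cases hk : Even k
    · refine ⟨-a, ?_, by simp⟩
      rw [show -a - Z = -(Z + a) by ring]
      exact (h hk).neg
    · have hk' : Odd (k : ℤ) := Int.not_even_iff_odd.1 (mt (Int.even_coe_nat k).1 hk)
      rcases Int.even_or_odd (Z + a) with hZ | hZ
      · refine ⟨-a, ?_, by simp⟩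
        rw [show -a - Z = -(Z + a) by ring]
        exact hZ.neg
      -- Adding the odd number `k` corrects the parity of the solution `-a`.
      · refine ⟨-a + k, ?_, by simp⟩
        rw [show -a + k - Z = k - (Z + a) by ring]
        exact hk'.sub_odd hZ

theorem even_sg_mul_add (e a b : ℤ) : Even (sg e * a + b) ↔ Even (a + b) := by
  rcases sg_eq_one_or e with h | h <;> rw [h] <;> simp [Int.even_add]

/-- As `r` reverses the x-direction, `X` enters with coefficient 2, and after halving it adjusts `t`
freely modulo `k`, except that `X` must have the parity of `Z`. For even `k` a parity condition
survives: a reflection of `u` (odd `Z`) goes with a change of parity. The residue of `s` is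
2-torsion, so signs do not affect it. -/
theorem conjRel_iff_of_even_even_odd (h : IsGood k l m d) (h' : IsGood k l m d')
    (hl : Even (l : ℤ)) (hm : Even (m : ℤ)) (hu : Odd d.2.2) :
    ConjRel k l m d d' ↔ (k : ℤ) ∣ d.1 - d'.1 ∧ ∃ j : ℤ,
      (d.2.2 = d'.2.2 + j * l ∧ (Even k → Even (d.2.1 - d'.2.1 - j * d'.1))) ∨
      (-d.2.2 = d'.2.2 + j * l ∧ (Even k → Odd (d.2.1 - d'.2.1 - j * d'.1))) := by
  have e1 : ∀ X Y Z j : ℤ, 2 * (k : ℤ) ∣ X * (1 - sg (d.2.2 + m)) +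
      sg (Y + Z) * (2 * d.2.1 + (m : ℤ) % 2) - (j * (2 * d'.1) + (2 * d'.2.1 + (m : ℤ) % 2)) ↔
      (k : ℤ) ∣ X + (sg (Y + Z) * d.2.1 - (j * d'.1 + d'.2.1)) := fun X Y Z j =>
    two_mul_dvd_iff (by rw [sg_odd (hu.add_even hm), Int.even_iff.1 hm]; ring)
  have e2 : ∀ Y Z j : ℤ, Even (Z + (sg (Y + Z) * d.2.1 - (j * d'.1 + d'.2.1))) ↔
      Even (Z + (d.2.1 - d'.2.1 - j * d'.1)) := by
    intro Y Z j
    rw [show Z + (sg (Y + Z) * d.2.1 - (j * d'.1 + d'.2.1)) =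
      sg (Y + Z) * d.2.1 + (Z - (j * d'.1 + d'.2.1)) by ring, even_sg_mul_add]
    rw [show d.2.1 + (Z - (j * d'.1 + d'.2.1)) = Z + (d.2.1 - d'.2.1 - j * d'.1) by ring]
  rw [ConjRel]
  simp_rw [h.conj_iff_of_even h' hl, e1, sg_even hm]
  rw [exists_model_iff (p := fun X Y Z => (k : ℤ) ∣ sg Y * d.1 - d'.1 ∧ ∃ j : ℤ,
    Y * (1 - 1) + sg Z * d.2.2 = d'.2.2 + j * l ∧
    (k : ℤ) ∣ X + (sg (Y + Z) * d.2.1 - (j * d'.1 + d'.2.1)))]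
  simp_rw [dvd_sg_mul_sub_iff (h.dvd_two_mul_s hl hu)]
  constructor
  · rintro ⟨X, Y, Z, hX, h1, j, h2, h3⟩
    have h4 := (exists_dvd_add_iff k Z _).1 ⟨X, hX, h3⟩
    rw [e2] at h4
    refine ⟨h1, j, ?_⟩
    rcases Int.even_or_odd Z with hZ | hZ
    · rw [sg_even hZ] at h2
      refine .inl ⟨by linarith, fun hk => ?_⟩
      have := (h4 hk).sub hZ
      rwa [add_sub_cancel_left] at this
    · rw [sg_odd hZ] at h2
      refine .inr ⟨by linarith, fun hk => ?_⟩
      have := (h4 hk).sub_odd hZ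
      rwa [add_sub_cancel_left] at this
  · rintro ⟨h1, j, ⟨h2, h3⟩ | ⟨h2, h3⟩⟩
    · obtain ⟨X, hX, h4⟩ := (exists_dvd_add_iff k 0 _).2 (fun hk => (e2 0 0 j).2
        (by simpa using h3 hk))
      exact ⟨X, 0, 0, hX, h1, j, by simp [h2], h4⟩
    · obtain ⟨X, hX, h4⟩ := (exists_dvd_add_iff k 1 _).2 (fun hk => (e2 0 1 j).2
        (odd_one.add_odd (h3 hk)))
      exact ⟨X, 0, 1, hX, h1, j, by simp [h2], h4⟩

/-- The mechanism is the same with `s` and `t` exchanged: `q` reverses the x-direction, so `X` moves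
`s`, while `t` is 2-torsion and stays fixed modulo `k`. -/
theorem conjRel_iff_of_odd_even (h : IsGood k l m d) (h' : IsGood k l m d')
    (hl : Odd (l : ℤ)) (hm : Even (m : ℤ)) :
    ConjRel k l m d d' ↔ (k : ℤ) ∣ d.2.1 - d'.2.1 ∧ ∃ j : ℤ,
      (d.2.2 = d'.2.2 + 2 * j * l ∧ (Even k → Even (d.1 - d'.1))) ∨
      (-d.2.2 = d'.2.2 + 2 * j * l ∧ (Even k → Odd (d.1 - d'.1))) := by
  have e1 : ∀ X Y Z : ℤ, 2 * (k : ℤ) ∣ X * (1 - sg m) +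
      sg (Y + Z) * (2 * d.2.1 + (m : ℤ) % 2) - (2 * d'.2.1 + (m : ℤ) % 2) ↔
      (k : ℤ) ∣ d.2.1 - d'.2.1 := fun X Y Z =>
    (two_mul_dvd_iff (a := sg (Y + Z) * d.2.1 - d'.2.1)
      (by rw [sg_even hm, Int.even_iff.1 hm]; ring)).trans
      (dvd_sg_mul_sub_iff (h.dvd_two_mul_t hl hm) _)
  have e2 : ∀ Y Z : ℤ, Even (Z + (sg (Y + Z) * d.1 - d'.1)) ↔ Even (Z + (d.1 - d'.1)) := by
    intro Y Z
    rw [show Z + (sg (Y + Z) * d.1 - d'.1) = sg (Y + Z) * d.1 + (Z - d'.1) by ring,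
      even_sg_mul_add, show d.1 + (Z - d'.1) = Z + (d.1 - d'.1) by ring]
  rw [ConjRel]
  simp_rw [h.conj_iff_of_odd h' hl, e1, sg_even hm]
  rw [exists_model_iff (p := fun X Y Z => (k : ℤ) ∣ X + sg (Y + Z) * d.1 - d'.1 ∧ ∃ j : ℤ,
    Y * (1 - 1) + sg Z * d.2.2 = d'.2.2 + 2 * j * l ∧ (k : ℤ) ∣ d.2.1 - d'.2.1)]
  simp_rw [add_sub_assoc]
  constructor
  · rintro ⟨X, Y, Z, hX, h1, j, h2, h3⟩
    have h4 := (exists_dvd_add_iff k Z _).1 ⟨X, hX, h1⟩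
    rw [e2] at h4
    refine ⟨h3, j, ?_⟩
    rcases Int.even_or_odd Z with hZ | hZ
    · rw [sg_even hZ] at h2
      refine .inl ⟨by linarith, fun hk => ?_⟩
      have := (h4 hk).sub hZ
      rwa [add_sub_cancel_left] at this
    · rw [sg_odd hZ] at h2
      refine .inr ⟨by linarith, fun hk => ?_⟩
      have := (h4 hk).sub_odd hZ
      rwa [add_sub_cancel_left] at this
  · rintro ⟨h1, j, ⟨h2, h3⟩ | ⟨h2, h3⟩⟩
    · obtain ⟨X, hX, h4⟩ := (exists_dvd_add_iff k 0 _).2 (fun hk => (e2 0 0).2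
        (by simpa using h3 hk))
      exact ⟨X, 0, 0, hX, h4, j, by simp [h2], h1⟩
    · obtain ⟨X, hX, h4⟩ := (exists_dvd_add_iff k 1 _).2 (fun hk => (e2 0 1).2
        (odd_one.add_odd (h3 hk)))
      exact ⟨X, 0, 1, hX, h4, j, by simp [h2], h1⟩

/-- For odd `m` the half translation in `r` contributes `sg (Y + Z) - 1`; halving it leaves `c`, of
which only the parity matters. -/
theorem exists_sg_eq (w : ℤ) : ∃ c : ℤ, sg w = 1 + 2 * c ∧ Even (c - w) := by
  rcases Int.even_or_odd w with h | h
  · exact ⟨0, by rw [sg_even h]; rfl, by simpa using h⟩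
  · exact ⟨-1, by rw [sg_odd h]; rfl, odd_neg_one.sub_odd h⟩

/-- The half translation contributes the parity of `Y + Z`, and `X` has the parity of `Z`. The two
occurrences of `Z` cancel, so that `Y` alone enters the parity condition on `t`. -/
theorem conjRel_iff_of_even_odd_even (h : IsGood k l m d) (h' : IsGood k l m d')
    (hl : Even (l : ℤ)) (hm : Odd (m : ℤ)) (hu : Even d.2.2) :
    ConjRel k l m d d' ↔ ∃ Y Z j : ℤ, (k : ℤ) ∣ sg Y * d.1 - d'.1 ∧
      2 * Y + sg Z * d.2.2 = d'.2.2 + j * l ∧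
      (Even k → Even (d.2.1 - d'.2.1 + Y - j * d'.1)) := by
  have e1 : ∀ X Y Z j : ℤ, (∃ X : ℤ, Even (X - Z) ∧ 2 * (k : ℤ) ∣ X * (1 - sg (d.2.2 + m)) +
      sg (Y + Z) * (2 * d.2.1 + (m : ℤ) % 2) - (j * (2 * d'.1) + (2 * d'.2.1 + (m : ℤ) % 2))) ↔
      (Even k → Even (d.2.1 - d'.2.1 + Y - j * d'.1)) := by
    intro X Y Z j
    obtain ⟨c, hc, hc'⟩ := exists_sg_eq (Y + Z)
    have : ∀ X : ℤ, 2 * (k : ℤ) ∣ X * (1 - sg (d.2.2 + m)) +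
      sg (Y + Z) * (2 * d.2.1 + (m : ℤ) % 2) - (j * (2 * d'.1) + (2 * d'.2.1 + (m : ℤ) % 2)) ↔
      (k : ℤ) ∣ X + (sg (Y + Z) * d.2.1 + (c - j * d'.1 - d'.2.1)) := fun X =>
      two_mul_dvd_iff (by rw [sg_odd (hu.add_odd hm), Int.odd_iff.1 hm, hc]; ring)
    simp_rw [this]
    rw [exists_dvd_add_iff, show Z + (sg (Y + Z) * d.2.1 + (c - j * d'.1 - d'.2.1)) =
      sg (Y + Z) * d.2.1 + (Z + (c - j * d'.1 - d'.2.1)) by ring, even_sg_mul_add]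
    refine imp_congr_right fun _ => ?_
    rw [show d.2.1 + (Z + (c - j * d'.1 - d'.2.1)) = (d.2.1 - d'.2.1 + Y - j * d'.1) +
      ((c - (Y + Z)) + 2 * Z) by ring]
    have hev : Even (c - (Y + Z) + 2 * Z) := hc'.add (even_two_mul Z)
    rw [Int.even_add]
    tauto
  rw [ConjRel]
  simp_rw [h.conj_iff_of_even h' hl, sg_odd hm]
  rw [exists_model_iff (p := fun X Y Z => (k : ℤ) ∣ sg Y * d.1 - d'.1 ∧ ∃ j : ℤ,
    Y * (1 - -1) + sg Z * d.2.2 = d'.2.2 + j * l ∧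
    2 * (k : ℤ) ∣ X * (1 - sg (d.2.2 + m)) +
      sg (Y + Z) * (2 * d.2.1 + (m : ℤ) % 2) - (j * (2 * d'.1) + (2 * d'.2.1 + (m : ℤ) % 2)))]
  constructor
  · rintro ⟨X, Y, Z, hX, h1, j, h2, h3⟩
    exact ⟨Y, Z, j, h1, by linarith, (e1 X Y Z j).1 ⟨X, hX, h3⟩⟩
  · rintro ⟨Y, Z, j, h1, h2, h3⟩
    obtain ⟨X, hX, h4⟩ := (e1 0 Y Z j).2 h3
    exact ⟨X, Y, Z, hX, h1, j, by linarith, h4⟩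

/-- Here `u + m` is even, so `r` commutes with the translations along x and `X` drops out; the
choice `X = Z` satisfies its parity constraint. -/
theorem conjRel_iff_of_even_odd_odd (h : IsGood k l m d) (h' : IsGood k l m d')
    (hl : Even (l : ℤ)) (hm : Odd (m : ℤ)) (hu : Odd d.2.2) :
    ConjRel k l m d d' ↔ (k : ℤ) ∣ d.1 - d'.1 ∧ ∃ Y Z j : ℤ,
      2 * Y + sg Z * d.2.2 = d'.2.2 + j * l ∧
      2 * (k : ℤ) ∣ sg (Y + Z) * (2 * d.2.1 + 1) - j * (2 * d'.1) - (2 * d'.2.1 + 1) := by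
  rw [ConjRel]
  simp_rw [h.conj_iff_of_even h' hl, sg_odd hm, sg_even (hu.add_odd hm), Int.odd_iff.1 hm,
    dvd_sg_mul_sub_iff (h.dvd_two_mul_s hl hu)]
  rw [exists_model_iff (p := fun X Y Z => (k : ℤ) ∣ d.1 - d'.1 ∧ ∃ j : ℤ,
    Y * (1 - -1) + sg Z * d.2.2 = d'.2.2 + j * l ∧
    2 * (k : ℤ) ∣ X * (1 - 1) +
      sg (Y + Z) * (2 * d.2.1 + 1) - (j * (2 * d'.1) + (2 * d'.2.1 + 1)))]
  constructor
  · rintro ⟨X, Y, Z, hX, h1, j, h2, h3⟩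
    refine ⟨h1, Y, Z, j, by linarith, ?_⟩
    rwa [sub_self, mul_zero, zero_add, ← sub_sub] at h3
  · rintro ⟨h1, Y, Z, j, h2, h3⟩
    refine ⟨Z, Y, Z, by simp, h1, j, by linarith, ?_⟩
    rwa [sub_self, mul_zero, zero_add, ← sub_sub]

/-- All generators preserve the directions of x and y, so only the two signs `sg g.b` and `sg g.c`
of the conjugating element matter. -/
theorem conj_iff_of_even_even_even (h : IsGood k l m d) (h' : IsGood k l m d')
    (hl : Even (l : ℤ)) (hm : Even (m : ℤ)) (hu : Even d.2.2) (g : Model) :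
    (sub k l m d).map (MulAut.conj g).toMonoidHom = sub k l m d' ↔
      (k : ℤ) ∣ sg g.b * d.1 - d'.1 ∧ ∃ j : ℤ, sg g.c * d.2.2 = d'.2.2 + j * l ∧
        (k : ℤ) ∣ sg g.b * sg g.c * d.2.1 - j * d'.1 - d'.2.1 := by
  rw [h.conj_iff_of_even h' hl]
  refine and_congr_right fun _ => exists_congr fun j => ?_
  rw [sg_even hm, sg_even (hu.add hm), sub_self, mul_zero, zero_add, mul_zero, zero_add,
    two_mul_dvd_iff (a := sg g.b * sg g.c * d.2.1 - j * d'.1 - d'.2.1)]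
  rw [Int.even_iff.1 hm, sg_add]
  ring

end IsGood

/-- Transversals in terms of the relation on data. -/
theorem isTransversal_of {H : Type*} [Group H] {k l m : ℕ} {T : Finset (ℤ × ℤ × ℤ)}
    {p : ℤ × ℤ × ℤ → Prop}
    (hp : ∀ d, IsGood k l m d → (Nonempty (sub k l m d ≃* H) ↔ p d))
    (good : ∀ d ∈ T, IsGood k l m d) (type : ∀ d ∈ T, p d)
    (h1 : ∀ d, IsGood k l m d → p d → ∃ r ∈ T, ConjRel k l m d r)
    (h2 : ∀ d ∈ T, ∀ d' ∈ T, ConjRel k l m d d' → d = d') : IsTransversal H k l m T where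
  good := good
  iso d hd := (hp d (good d hd)).2 (type d hd)
  exists_conj d hd hd' := h1 d hd ((hp d hd).1 hd')
  eq_of_conj d hd d' hd' g hg := h2 d hd d' hd' ⟨g, hg⟩

/-! ### Representatives modulo translations and reflections -/

theorem exists_rep {N : ℕ} (hN : 0 < N) (a : ℤ) : ∃ v < N, ∃ j : ℤ, a = v + j * N := by
  have hN' : (0 : ℤ) < N := by exact_mod_cast hN
  refine ⟨(a % N).toNat, ?_, a / N, ?_⟩
  · have := Int.emod_lt_of_pos a hN'
    have := Int.emod_nonneg a hN'.ne'
    omega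
  · rw [Int.toNat_of_nonneg (Int.emod_nonneg a hN'.ne')]
    linarith [Int.emod_add_mul_ediv a N]

theorem rep_unique {N v v' : ℕ} (hv : v < N) (hv' : v' < N) {j : ℤ}
    (h : (v : ℤ) = v' + j * N) : v = v' ∧ j = 0 := by
  have h1 : (v : ℤ) = v' := IsHNF.eq_of_dvd_sub_of_lt (n := N) ⟨j, by rw [h]; ring⟩ (by simp)
    (by exact_mod_cast hv) (by simp) (by exact_mod_cast hv')
  refine ⟨by exact_mod_cast h1, ?_⟩
  rw [h1, left_eq_add, mul_eq_zero] at h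
  exact h.resolve_right (by exact_mod_cast (Nat.zero_lt_of_lt hv).ne')

/-- The map `a ↦ -1 - a` is the effect of `u ↦ -u` on `u = 2 * a + 1`. Modulo `N` it pairs `v` with
`N - 1 - v` and has a fixed point only for odd `N`, which leaves `(N + 1) / 2` orbits. -/
theorem exists_reflect_rep {N : ℕ} (hN : 0 < N) (a : ℤ) :
    ∃ v < (N + 1) / 2, ∃ j : ℤ, a = v + j * N ∨ -1 - a = v + j * N := by
  obtain ⟨v, hv, j, h⟩ := exists_rep hN a
  by_cases hv' : v < (N + 1) / 2
  · exact ⟨v, hv', j, .inl h⟩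
  · refine ⟨N - 1 - v, by omega, -(j + 1), .inr ?_⟩
    rw [Nat.sub_sub, Nat.cast_sub (by omega), h]
    push_cast
    ring

/-- Representatives can be reflections of each other only at the fixed point. The value `j = -1`
there is needed where a translation has side effects on a parity. -/
theorem reflect_unique {N v v' : ℕ} (hv : v < (N + 1) / 2) (hv' : v' < (N + 1) / 2) {j : ℤ}
    (h : -1 - (v : ℤ) = v' + j * N) : v = v' ∧ j = -1 ∧ 2 * v + 1 = N := by
  have hN : 0 < N := by omega
  have hd : (N : ℤ) ∣ ((v + v' + 1 : ℕ) : ℤ) := ⟨-j, by push_cast; linarith⟩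
  have h1 : N ∣ v + v' + 1 := by exact_mod_cast hd
  have h2 := Nat.le_of_dvd (by omega) h1
  have h3 : v = v' ∧ 2 * v + 1 = N := by omega
  refine ⟨h3.1, ?_, h3.2⟩
  have h4 : ((j + 1) * N : ℤ) = 0 := by
    have : (N : ℤ) = 2 * v + 1 := by exact_mod_cast h3.2.symm
    have h5 : (v : ℤ) = v' := by exact_mod_cast h3.1
    linarith
  rw [mul_eq_zero] at h4
  have := h4.resolve_right (by exact_mod_cast hN.ne')
  linarith

theorem exists_neg_rep {N : ℕ} (hN : Odd N) (a : ℤ) :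
    ∃ v < (N + 1) / 2, ∃ j : ℤ, a = v + j * N ∨ -a = v + j * N := by
  obtain ⟨v, hv, j, h⟩ := exists_rep hN.pos a
  by_cases hv' : v < (N + 1) / 2
  · exact ⟨v, hv', j, .inl h⟩
  · rw [Nat.odd_iff] at hN
    refine ⟨N - v, by omega, -(j + 1), .inr ?_⟩
    rw [Nat.cast_sub (by omega), h]
    ring

theorem neg_unique {N v v' : ℕ} (hN : Odd N) (hv : v < (N + 1) / 2) (hv' : v' < (N + 1) / 2)
    {j : ℤ} (h : -(v : ℤ) = v' + j * N) : v = v' := by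
  rw [Nat.odd_iff] at hN
  have hd : (N : ℤ) ∣ ((v + v' : ℕ) : ℤ) := ⟨-j, by push_cast; linarith⟩
  have h1 : N ∣ v + v' := by exact_mod_cast hd
  have h2 := Nat.eq_zero_of_dvd_of_lt h1 (by omega)
  omega

theorem exists_parity (a : ℤ) : ∃ e < 2, Even (a - (e : ℕ)) := by
  rcases Int.even_or_odd a with h | h
  · exact ⟨0, by norm_num, by simpa using h⟩
  · exact ⟨1, by norm_num, by simpa using h.sub_odd odd_one⟩

theorem parity_unique {e e' : ℕ} (he : e < 2) (he' : e' < 2) (h : Even ((e : ℤ) - e')) :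
    e = e' := by
  rw [Int.even_iff] at h
  omega

/-! ### Transversals -/

variable {H : Type*} [Group H] {k l m : ℕ}

theorem isGood_of_even {s t u : ℤ} (hk : 0 < k) (hl0 : 0 < l) (hm0 : 0 < m) (hl : Even (l : ℤ))
    (h : (k : ℤ) ∣ (sg u - 1) * s) : IsGood k l m (s, t, u) :=
  ⟨hk, hl0, hm0, fun _ => h, fun hl' => absurd hl (Int.not_even_iff_odd.2 hl')⟩

theorem isGood_of_odd_u {s t u : ℤ} (hk : 0 < k) (hl0 : 0 < l) (hm0 : 0 < m) (hl : Even (l : ℤ))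
    (hu : Odd u) (h : (k : ℤ) ∣ 2 * s) : IsGood k l m (s, t, u) := by
  refine isGood_of_even hk hl0 hm0 hl ?_
  rw [sg_odd hu, show (-1 - 1) * s = -(2 * s) by ring]
  exact h.neg_right

/-! ### Transversals for even `l`, even `m` and odd `u` -/

section EvenEvenOdd

variable {s₀ : ℤ} {L : ℕ}

/-- With `s` fixed at the residue `s₀`, the datum `a` in `u = 2 * a + 1` may be translated by `L`.
For even `k` a reflection changes the parity of `t`, so the reflections are used up in making `t`
even, and `a` modulo `L` remains. -/
theorem transversal_even_even_odd (hk0 : 0 < k) (hL : 0 < L) (hm0 : 0 < m) (hm : Even (m : ℤ))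
    (hk : Even k) (hs : Even s₀) (hks : (k : ℤ) ∣ 2 * s₀)
    (hp : ∀ d, IsGood k (2 * L) m d → (Nonempty (sub k (2 * L) m d ≃* H) ↔
      Odd d.2.2 ∧ (k : ℤ) ∣ d.1 - s₀)) :
    ∃ T, IsTransversal H k (2 * L) m T ∧ T.card = L := by
  have hl : Even ((2 * L : ℕ) : ℤ) := by simp
  have good : ∀ v : ℕ, IsGood k (2 * L) m (s₀, 0, 2 * v + 1) := fun v =>
    isGood_of_odd_u hk0 (by omega) hm0 hl (odd_two_mul_add_one _) hks
  refine ⟨(Finset.range L).image fun v : ℕ => (s₀, 0, 2 * (v : ℤ) + 1),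
    isTransversal_of hp ?_ ?_ ?_ ?_, ?_⟩
  · simp only [Finset.mem_image, Finset.mem_range]
    rintro _ ⟨v, -, rfl⟩
    exact good v
  · simp only [Finset.mem_image, Finset.mem_range]
    rintro _ ⟨v, -, rfl⟩
    exact ⟨odd_two_mul_add_one _, by simp⟩
  · rintro ⟨s, t, u⟩ hd ⟨hu, hds⟩
    simp only at hu hds
    obtain ⟨a, rfl⟩ := hu
    simp only [Finset.mem_image, Finset.mem_range, exists_exists_and_eq_and]
    rcases Int.even_or_odd t with ht | ht
    · obtain ⟨v, hv, j, rfl⟩ := exists_rep hL a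
      refine ⟨v, hv, (hd.conjRel_iff_of_even_even_odd (good v) hl hm (odd_two_mul_add_one _)).2
        ⟨hds, j, .inl ⟨by push_cast; ring, fun _ => ?_⟩⟩⟩
      simp only [sub_zero]
      exact ht.sub (hs.mul_left j)
    · obtain ⟨v, hv, j, h⟩ := exists_rep hL (-1 - a)
      refine ⟨v, hv, (hd.conjRel_iff_of_even_even_odd (good v) hl hm (odd_two_mul_add_one _)).2
        ⟨hds, j, .inr ⟨by push_cast; linarith, fun _ => ?_⟩⟩⟩
      simp only [sub_zero]
      exact ht.sub_even (hs.mul_left j)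
  · simp only [Finset.mem_image, Finset.mem_range]
    rintro _ ⟨v, hv, rfl⟩ _ ⟨v', hv', rfl⟩ hc
    obtain ⟨-, j, ⟨h1, -⟩ | ⟨-, h2⟩⟩ := ((good v).conjRel_iff_of_even_even_odd (good v') hl hm
      (odd_two_mul_add_one _)).1 hc
    · push_cast at h1
      rw [(rep_unique hv hv' (j := j) (by linarith)).1]
    · have h3 := h2 hk
      simp only [sub_zero, zero_sub] at h3
      exact absurd (hs.mul_left j).neg (Int.not_even_iff_odd.2 h3)
  · rw [Finset.card_image_of_injective, Finset.card_range]
    intro v v' h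
    simpa using h

/-- For odd `k` no parity of `t` is left, and `a` modulo `L` counts only up to reflection. -/
theorem transversal_even_even_odd_of_odd (hk0 : 0 < k) (hL : 0 < L) (hm0 : 0 < m)
    (hm : Even (m : ℤ)) (hk : Odd k)
    (hp : ∀ d, IsGood k (2 * L) m d → (Nonempty (sub k (2 * L) m d ≃* H) ↔
      Odd d.2.2 ∧ (k : ℤ) ∣ d.1)) :
    ∃ T, IsTransversal H k (2 * L) m T ∧ T.card = (L + 1) / 2 := by
  have hl : Even ((2 * L : ℕ) : ℤ) := by simp
  have hk' : ¬ Even k := Nat.not_even_iff_odd.2 hk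
  have good : ∀ v : ℕ, IsGood k (2 * L) m (0, 0, 2 * v + 1) := fun v =>
    isGood_of_odd_u hk0 (by omega) hm0 hl (odd_two_mul_add_one _) (by simp)
  refine ⟨(Finset.range ((L + 1) / 2)).image fun v : ℕ => (0, 0, 2 * (v : ℤ) + 1),
    isTransversal_of hp ?_ ?_ ?_ ?_, ?_⟩
  · simp only [Finset.mem_image, Finset.mem_range]
    rintro _ ⟨v, -, rfl⟩
    exact good v
  · simp only [Finset.mem_image, Finset.mem_range]
    rintro _ ⟨v, -, rfl⟩
    exact ⟨odd_two_mul_add_one _, by simp⟩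
  · rintro ⟨s, t, u⟩ hd ⟨hu, hds⟩
    simp only at hu hds
    obtain ⟨a, rfl⟩ := hu
    simp only [Finset.mem_image, Finset.mem_range, exists_exists_and_eq_and]
    obtain ⟨v, hv, j, h⟩ := exists_reflect_rep hL a
    refine ⟨v, hv, (hd.conjRel_iff_of_even_even_odd (good v) hl hm (odd_two_mul_add_one _)).2
      ⟨by simpa using hds, j, ?_⟩⟩
    rcases h with h | h
    · exact .inl ⟨by push_cast; linarith, fun hk => absurd hk hk'⟩
    · exact .inr ⟨by push_cast; linarith, fun hk => absurd hk hk'⟩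
  · simp only [Finset.mem_image, Finset.mem_range]
    rintro _ ⟨v, hv, rfl⟩ _ ⟨v', hv', rfl⟩ hc
    obtain ⟨-, j, ⟨h1, -⟩ | ⟨h1, -⟩⟩ := ((good v).conjRel_iff_of_even_even_odd (good v') hl hm
      (odd_two_mul_add_one _)).1 hc
    · push_cast at h1
      rw [(rep_unique (N := L) (v := v) (v' := v') (by omega) (by omega) (j := j) (by linarith)).1]
    · push_cast at h1
      rw [(reflect_unique hv hv' (j := j) (by linarith)).1]
  · rw [Finset.card_image_of_injective, Finset.card_range]
    intro v v' h
    simpa using h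

/-- For odd `s₀` a translation of `u` by `l` also changes the parity of `t`. At the fixed point of
the reflection, where `j = -1`, the two changes cancel, so both parities give separate classes there
too. -/
theorem transversal_even_even_odd_of_odd_s (hk0 : 0 < k) (hL : 0 < L) (hm0 : 0 < m)
    (hm : Even (m : ℤ)) (hk : Even k) (hs : Odd s₀) (hks : (k : ℤ) ∣ 2 * s₀)
    (hp : ∀ d, IsGood k (2 * L) m d → (Nonempty (sub k (2 * L) m d ≃* H) ↔
      Odd d.2.2 ∧ (k : ℤ) ∣ d.1 - s₀)) :
    ∃ T, IsTransversal H k (2 * L) m T ∧ T.card = 2 * ((L + 1) / 2) := by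
  have hl : Even ((2 * L : ℕ) : ℤ) := by simp
  have good : ∀ v e : ℕ, IsGood k (2 * L) m (s₀, e, 2 * v + 1) := fun v e =>
    isGood_of_odd_u hk0 (by omega) hm0 hl (odd_two_mul_add_one _) hks
  refine ⟨(Finset.range 2 ×ˢ Finset.range ((L + 1) / 2)).image fun w : ℕ × ℕ =>
    (s₀, (w.1 : ℤ), 2 * (w.2 : ℤ) + 1), isTransversal_of hp ?_ ?_ ?_ ?_, ?_⟩
  · simp only [Finset.mem_image]
    rintro _ ⟨⟨e, v⟩, -, rfl⟩
    exact good v e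
  · simp only [Finset.mem_image]
    rintro _ ⟨⟨e, v⟩, -, rfl⟩
    exact ⟨odd_two_mul_add_one _, by simp⟩
  · rintro ⟨s, t, u⟩ hd ⟨hu, hds⟩
    simp only at hu hds
    obtain ⟨a, rfl⟩ := hu
    obtain ⟨v, hv, j, h | h⟩ := exists_reflect_rep hL a
    · obtain ⟨e, he, he'⟩ := exists_parity (t - j * s₀)
      refine ⟨_, Finset.mem_image.2 ⟨(e, v), by simp [he, hv], rfl⟩,
        (hd.conjRel_iff_of_even_even_odd (good v e) hl hm
        (odd_two_mul_add_one _)).2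
        ⟨by simpa using hds, j, .inl ⟨by push_cast; linarith, fun _ => ?_⟩⟩⟩
      rwa [sub_right_comm] at he'
    · obtain ⟨e, he, he'⟩ := exists_parity (t - j * s₀ - 1)
      refine ⟨_, Finset.mem_image.2 ⟨(e, v), by simp [he, hv], rfl⟩,
        (hd.conjRel_iff_of_even_even_odd (good v e) hl hm
        (odd_two_mul_add_one _)).2
        ⟨by simpa using hds, j, .inr ⟨by push_cast; linarith, fun _ => ?_⟩⟩⟩
      have := he'.add_odd odd_one
      rwa [show t - j * s₀ - 1 - e + 1 = t - e - j * s₀ by ring] at this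
  · simp only [Finset.mem_image, Finset.mem_product, Finset.mem_range]
    rintro _ ⟨⟨e, v⟩, ⟨he, hv⟩, rfl⟩ _ ⟨⟨e', v'⟩, ⟨he', hv'⟩, rfl⟩ hc
    simp only at he hv he' hv'
    obtain ⟨-, j, ⟨h1, h2⟩ | ⟨h1, h2⟩⟩ := ((good v e).conjRel_iff_of_even_even_odd (good v' e')
      hl hm (odd_two_mul_add_one _)).1 hc
    · push_cast at h1
      obtain ⟨rfl, rfl⟩ := rep_unique (N := L) (v := v) (v' := v') (by omega) (by omega) (j := j)
        (by linarith)
      have h3 := h2 hk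
      simp only [zero_mul, sub_zero] at h3
      rw [parity_unique he he' h3]
    · push_cast at h1
      obtain ⟨rfl, rfl, -⟩ := reflect_unique hv hv' (j := j) (by linarith)
      have h3 := (h2 hk).sub_odd hs
      rw [parity_unique he he' (by
        rwa [show (e : ℤ) - e' - -1 * s₀ - s₀ = e - e' by ring] at h3)]
  · rw [Finset.card_image_of_injective, Finset.card_product, Finset.card_range, Finset.card_range]
    rintro ⟨e, v⟩ ⟨e', v'⟩ h
    simpa using h

end EvenEvenOdd

/-! ### Transversals for odd `l` and even `m` -/

section OddEven

variable {t₀ : ℤ}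

theorem isGood_odd_even (hk0 : 0 < k) (hl0 : 0 < l) (hm0 : 0 < m) (hl : Odd (l : ℤ))
    (hm : Even (m : ℤ)) (hkt : (k : ℤ) ∣ 2 * t₀) (s : ℤ) (v : ℕ) :
    IsGood k l m (s, t₀, 2 * v) := by
  refine ⟨hk0, hl0, hm0, fun hl' => absurd hl' (Int.not_even_iff_odd.2 hl),
    fun _ => ⟨even_two_mul _, ?_⟩⟩
  rw [Int.even_iff.1 hm, sg_even hm]
  simpa using hkt

/-- Here `u = 2 * a` may be translated by `2 * l`, and for even `k` a change of its sign alters the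
parity of `s`. Making `s` even exhausts the signs and leaves `a` modulo `l`. For odd `k` the sign
stays available, as in the next lemma. -/
theorem transversal_odd_even (hk0 : 0 < k) (hl0 : 0 < l) (hm0 : 0 < m) (hl : Odd (l : ℤ))
    (hm : Even (m : ℤ)) (hk : Even k) (hkt : (k : ℤ) ∣ 2 * t₀)
    (hp : ∀ d, IsGood k l m d → (Nonempty (sub k l m d ≃* H) ↔ (k : ℤ) ∣ d.2.1 - t₀)) :
    ∃ T, IsTransversal H k l m T ∧ T.card = l := by
  have good : ∀ v : ℕ, IsGood k l m (0, t₀, 2 * v) := isGood_odd_even hk0 hl0 hm0 hl hm hkt 0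
  refine ⟨(Finset.range l).image fun v : ℕ => (0, t₀, 2 * (v : ℤ)),
    isTransversal_of hp ?_ ?_ ?_ ?_, ?_⟩
  · simp only [Finset.mem_image, Finset.mem_range]
    rintro _ ⟨v, -, rfl⟩
    exact good v
  · simp only [Finset.mem_image, Finset.mem_range]
    rintro _ ⟨v, -, rfl⟩
    simp
  · rintro ⟨s, t, u⟩ hd hdt
    obtain ⟨a, ha⟩ := (hd.of_odd hl).1.two_dvd
    simp only at ha hdt
    subst ha
    simp only [Finset.mem_image, Finset.mem_range, exists_exists_and_eq_and]
    rcases Int.even_or_odd s with hs | hs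
    · obtain ⟨v, hv, j, rfl⟩ := exists_rep hl0 a
      exact ⟨v, hv, (hd.conjRel_iff_of_odd_even (good v) hl hm).2
        ⟨hdt, j, .inl ⟨by ring, fun _ => by simpa using hs⟩⟩⟩
    · obtain ⟨v, hv, j, h⟩ := exists_rep hl0 (-a)
      exact ⟨v, hv, (hd.conjRel_iff_of_odd_even (good v) hl hm).2
        ⟨hdt, j, .inr ⟨by linarith, fun _ => by simpa using hs⟩⟩⟩
  · simp only [Finset.mem_image, Finset.mem_range]
    rintro _ ⟨v, hv, rfl⟩ _ ⟨v', hv', rfl⟩ hc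
    obtain ⟨-, j, ⟨h1, -⟩ | ⟨-, h2⟩⟩ := ((good v).conjRel_iff_of_odd_even (good v') hl hm).1 hc
    · simp only at h1
      rw [(rep_unique hv hv' (j := j) (by linarith)).1]
    · simpa using h2 hk
  · rw [Finset.card_image_of_injective, Finset.card_range]
    intro v v' h
    simpa using h

theorem transversal_odd_even_of_odd (hk0 : 0 < k) (hl0 : 0 < l) (hm0 : 0 < m) (hl : Odd (l : ℤ))
    (hm : Even (m : ℤ)) (hk : Odd k)
    (hp : ∀ d, IsGood k l m d → (Nonempty (sub k l m d ≃* H) ↔ (k : ℤ) ∣ d.2.1)) :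
    ∃ T, IsTransversal H k l m T ∧ T.card = (l + 1) / 2 := by
  have good : ∀ v : ℕ, IsGood k l m (0, 0, 2 * v) :=
    isGood_odd_even hk0 hl0 hm0 hl hm (by simp) 0
  have hl' : Odd l := by exact_mod_cast hl
  have hk' : ¬ Even k := Nat.not_even_iff_odd.2 hk
  refine ⟨(Finset.range ((l + 1) / 2)).image fun v : ℕ => (0, 0, 2 * (v : ℤ)),
    isTransversal_of hp ?_ ?_ ?_ ?_, ?_⟩
  · simp only [Finset.mem_image, Finset.mem_range]
    rintro _ ⟨v, -, rfl⟩
    exact good v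
  · simp only [Finset.mem_image, Finset.mem_range]
    rintro _ ⟨v, -, rfl⟩
    simp
  · rintro ⟨s, t, u⟩ hd hdt
    obtain ⟨a, ha⟩ := (hd.of_odd hl).1.two_dvd
    simp only at ha hdt
    subst ha
    simp only [Finset.mem_image, Finset.mem_range, exists_exists_and_eq_and]
    obtain ⟨v, hv, j, h⟩ := exists_neg_rep hl' a
    refine ⟨v, hv, (hd.conjRel_iff_of_odd_even (good v) hl hm).2 ⟨by simpa using hdt, j, ?_⟩⟩
    rcases h with h | h
    · exact .inl ⟨by simp only; linarith, fun hk => absurd hk hk'⟩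
    · exact .inr ⟨by simp only; linarith, fun hk => absurd hk hk'⟩
  · simp only [Finset.mem_image, Finset.mem_range]
    rintro _ ⟨v, hv, rfl⟩ _ ⟨v', hv', rfl⟩ hc
    obtain ⟨-, j, ⟨h1, -⟩ | ⟨h1, -⟩⟩ := ((good v).conjRel_iff_of_odd_even (good v') hl hm).1 hc
    · simp only at h1
      rw [(rep_unique (N := l) (v := v) (v' := v') (by omega) (by omega) (j := j) (by linarith)).1]
    · simp only at h1
      rw [neg_unique hl' hv hv' (j := j) (by linarith)]
  · rw [Finset.card_image_of_injective, Finset.card_range]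
    intro v v' h
    simpa using h

end OddEven

/-! ### The single class for odd `l` and odd `m` -/

section OddOdd

/-- Conjugation by powers of y moves the even number `u` to zero, and a translation removes `s`
modulo the odd number `k`. Then goodness determines `t` modulo `k`, and the rounded half `k / 2`
solves `2 * t + 1 = k`. -/
theorem transversal_odd_odd (hk0 : 0 < k) (hl0 : 0 < l) (hm0 : 0 < m) (hl : Odd (l : ℤ))
    (hm : Odd (m : ℤ)) (hk : Odd k)
    (hp : ∀ d, IsGood k l m d → Nonempty (sub k l m d ≃* H)) :
    ∃ T, IsTransversal H k l m T ∧ T.card = 1 := by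
  have hk2 := Nat.odd_iff.1 hk
  have hcop : IsCoprime (2 : ℤ) k := by
    rw [Int.isCoprime_iff_gcd_eq_one]
    exact (Nat.coprime_two_left).2 hk
  have hgood : ∀ d, IsGood k l m d → (k : ℤ) ∣ 2 * d.2.1 + 1 - 2 * d.1 := by
    intro d hd
    have := (hd.of_odd hl).2
    rw [sg_odd hm, Int.odd_iff.1 hm] at this
    exact this
  have good : IsGood k l m (0, ((k / 2 : ℕ) : ℤ), 0) := by
    refine ⟨hk0, hl0, hm0, fun hl' => absurd hl' (Int.not_even_iff_odd.2 hl),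
      fun _ => ⟨Even.zero, ?_⟩⟩
    rw [sg_odd hm, Int.odd_iff.1 hm]
    refine ⟨1, ?_⟩
    simp only
    omega
  refine ⟨{(0, ((k / 2 : ℕ) : ℤ), 0)}, isTransversal_of (p := fun _ => True)
    (fun d hd => by simp [hp d hd]) ?_ ?_ ?_ ?_, rfl⟩
  · simp only [Finset.mem_singleton]
    rintro _ rfl
    exact good
  · simp
  · intro d hd _
    refine ⟨_, Finset.mem_singleton_self _, ?_⟩
    obtain ⟨a, ha⟩ := (hd.of_odd hl).1.two_dvd
    have he : Even (d.2.2 + m + 1 : ℤ) := by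
      rw [ha, add_assoc]
      exact (even_two_mul a).add (hm.add_odd odd_one)
    obtain ⟨X, hX, hXd⟩ := (IsGood.exists_dvd_add_iff k 0 (sg (-a) * d.1)).2
      (fun h => absurd h (Nat.not_even_iff_odd.2 hk))
    rw [sub_zero] at hX
    refine ⟨⟨X, -a, 0, by simpa using hX⟩, (hd.conj_iff_of_odd good hl _).2
      ⟨by simpa using hXd, 0, ?_, ?_⟩⟩
    · simp [sg_odd hm, ha]; ring
    · have h1 := hgood d hd
      simp only [sg_odd hm, Int.odd_iff.1 hm, add_zero]
      have h2 : (k : ℤ) = 2 * ((k / 2 : ℕ) : ℤ) + 1 := by omega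
      refine (IsCoprime.mul_dvd hcop ?_ ?_)
      · rcases sg_eq_one_or (-a) with e | e <;> rw [e] <;> omega
      · have : X * (1 - -1) + sg (-a) * (2 * d.2.1 + 1) - (2 * ((k / 2 : ℕ) : ℤ) + 1) =
            2 * (X + sg (-a) * d.1) + sg (-a) * (2 * d.2.1 + 1 - 2 * d.1) - k := by
          rw [h2]; ring
        rw [this]
        exact ((hXd.mul_left 2).add (h1.mul_left _)).sub dvd_rfl
  · simp

end OddOdd

variable {H : Type*} [Group H] {k m L : ℕ}

theorem exists_eq_add_mul {k a b : ℤ} (h : k ∣ a - b) : ∃ j : ℤ, a = b + j * k := by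
  obtain ⟨j, hj⟩ := h
  exact ⟨j, by linarith⟩

/-! ### Transversals for even `l`, odd `m` and even `u` -/

section EvenOddEven

theorem isGood_zero (hk0 : 0 < k) (hL : 0 < L) (hm0 : 0 < m) (s t : ℤ) :
    IsGood k (2 * L) m (s, t, 0) :=
  isGood_of_even hk0 (by omega) hm0 (by simp) (by simp)

/-- For odd `m` conjugation with y-exponent `Y` moves `u` by `2 * Y`, so every even `u` can be
brought to zero. The freedom left is `Y = j * L`, which shifts `u` by a multiple of `l`; by the sign
of `j * L` it may negate `s`. -/
theorem conjRel_zero_of {d : ℤ × ℤ × ℤ} (hd : IsGood k (2 * L) m d) (hm : Odd (m : ℤ)) {a : ℤ}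
    (ha : d.2.2 = 2 * a) {s' t' : ℤ} (j : ℤ) (h1 : (k : ℤ) ∣ sg (j * L - a) * d.1 - s')
    (h2 : Even k → Even (d.2.1 - t' + (j * L - a) - j * s')) :
    ConjRel k (2 * L) m d (s', t', 0) := by
  have h0 : 0 < L := by have := hd.l_pos; omega
  refine (hd.conjRel_iff_of_even_odd_even (isGood_zero hd.k_pos h0 hd.m_pos s' t') (by simp) hm
    (by rw [ha]; exact even_two_mul a)).2 ⟨j * L - a, 0, j, h1, ?_, h2⟩
  rw [ha, sg_zero]
  push_cast
  ring

theorem of_conjRel_zero (hk0 : 0 < k) (hL : 0 < L) (hm0 : 0 < m) (hm : Odd (m : ℤ))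
    {s t s' t' : ℤ} (h : ConjRel k (2 * L) m (s, t, 0) (s', t', 0)) :
    ∃ j : ℤ, (k : ℤ) ∣ sg (j * L) * s - s' ∧
      (Even k → Even (t - t' + j * L - j * s')) := by
  obtain ⟨Y, Z, j, h1, h2, h3⟩ := ((isGood_zero hk0 hL hm0 s t).conjRel_iff_of_even_odd_even
    (isGood_zero hk0 hL hm0 s' t') (by simp) hm (by simp)).1 h
  have : Y = j * L := by push_cast at h2; linarith
  subst this
  exact ⟨j, h1, h3⟩

theorem transversal_even_odd_even (hk0 : 0 < k) (hL0 : 0 < L) (hm0 : 0 < m) (hm : Odd (m : ℤ))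
    (hk : Odd k) (hL : Even L)
    (hp : ∀ d, IsGood k (2 * L) m d → (Nonempty (sub k (2 * L) m d ≃* H) ↔ Even d.2.2)) :
    ∃ T, IsTransversal H k (2 * L) m T ∧ T.card = k := by
  have hk' : ¬ Even k := Nat.not_even_iff_odd.2 hk
  have hL' : ∀ j : ℤ, Even (j * (L : ℤ)) := fun j => ((Int.even_coe_nat L).2 hL).mul_left j
  refine ⟨(Finset.range k).image fun s : ℕ => ((s : ℤ), 0, 0),
    isTransversal_of hp ?_ ?_ ?_ ?_, ?_⟩
  · simp only [Finset.mem_image]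
    rintro _ ⟨v, -, rfl⟩
    exact isGood_zero hk0 hL0 hm0 _ _
  · simp only [Finset.mem_image]
    rintro _ ⟨v, -, rfl⟩
    exact Even.zero
  · rintro d hd hu
    obtain ⟨a, ha⟩ := hu.two_dvd
    obtain ⟨v, hv, j, hj⟩ := exists_rep hk0 (sg (0 * L - a) * d.1)
    exact ⟨_, Finset.mem_image.2 ⟨v, by simpa using hv, rfl⟩,
      conjRel_zero_of hd hm ha 0 ⟨j, by rw [hj]; ring⟩ (fun h => absurd h hk')⟩
  · simp only [Finset.mem_image, Finset.mem_range]
    rintro _ ⟨v, hv, rfl⟩ _ ⟨v', hv', rfl⟩ hc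
    obtain ⟨j, h1, -⟩ := of_conjRel_zero hk0 hL0 hm0 hm hc
    rw [sg_even (hL' j), one_mul] at h1
    obtain ⟨i, hi⟩ := exists_eq_add_mul h1
    rw [(rep_unique hv hv' hi).1]
  · rw [Finset.card_image_of_injective, Finset.card_range]
    intro v v' h
    simpa using h

/-- An integer `j` such that `j * L - a` has prescribed parity. -/
theorem exists_mul_sub_parity (hL : Odd L) (a b : ℤ) : ∃ j : ℤ, Even (j * L - a - b) := by
  refine ⟨a + b, ?_⟩
  have : Odd (L : ℤ) := by exact_mod_cast hL
  rw [show (a + b) * (L : ℤ) - a - b = (a + b) * (L - 1) by ring]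
  exact (this.sub_odd odd_one).mul_left _

theorem sg_eq_of_even_sub {a b : ℤ} (h : Even (a - b)) : sg a = sg b := by
  have h1 := sg_add (a - b) b
  rw [sub_add_cancel, sg_even h, one_mul] at h1
  exact h1

theorem transversal_even_odd_even_of_odd (hk0 : 0 < k) (hL0 : 0 < L) (hm0 : 0 < m)
    (hm : Odd (m : ℤ)) (hk : Odd k) (hL : Odd L)
    (hp : ∀ d, IsGood k (2 * L) m d → (Nonempty (sub k (2 * L) m d ≃* H) ↔ Even d.2.2)) :
    ∃ T, IsTransversal H k (2 * L) m T ∧ T.card = (k + 1) / 2 := by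
  have hk' : ¬ Even k := Nat.not_even_iff_odd.2 hk
  refine ⟨(Finset.range ((k + 1) / 2)).image fun s : ℕ => ((s : ℤ), 0, 0),
    isTransversal_of hp ?_ ?_ ?_ ?_, ?_⟩
  · simp only [Finset.mem_image]
    rintro _ ⟨v, -, rfl⟩
    exact isGood_zero hk0 hL0 hm0 _ _
  · simp only [Finset.mem_image]
    rintro _ ⟨v, -, rfl⟩
    exact Even.zero
  · rintro d hd hu
    obtain ⟨a, ha⟩ := hu.two_dvd
    obtain ⟨v, hv, j, hj⟩ := exists_neg_rep hk d.1
    refine ⟨_, Finset.mem_image.2 ⟨v, by simpa using hv, rfl⟩, ?_⟩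
    rcases hj with hj | hj
    · obtain ⟨i, hi⟩ := exists_mul_sub_parity hL a 0
      refine conjRel_zero_of hd hm ha i ⟨j, ?_⟩ (fun h => absurd h hk')
      rw [sg_eq_of_even_sub hi, sg_zero, one_mul, hj]
      ring
    · obtain ⟨i, hi⟩ := exists_mul_sub_parity hL a 1
      refine conjRel_zero_of hd hm ha i ⟨j, ?_⟩ (fun h => absurd h hk')
      rw [sg_eq_of_even_sub hi, sg_one, neg_one_mul, hj]
      ring
  · simp only [Finset.mem_image, Finset.mem_range]
    rintro _ ⟨v, hv, rfl⟩ _ ⟨v', hv', rfl⟩ hc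
    obtain ⟨j, h1, -⟩ := of_conjRel_zero hk0 hL0 hm0 hm hc
    obtain ⟨i, hi⟩ := exists_eq_add_mul h1
    rcases sg_eq_one_or (j * L) with e | e <;> rw [e] at hi
    · rw [one_mul] at hi
      rw [(rep_unique (v := v) (v' := v') (by omega) (by omega) hi).1]
    · rw [neg_one_mul] at hi
      rw [neg_unique hk hv hv' hi]
  · rw [Finset.card_image_of_injective, Finset.card_range]
    intro v v' h
    simpa using h

theorem even_of_dvd_sub {h : ℕ} {e s s' : ℤ} (hd : ((2 * h : ℕ) : ℤ) ∣ sg e * s - s') :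
    Even (s - s') := by
  have h1 : Even (sg e * s - s') :=
    even_iff_two_dvd.2 (dvd_trans ⟨h, by push_cast; ring⟩ hd)
  rw [sub_eq_add_neg, IsGood.even_sg_mul_add, ← sub_eq_add_neg] at h1
  exact h1

theorem exists_sg_mul_eq (e b : ℤ) (δ : ℤ) : ∃ b' : ℤ, sg e * (2 * b + δ) = 2 * b' + δ := by
  rcases sg_eq_one_or e with h | h <;> rw [h]
  · exact ⟨b, by ring⟩
  · exact ⟨-b - δ, by ring⟩

/-- For even `L` the sign of `s` is fixed. If `s` is even, neither `j * L` nor `j * s` alters the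
parity of `t`, which gives `2 * h` classes; if `s` is odd, an odd `j` alters it, which gives `h`
more. -/
theorem transversal_even_odd_even_two_mul {h : ℕ} (hh : 0 < h) (hL0 : 0 < L) (hm0 : 0 < m)
    (hm : Odd (m : ℤ)) (hL : Even L)
    (hp : ∀ d, IsGood (2 * h) (2 * L) m d →
      (Nonempty (sub (2 * h) (2 * L) m d ≃* H) ↔ Even d.2.2)) :
    ∃ T, IsTransversal H (2 * h) (2 * L) m T ∧ T.card = 3 * h := by
  have hk0 : 0 < 2 * h := by omega
  have hL' : ∀ j : ℤ, Even (j * (L : ℤ)) := fun j => ((Int.even_coe_nat L).2 hL).mul_left j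
  have hsg : ∀ j a : ℤ, sg (j * L - a) = sg a := fun j a => by
    rw [sub_eq_add_neg, sg_add, sg_even (hL' j), one_mul, sg_neg]
  have huniq : ∀ (v v' : ℕ) (j : ℤ), v < h → v' < h → ∀ δ : ℤ, ((2 * h : ℕ) : ℤ) ∣
      sg (j * L) * (2 * v + δ) - (2 * v' + δ) → v = v' := by
    intro v v' j hv hv' δ h1
    rw [sg_even (hL' j), one_mul] at h1
    obtain ⟨i, hi⟩ := exists_eq_add_mul h1
    push_cast at hi
    exact (rep_unique hv hv' (j := i) (by linarith)).1
  refine ⟨((Finset.range h ×ˢ Finset.range 2).image fun w : ℕ × ℕ => (2 * (w.1 : ℤ), (w.2 : ℤ), 0))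
    ∪ (Finset.range h).image fun i : ℕ => (2 * (i : ℤ) + 1, 0, 0),
    isTransversal_of hp ?_ ?_ ?_ ?_, ?_⟩
  · simp only [Finset.mem_union, Finset.mem_image]
    rintro _ (⟨v, -, rfl⟩ | ⟨v, -, rfl⟩) <;> exact isGood_zero hk0 hL0 hm0 _ _
  · simp only [Finset.mem_union, Finset.mem_image]
    rintro _ (⟨v, -, rfl⟩ | ⟨v, -, rfl⟩) <;> exact Even.zero
  · rintro ⟨s, t, u⟩ hd hu
    obtain ⟨a, ha⟩ := hu.two_dvd
    rcases Int.even_or_odd' s with ⟨b, rfl | rfl⟩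
    · obtain ⟨b', hb'⟩ := exists_sg_mul_eq a b 0
      obtain ⟨v, hv, j, rfl⟩ := exists_rep hh b'
      obtain ⟨e, he, he'⟩ := exists_parity (t - a)
      refine ⟨_, Finset.mem_union_left _ (Finset.mem_image.2 ⟨(v, e), by simp [hv, he], rfl⟩),
        conjRel_zero_of hd hm ha 0 ⟨j, ?_⟩ fun _ => ?_⟩
      · rw [add_zero, add_zero] at hb'
        rw [hsg, hb']
        push_cast
        ring
      · simpa [sub_right_comm, sub_eq_add_neg, add_right_comm] using he'
    · obtain ⟨b', hb'⟩ := exists_sg_mul_eq a b 1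
      obtain ⟨v, hv, j, rfl⟩ := exists_rep hh b'
      -- Since `L` is even and the new `s` is odd, `j = t - a` has the parity that brings `t` to
      -- zero.
      refine ⟨_, Finset.mem_union_right _ (Finset.mem_image.2 ⟨v, by simpa using hv, rfl⟩),
        conjRel_zero_of hd hm ha (t - a) ⟨j, ?_⟩ fun _ => ?_⟩
      · rw [hsg, hb']
        push_cast
        ring
      · simp only
        have := (hL' (t - a)).sub (even_two_mul ((t - a) * v))
        rwa [show (t - a) * (L : ℤ) - 2 * ((t - a) * v) =
          t - 0 + ((t - a) * L - a) - (t - a) * (2 * v + 1) by ring] at this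
  · simp only [Finset.mem_union, Finset.mem_image, Finset.mem_product, Finset.mem_range]
    rintro _ (⟨⟨v, e⟩, ⟨hv, he⟩, rfl⟩ | ⟨v, hv, rfl⟩) _
      (⟨⟨v', e'⟩, ⟨hv', he'⟩, rfl⟩ | ⟨v', hv', rfl⟩) hc
    all_goals obtain ⟨j, h1, h2⟩ := of_conjRel_zero hk0 hL0 hm0 hm hc
    · simp only at hv he hv' he'
      obtain rfl := huniq v v' j hv hv' 0 (by simpa using h1)
      have h3 := h2 (even_two_mul h)
      have h4 := (h3.sub (hL' j)).add (even_two_mul (j * v))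
      rw [show (e : ℤ) - e' + j * L - j * (2 * v) - j * L + 2 * (j * v) = e - e' by ring] at h4
      rw [parity_unique he he' h4]
    · have := even_of_dvd_sub h1
      simp only [Int.even_iff] at this
      omega
    · have := even_of_dvd_sub h1
      simp only [Int.even_iff] at this
      omega
    · rw [huniq v v' j hv hv' 1 h1]
  · rw [Finset.card_union_of_disjoint, Finset.card_image_of_injective,
      Finset.card_image_of_injective, Finset.card_product, Finset.card_range, Finset.card_range]
    · ring
    · intro v v' h
      simpa using h
    · rintro ⟨e, v⟩ ⟨e', v'⟩ h
      simpa using h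
    · rw [Finset.disjoint_left]
      simp only [Finset.mem_image]
      rintro _ ⟨w, -, rfl⟩ ⟨i, -, h⟩
      simp only [Prod.mk.injEq] at h
      omega

/-- For odd `L` an odd `j` negates `s`. If `s` is even it also flips the parity of `t`, so
normalizing `t` uses up the sign and `h` classes remain. If `s = 2 * b + 1`, the two parity
contributions cancel: the parity of `t` is invariant and `b` modulo `h` counts up to reflection. -/
theorem transversal_even_odd_even_two_mul_of_odd {h : ℕ} (hh : 0 < h) (hL0 : 0 < L) (hm0 : 0 < m)
    (hm : Odd (m : ℤ)) (hL : Odd L)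
    (hp : ∀ d, IsGood (2 * h) (2 * L) m d →
      (Nonempty (sub (2 * h) (2 * L) m d ≃* H) ↔ Even d.2.2)) :
    ∃ T, IsTransversal H (2 * h) (2 * L) m T ∧ T.card = h + 2 * ((h + 1) / 2) := by
  have hk0 : 0 < 2 * h := by omega
  have hL' : Odd (L : ℤ) := by exact_mod_cast hL
  refine ⟨((Finset.range h).image fun i : ℕ => (2 * (i : ℤ), 0, 0)) ∪
    (Finset.range ((h + 1) / 2) ×ˢ Finset.range 2).image fun w : ℕ × ℕ =>
      (2 * (w.1 : ℤ) + 1, (w.2 : ℤ), 0),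
    isTransversal_of hp ?_ ?_ ?_ ?_, ?_⟩
  · simp only [Finset.mem_union, Finset.mem_image]
    rintro _ (⟨v, -, rfl⟩ | ⟨v, -, rfl⟩) <;> exact isGood_zero hk0 hL0 hm0 _ _
  · simp only [Finset.mem_union, Finset.mem_image]
    rintro _ (⟨v, -, rfl⟩ | ⟨v, -, rfl⟩) <;> exact Even.zero
  · rintro ⟨s, t, u⟩ hd hu
    obtain ⟨a, ha⟩ := hu.two_dvd
    rcases Int.even_or_odd' s with ⟨b, rfl | rfl⟩
    · obtain ⟨i, hi⟩ := exists_mul_sub_parity hL a t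
      obtain ⟨b', hb'⟩ := exists_sg_mul_eq (i * L - a) b 0
      obtain ⟨v, hv, j, rfl⟩ := exists_rep hh b'
      refine ⟨_, Finset.mem_union_left _ (Finset.mem_image.2 ⟨v, by simp [hv], rfl⟩),
        conjRel_zero_of hd hm ha i ⟨j, ?_⟩ fun _ => ?_⟩
      · rw [add_zero, add_zero] at hb'
        rw [hb']
        push_cast
        ring
      · have := (hi.add (even_two_mul t)).sub (even_two_mul (i * v))
        simp only
        rwa [show i * (L : ℤ) - a - t + 2 * t - 2 * (i * v) =
          t - 0 + (i * L - a) - i * (2 * v) by ring] at this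
    · obtain ⟨v, hv, j, hj⟩ := exists_reflect_rep hh b
      rcases hj with hj | hj
      · obtain ⟨i, hi⟩ := exists_mul_sub_parity hL a 0
        obtain ⟨e, he, he'⟩ := exists_parity (t + (i * L - a) - i * (2 * v + 1))
        refine ⟨_, Finset.mem_union_right _ (Finset.mem_image.2 ⟨(v, e), by simp [hv, he], rfl⟩),
          conjRel_zero_of hd hm ha i ⟨j, ?_⟩ fun _ => ?_⟩
        · rw [sg_eq_of_even_sub hi, sg_zero, hj]
          push_cast
          ring
        · simp only
          rwa [show t - (e : ℤ) + (i * L - a) - i * (2 * v + 1) =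
            t + (i * L - a) - i * (2 * v + 1) - e by ring]
      · obtain ⟨i, hi⟩ := exists_mul_sub_parity hL a 1
        obtain ⟨e, he, he'⟩ := exists_parity (t + (i * L - a) - i * (2 * v + 1))
        refine ⟨_, Finset.mem_union_right _ (Finset.mem_image.2 ⟨(v, e), by simp [hv, he], rfl⟩),
          conjRel_zero_of hd hm ha i ⟨j, ?_⟩ fun _ => ?_⟩
        · rw [sg_eq_of_even_sub hi, sg_one]
          push_cast
          linear_combination 2 * hj
        · simp only
          rwa [show t - (e : ℤ) + (i * L - a) - i * (2 * v + 1) =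
            t + (i * L - a) - i * (2 * v + 1) - e by ring]
  · simp only [Finset.mem_union, Finset.mem_image, Finset.mem_product, Finset.mem_range]
    rintro _ (⟨v, hv, rfl⟩ | ⟨⟨v, e⟩, ⟨hv, he⟩, rfl⟩) _
      (⟨v', hv', rfl⟩ | ⟨⟨v', e'⟩, ⟨hv', he'⟩, rfl⟩) hc
    all_goals
      obtain ⟨j, h1, h2⟩ := of_conjRel_zero hk0 hL0 hm0 hm hc
      have h3 := h2 (even_two_mul h)
    · have h4 : Even (j * (L : ℤ)) := by
        have := h3.add (even_two_mul (j * v'))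
        rwa [show (0 : ℤ) - 0 + j * L - j * (2 * v') + 2 * (j * v') = j * L by ring] at this
      rw [sg_even h4] at h1
      obtain ⟨i, hi⟩ := exists_eq_add_mul h1
      push_cast at hi
      rw [(rep_unique hv hv' (j := i) (by linarith)).1]
    · have := even_of_dvd_sub h1
      simp only [Int.even_iff] at this
      omega
    · have := even_of_dvd_sub h1
      simp only [Int.even_iff] at this
      omega
    · simp only at hv he hv' he'
      have h4 : Even ((e : ℤ) - e') := by
        have h5 : Even (j * ((L : ℤ) - 1) - 2 * (j * v')) :=
          ((hL'.sub_odd odd_one).mul_left j).sub (even_two_mul _)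
        have h6 := h3.sub h5
        rwa [show (e : ℤ) - e' + j * L - j * (2 * v' + 1) - (j * (L - 1) - 2 * (j * v')) =
          e - e' by ring] at h6
      obtain rfl := parity_unique he he' h4
      obtain ⟨i, hi⟩ := exists_eq_add_mul h1
      push_cast at hi
      rcases sg_eq_one_or (j * L) with e | e <;> rw [e] at hi
      · rw [(rep_unique (N := h) (v := v) (v' := v') (by omega) (by omega) (j := i)
          (by linarith)).1]
      · rw [(reflect_unique hv hv' (j := i) (by linarith)).1]
  · rw [Finset.card_union_of_disjoint, Finset.card_image_of_injective,
      Finset.card_image_of_injective, Finset.card_product, Finset.card_range, Finset.card_range,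
      Finset.card_range]
    · ring
    · rintro ⟨e, v⟩ ⟨e', v'⟩ h
      simpa using h
    · intro v v' h
      simpa using h
    · rw [Finset.disjoint_left]
      simp only [Finset.mem_image]
      rintro _ ⟨i, -, rfl⟩ ⟨w, -, h⟩
      simp only [Prod.mk.injEq] at h
      omega

end EvenOddEven

/-! ### Transversals for even `l`, odd `m` and odd `u` -/

section EvenOddOdd

theorem isGood_one (hk0 : 0 < k) (hL : 0 < L) (hm0 : 0 < m) {s : ℤ} (hs : (k : ℤ) ∣ 2 * s)
    (t : ℤ) : IsGood k (2 * L) m (s, t, 1) :=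
  isGood_of_odd_u hk0 (by omega) hm0 (by simp) odd_one hs

/-- An odd `u` is moved to 1. What remains is the odd number `2 * t + 1` modulo `2 * k`, subject to
the sign of `j * L - a` and to a shift by `j * (2 * s')`. For `s' = 0` there is no shift, and
between data with `u = 1` a sign change is available exactly when `L` is odd. -/
theorem conjRel_one_of {d : ℤ × ℤ × ℤ} (hd : IsGood k (2 * L) m d) (hm : Odd (m : ℤ)) {a : ℤ}
    (ha : d.2.2 = 2 * a + 1) {s' t' : ℤ} (hs' : (k : ℤ) ∣ 2 * s') (h : (k : ℤ) ∣ d.1 - s') (j : ℤ)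
    (h1 : 2 * (k : ℤ) ∣ sg (j * L - a) * (2 * d.2.1 + 1) - j * (2 * s') - (2 * t' + 1)) :
    ConjRel k (2 * L) m d (s', t', 1) := by
  have h0 : 0 < L := by have := hd.l_pos; omega
  refine (hd.conjRel_iff_of_even_odd_odd (isGood_one hd.k_pos h0 hd.m_pos hs' t') (by simp) hm
    (by rw [ha]; exact odd_two_mul_add_one a)).2 ⟨h, j * L - a, 0, j, ?_, by rwa [add_zero]⟩
  rw [ha, sg_zero]
  push_cast
  ring

theorem of_conjRel_one (hk0 : 0 < k) (hL : 0 < L) (hm0 : 0 < m) (hm : Odd (m : ℤ)) {s t t' : ℤ}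
    (hs : (k : ℤ) ∣ 2 * s) (h : ConjRel k (2 * L) m (s, t, 1) (s, t', 1)) :
    ∃ j : ℤ, 2 * (k : ℤ) ∣ sg (j * L) * (2 * t + 1) - j * (2 * s) - (2 * t' + 1) := by
  obtain ⟨-, Y, Z, j, h2, h3⟩ := ((isGood_one hk0 hL hm0 hs t).conjRel_iff_of_even_odd_odd
    (isGood_one hk0 hL hm0 hs t') (by simp) hm odd_one).1 h
  refine ⟨j, ?_⟩
  push_cast at h2
  rwa [sg_eq_of_even_sub (a := Y + Z) (b := j * L)] at h3
  rcases Int.even_or_odd' Z with ⟨c, rfl | rfl⟩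
  · rw [sg_even (even_two_mul c)] at h2
    exact ⟨c, by linarith⟩
  · rw [sg_odd (odd_two_mul_add_one c)] at h2
    exact ⟨c + 1, by linarith⟩

theorem transversal_even_odd_odd (hk0 : 0 < k) (hL0 : 0 < L) (hm0 : 0 < m) (hm : Odd (m : ℤ))
    (hL : Even L)
    (hp : ∀ d, IsGood k (2 * L) m d → (Nonempty (sub k (2 * L) m d ≃* H) ↔
      Odd d.2.2 ∧ (k : ℤ) ∣ d.1)) :
    ∃ T, IsTransversal H k (2 * L) m T ∧ T.card = k := by
  have hL' : ∀ j : ℤ, Even (j * (L : ℤ)) := fun j => ((Int.even_coe_nat L).2 hL).mul_left j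
  have h0 : (k : ℤ) ∣ 2 * 0 := by simp
  refine ⟨(Finset.range k).image fun t : ℕ => (0, (t : ℤ), 1),
    isTransversal_of hp ?_ ?_ ?_ ?_, ?_⟩
  · simp only [Finset.mem_image]
    rintro _ ⟨v, -, rfl⟩
    exact isGood_one hk0 hL0 hm0 h0 _
  · simp only [Finset.mem_image]
    rintro _ ⟨v, -, rfl⟩
    exact ⟨odd_one, by simp⟩
  · rintro d hd ⟨⟨a, ha⟩, hs⟩
    obtain ⟨b', hb'⟩ := exists_sg_mul_eq (0 * L - a) d.2.1 1
    obtain ⟨v, hv, j, rfl⟩ := exists_rep hk0 b'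
    refine ⟨_, Finset.mem_image.2 ⟨v, by simpa using hv, rfl⟩,
      conjRel_one_of hd hm ha h0 (by simpa using hs) 0 ⟨j, ?_⟩⟩
    rw [hb']
    ring
  · simp only [Finset.mem_image, Finset.mem_range]
    rintro _ ⟨v, hv, rfl⟩ _ ⟨v', hv', rfl⟩ hc
    obtain ⟨j, h1⟩ := of_conjRel_one hk0 hL0 hm0 hm h0 hc
    rw [sg_even (hL' j)] at h1
    obtain ⟨i, hi⟩ := h1
    rw [(rep_unique hv hv' (j := i) (by linarith)).1]
  · rw [Finset.card_image_of_injective, Finset.card_range]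
    intro v v' h
    simpa using h

theorem transversal_even_odd_odd_of_odd (hk0 : 0 < k) (hL0 : 0 < L) (hm0 : 0 < m) (hm : Odd (m : ℤ))
    (hL : Odd L)
    (hp : ∀ d, IsGood k (2 * L) m d → (Nonempty (sub k (2 * L) m d ≃* H) ↔
      Odd d.2.2 ∧ (k : ℤ) ∣ d.1)) :
    ∃ T, IsTransversal H k (2 * L) m T ∧ T.card = (k + 1) / 2 := by
  have h0 : (k : ℤ) ∣ 2 * 0 := by simp
  refine ⟨(Finset.range ((k + 1) / 2)).image fun t : ℕ => (0, (t : ℤ), 1),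
    isTransversal_of hp ?_ ?_ ?_ ?_, ?_⟩
  · simp only [Finset.mem_image]
    rintro _ ⟨v, -, rfl⟩
    exact isGood_one hk0 hL0 hm0 h0 _
  · simp only [Finset.mem_image]
    rintro _ ⟨v, -, rfl⟩
    exact ⟨odd_one, by simp⟩
  · rintro d hd ⟨⟨a, ha⟩, hs⟩
    obtain ⟨v, hv, j, hj⟩ := exists_reflect_rep hk0 d.2.1
    refine ⟨_, Finset.mem_image.2 ⟨v, by simpa using hv, rfl⟩, ?_⟩
    rcases hj with hj | hj
    · obtain ⟨i, hi⟩ := exists_mul_sub_parity hL a 0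
      refine conjRel_one_of hd hm ha h0 (by simpa using hs) i ⟨j, ?_⟩
      rw [sg_eq_of_even_sub hi, sg_zero]
      linear_combination 2 * hj
    · obtain ⟨i, hi⟩ := exists_mul_sub_parity hL a 1
      refine conjRel_one_of hd hm ha h0 (by simpa using hs) i ⟨j, ?_⟩
      rw [sg_eq_of_even_sub hi, sg_one]
      linear_combination 2 * hj
  · simp only [Finset.mem_image, Finset.mem_range]
    rintro _ ⟨v, hv, rfl⟩ _ ⟨v', hv', rfl⟩ hc
    obtain ⟨j, i, hi⟩ := of_conjRel_one hk0 hL0 hm0 hm h0 hc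
    rcases sg_eq_one_or (j * L) with e | e <;> rw [e] at hi
    · rw [(rep_unique (N := k) (v := v) (v' := v') (by omega) (by omega) (j := i)
        (by linarith)).1]
    · rw [(reflect_unique hv hv' (j := i) (by linarith)).1]
  · rw [Finset.card_image_of_injective, Finset.card_range]
    intro v v' h
    simpa using h

/-- With `s = h = k / 2` the number `j` shifts `t` by multiples of `h`; since `L` is even it brings
no sign with it, so `t` counts modulo `h`. -/
theorem transversal_even_odd_odd_half {h : ℕ} (hh : 0 < h) (hL0 : 0 < L) (hm0 : 0 < m)
    (hm : Odd (m : ℤ)) (hL : Even L)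
    (hp : ∀ d, IsGood (2 * h) (2 * L) m d → (Nonempty (sub (2 * h) (2 * L) m d ≃* H) ↔
      Odd d.2.2 ∧ ((2 * h : ℕ) : ℤ) ∣ d.1 - h)) :
    ∃ T, IsTransversal H (2 * h) (2 * L) m T ∧ T.card = h := by
  have hk0 : 0 < 2 * h := by omega
  have hL' : ∀ j : ℤ, Even (j * (L : ℤ)) := fun j => ((Int.even_coe_nat L).2 hL).mul_left j
  have hsg : ∀ j a : ℤ, sg (j * L - a) = sg a := fun j a => by
    rw [sub_eq_add_neg, sg_add, sg_even (hL' j), one_mul, sg_neg]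
  have h0 : ((2 * h : ℕ) : ℤ) ∣ 2 * h := by push_cast; exact dvd_rfl
  refine ⟨(Finset.range h).image fun t : ℕ => ((h : ℤ), (t : ℤ), 1),
    isTransversal_of hp ?_ ?_ ?_ ?_, ?_⟩
  · simp only [Finset.mem_image]
    rintro _ ⟨v, -, rfl⟩
    exact isGood_one hk0 hL0 hm0 h0 _
  · simp only [Finset.mem_image]
    rintro _ ⟨v, -, rfl⟩
    exact ⟨odd_one, by simp⟩
  · rintro d hd ⟨⟨a, ha⟩, hs⟩
    obtain ⟨b', hb'⟩ := exists_sg_mul_eq a d.2.1 1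
    obtain ⟨v, hv, j, rfl⟩ := exists_rep hh b'
    refine ⟨_, Finset.mem_image.2 ⟨v, by simpa using hv, rfl⟩,
      conjRel_one_of hd hm ha h0 hs j ⟨0, ?_⟩⟩
    rw [hsg, hb']
    ring
  · simp only [Finset.mem_image, Finset.mem_range]
    rintro _ ⟨v, hv, rfl⟩ _ ⟨v', hv', rfl⟩ hc
    obtain ⟨j, i, hi⟩ := of_conjRel_one hk0 hL0 hm0 hm h0 hc
    rw [sg_even (hL' j)] at hi
    push_cast at hi
    rw [(rep_unique hv hv' (j := 2 * i + j) (by linarith)).1]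
  · rw [Finset.card_image_of_injective, Finset.card_range]
    intro v v' h
    simpa using h

/-- For odd `L` an odd `j` reflects and shifts at once, which gives the involution `t ↦ -1 - t - h`
modulo `2 * h`. It has two fixed points for odd `h` and none for even `h`. The representatives are
`v + h * e` with `v` in the lower half of the residues modulo `h` and `e` in `{0, 1}`. -/
theorem transversal_even_odd_odd_half_of_odd {h : ℕ} (hh : 0 < h) (hL0 : 0 < L) (hm0 : 0 < m)
    (hm : Odd (m : ℤ)) (hL : Odd L)
    (hp : ∀ d, IsGood (2 * h) (2 * L) m d → (Nonempty (sub (2 * h) (2 * L) m d ≃* H) ↔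
      Odd d.2.2 ∧ ((2 * h : ℕ) : ℤ) ∣ d.1 - h)) :
    ∃ T, IsTransversal H (2 * h) (2 * L) m T ∧ T.card = 2 * ((h + 1) / 2) := by
  have hk0 : 0 < 2 * h := by omega
  have hL' : Odd (L : ℤ) := by exact_mod_cast hL
  have h0 : ((2 * h : ℕ) : ℤ) ∣ 2 * h := by push_cast; exact dvd_rfl
  refine ⟨(Finset.range 2 ×ˢ Finset.range ((h + 1) / 2)).image fun w : ℕ × ℕ =>
    ((h : ℤ), (w.2 : ℤ) + h * (w.1 : ℤ), 1), isTransversal_of hp ?_ ?_ ?_ ?_, ?_⟩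
  · simp only [Finset.mem_image]
    rintro _ ⟨v, -, rfl⟩
    exact isGood_one hk0 hL0 hm0 h0 _
  · simp only [Finset.mem_image]
    rintro _ ⟨v, -, rfl⟩
    exact ⟨odd_one, by simp⟩
  · rintro d hd ⟨⟨a, ha⟩, hs⟩
    obtain ⟨v, hv, j, hj⟩ := exists_reflect_rep hh d.2.1
    rcases hj with hj | hj
    · obtain ⟨i, hi⟩ := exists_mul_sub_parity hL a 0
      -- The index `i` that produces the wanted sign also shifts by `i * h`. The multiple of `h`
      -- left over is `j - i`, and only its parity matters modulo `2 * h`.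
      obtain ⟨e, he, he'⟩ := exists_parity (j - i)
      obtain ⟨c, hc⟩ := he'.two_dvd
      refine ⟨_, Finset.mem_image.2 ⟨(e, v), by simp [he, hv], rfl⟩,
        conjRel_one_of hd hm ha h0 hs i ⟨c, ?_⟩⟩
      rw [sg_eq_of_even_sub hi, sg_zero]
      push_cast
      linear_combination 2 * hj + 2 * (h : ℤ) * hc
    · obtain ⟨i, hi⟩ := exists_mul_sub_parity hL a 1
      obtain ⟨e, he, he'⟩ := exists_parity (j - i)
      obtain ⟨c, hc⟩ := he'.two_dvd
      refine ⟨_, Finset.mem_image.2 ⟨(e, v), by simp [he, hv], rfl⟩,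
        conjRel_one_of hd hm ha h0 hs i ⟨c, ?_⟩⟩
      rw [sg_eq_of_even_sub hi, sg_one]
      push_cast
      linear_combination 2 * hj + 2 * (h : ℤ) * hc
  · simp only [Finset.mem_image, Finset.mem_product, Finset.mem_range]
    rintro _ ⟨⟨e, v⟩, ⟨he, hv⟩, rfl⟩ _ ⟨⟨e', v'⟩, ⟨he', hv'⟩, rfl⟩ hc
    simp only at he hv he' hv'
    obtain ⟨j, i, hi⟩ := of_conjRel_one hk0 hL0 hm0 hm h0 hc
    push_cast at hi
    rcases Int.even_or_odd j with hj | hj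
    · rw [sg_even (hj.mul_right _)] at hi
      obtain ⟨rfl, h2⟩ := rep_unique (N := h) (v := v) (v' := v') (by omega) (by omega)
        (j := 2 * i + j + e' - e) (by linarith)
      have : Even ((e : ℤ) - e') := by
        rw [show (e : ℤ) - e' = 2 * i + j by linarith]
        exact (even_two_mul i).add hj
      rw [parity_unique he he' this]
    · rw [sg_odd (hj.mul hL')] at hi
      obtain ⟨rfl, h2, -⟩ := reflect_unique hv hv' (j := 2 * i + j + e' + e) (by linarith)
      have : Even ((e : ℤ) - e') := by
        rw [show (e : ℤ) - e' = -1 - j - 2 * (i + e') by linarith]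
        exact (odd_neg_one.sub_odd hj).sub (even_two_mul _)
      rw [parity_unique he he' this]
  · rw [Finset.card_image_of_injOn, Finset.card_product, Finset.card_range, Finset.card_range]
    rintro ⟨e, v⟩ hv ⟨e', v'⟩ hv' heq
    simp only [Finset.coe_product, Finset.coe_range, Set.mem_prod, Set.mem_Iio] at hv hv'
    simp only [Prod.mk.injEq, true_and, and_true] at heq
    obtain ⟨rfl, h2⟩ := rep_unique (N := h) (v := v) (v' := v') (by omega) (by omega)
      (j := (e' : ℤ) - e) (by linarith)
    rw [show e = e' by omega]

end EvenOddOdd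

/-! ### Orbits of two commuting involutions -/

section Involutions

variable {Ω : Type*} [Fintype Ω] [DecidableEq Ω] (σ τ : Ω → Ω)

/-- The action of the Klein four-group given by two commuting involutions. -/
@[reducible]
def involutionAction (hσ : ∀ x, σ (σ x) = x) (hτ : ∀ x, τ (τ x) = x)
    (hc : ∀ x, σ (τ x) = τ (σ x)) : MulAction (ℤˣ × ℤˣ) Ω where
  smul a x := (if a.1 = 1 then id else σ) ((if a.2 = 1 then id else τ) x)
  one_smul x := by
    change (if (1 : ℤˣ) = 1 then id else σ) ((if (1 : ℤˣ) = 1 then id else τ) x) = x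
    simp
  mul_smul := by
    rintro ⟨a, b⟩ ⟨a', b'⟩ x
    change (if a * a' = 1 then id else σ) ((if b * b' = 1 then id else τ) x) =
      (if a = 1 then id else σ) ((if b = 1 then id else τ)
        ((if a' = 1 then id else σ) ((if b' = 1 then id else τ) x)))
    have hne : (-1 : ℤˣ) ≠ 1 := by decide
    rcases Int.units_eq_one_or a with rfl | rfl <;> rcases Int.units_eq_one_or b with rfl | rfl <;>
      rcases Int.units_eq_one_or a' with rfl | rfl <;>
      rcases Int.units_eq_one_or b' with rfl | rfl <;> simp [hne, hσ, hτ, hc]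

/-- Burnside's lemma for the group generated by two commuting involutions. -/
theorem exists_transversal_involutions (hσ : ∀ x, σ (σ x) = x) (hτ : ∀ x, τ (τ x) = x)
    (hc : ∀ x, σ (τ x) = τ (σ x)) :
    ∃ T : Finset Ω, (∀ x, ∃ r ∈ T, r = x ∨ r = σ x ∨ r = τ x ∨ r = σ (τ x)) ∧
      (∀ r ∈ T, ∀ r' ∈ T, (r' = r ∨ r' = σ r ∨ r' = τ r ∨ r' = σ (τ r)) → r = r') ∧
      4 * T.card = Fintype.card Ω + (Finset.univ.filter fun x => σ x = x).card +
        (Finset.univ.filter fun x => τ x = x).card +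
        (Finset.univ.filter fun x => σ (τ x) = x).card := by
  classical
  let _ := involutionAction σ τ hσ hτ hc
  have hne : (-1 : ℤˣ) ≠ 1 := by decide
  have smul_def : ∀ (a b : ℤˣ) (x : Ω), ((a, b) : ℤˣ × ℤˣ) • x =
      (if a = 1 then id else σ) ((if b = 1 then id else τ) x) := fun _ _ _ => rfl
  have horbit : ∀ x y : Ω, y ∈ MulAction.orbit (ℤˣ × ℤˣ) x ↔
      (y = x ∨ y = σ x ∨ y = τ x ∨ y = σ (τ x)) := by
    intro x y
    constructor
    · rintro ⟨⟨a, b⟩, rfl⟩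
      change (a, b) • x = x ∨ (a, b) • x = σ x ∨ (a, b) • x = τ x ∨ (a, b) • x = σ (τ x)
      rw [smul_def]
      rcases Int.units_eq_one_or a with rfl | rfl <;>
        rcases Int.units_eq_one_or b with rfl | rfl <;> simp [hne]
    · rintro (rfl | rfl | rfl | rfl)
      · exact ⟨(1, 1), by change (1, 1) • _ = _; rw [smul_def]; simp⟩
      · exact ⟨(-1, 1), by change (-1, 1) • _ = _; rw [smul_def]; simp [hne]⟩
      · exact ⟨(1, -1), by change (1, -1) • _ = _; rw [smul_def]; simp [hne]⟩
      · exact ⟨(-1, -1), by change (-1, -1) • _ = _; rw [smul_def]; simp [hne]⟩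
  refine ⟨Finset.univ.image
    (Quotient.out : MulAction.orbitRel.Quotient (ℤˣ × ℤˣ) Ω → Ω), ?_, ?_, ?_⟩
  · intro x
    refine ⟨_, Finset.mem_image.2 ⟨Quotient.mk'' x, Finset.mem_univ _, rfl⟩, ?_⟩
    rw [← horbit]
    exact Quotient.mk_out (s := MulAction.orbitRel (ℤˣ × ℤˣ) Ω) x
  · simp only [Finset.mem_image, Finset.mem_univ, true_and]
    rintro _ ⟨c, rfl⟩ _ ⟨c', rfl⟩ h
    rw [← horbit] at h
    have : c' = c := by
      rw [← Quotient.out_eq c, ← Quotient.out_eq c']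
      exact Quotient.sound h
    rw [this]
  · rw [Finset.card_image_of_injective _ Quotient.out_injective, Finset.card_univ]
    have hB := MulAction.sum_card_fixedBy_eq_card_orbits_mul_card_group (ℤˣ × ℤˣ) Ω
    have hcard : Fintype.card (ℤˣ × ℤˣ) = 4 := by decide
    rw [hcard, Fintype.sum_prod_type] at hB
    have huniv : (Finset.univ : Finset ℤˣ) = {1, -1} := by decide
    have hfix : ∀ a b : ℤˣ, Fintype.card (MulAction.fixedBy Ω ((a, b) : ℤˣ × ℤˣ)) =
        (Finset.univ.filter fun x : Ω =>
          (if a = 1 then id else σ) ((if b = 1 then id else τ) x) = x).card := by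
      intro a b
      exact Fintype.card_of_subtype _ (fun x => by simp [MulAction.mem_fixedBy, smul_def])
    simp_rw [hfix, huniv] at hB
    rw [Finset.sum_pair hne.symm, Finset.sum_pair hne.symm, Finset.sum_pair hne.symm] at hB
    simp [hne] at hB
    rw [mul_comm, ← hB]
    ring

end Involutions

/-! ### Abelian subgroups -/

/-- The number of solutions of `2 * s = 0` modulo `k`. -/
def numHalves (k : ℕ) : ℕ := if Even k then 2 else 1

theorem card_dvd_two_mul {k : ℕ} (hk : 0 < k) :
    (Finset.univ.filter fun s : Fin k => (k : ℤ) ∣ 2 * (s : ℕ)).card = numHalves k := by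
  have hiff : ∀ s : Fin k, (k : ℤ) ∣ 2 * (s : ℕ) ↔ (s : ℕ) = 0 ∨ 2 * (s : ℕ) = k := by
    intro s
    have hs := s.2
    constructor
    · intro h
      have h1 : k ∣ 2 * (s : ℕ) := by exact_mod_cast h
      obtain ⟨c, hc⟩ := h1
      have : c < 2 := by
        by_contra hc2
        have := Nat.mul_le_mul_left k (not_lt.1 hc2)
        omega
      interval_cases c <;> omega
    · rintro (h | h)
      · rw [h]; simp
      · exact ⟨1, by rw [mul_one]; exact_mod_cast h⟩
  simp_rw [hiff]
  rw [numHalves]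
  split_ifs with he
  · obtain ⟨h, rfl⟩ := he
    have : (Finset.univ.filter fun s : Fin (h + h) => (s : ℕ) = 0 ∨ 2 * (s : ℕ) = h + h) =
        {⟨0, hk⟩, ⟨h, by omega⟩} := by
      ext s
      simp only [Finset.mem_filter, Finset.mem_univ, true_and, Finset.mem_insert,
        Finset.mem_singleton, Fin.ext_iff]
      omega
    rw [this, Finset.card_pair]
    simp only [ne_eq, Fin.ext_iff]
    omega
  · have : (Finset.univ.filter fun s : Fin k => (s : ℕ) = 0 ∨ 2 * (s : ℕ) = k) = {⟨0, hk⟩} := by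
      ext s
      simp only [Finset.mem_filter, Finset.mem_univ, true_and, Finset.mem_singleton, Fin.ext_iff]
      rw [Nat.even_iff] at he
      omega
    rw [this, Finset.card_singleton]

theorem card_two_mul_eq {L : ℕ} (hL : 0 < L) :
    (Finset.univ.filter fun v : Fin L => 2 * (v : ℕ) = L).card = if Even L then 1 else 0 := by
  split_ifs with he
  · obtain ⟨h, rfl⟩ := he
    rw [Finset.card_eq_one]
    refine ⟨⟨h, by omega⟩, ?_⟩
    ext s
    simp only [Finset.mem_filter, Finset.mem_univ, true_and, Finset.mem_singleton, Fin.ext_iff]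
    omega
  · rw [Finset.card_eq_zero, Finset.filter_eq_empty_iff]
    intro v _ h
    exact he ⟨v, by omega⟩

theorem card_eq_zero {L : ℕ} (hL : 0 < L) :
    (Finset.univ.filter fun v : Fin L => (v : ℕ) = 0).card = 1 := by
  rw [Finset.card_eq_one]
  refine ⟨⟨0, hL⟩, ?_⟩
  ext s
  simp [Fin.ext_iff]

theorem card_dvd_two_mul_sub {k : ℕ} (hk : 0 < k) :
    (Finset.univ.filter fun p : Fin k × Fin k =>
      (k : ℤ) ∣ 2 * (p.2 : ℕ) - (p.1 : ℕ)).card = k := by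
  have hk' : (0 : ℤ) < k := by exact_mod_cast hk
  refine Eq.trans (Finset.card_nbij' (t := (Finset.univ : Finset (Fin k))) (fun p => p.2)
    (fun t => (⟨2 * t % k, Nat.mod_lt _ hk⟩, t)) ?_ ?_ ?_ ?_) (by simp)
  · simp [Set.MapsTo]
  · intro t _
    simp only [Finset.coe_filter, Finset.mem_univ, true_and, Set.mem_ofPred_eq]
    push_cast
    exact Int.dvd_self_sub_emod
  · rintro ⟨s, t⟩ h
    simp only [Finset.coe_filter, Finset.mem_univ, true_and, Set.mem_ofPred_eq] at h
    simp only [Prod.mk.injEq, and_true, Fin.ext_iff]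
    have h1 : ((s : ℕ) : ℤ) ≡ ((2 * (t : ℕ) : ℕ) : ℤ) [ZMOD k] :=
      Int.modEq_iff_dvd.2 (by push_cast; exact h)
    have h2 : 2 * (t : ℕ) % k = (s : ℕ) % k := ((Int.natCast_modEq_iff.1 h1).symm : _)
    rw [h2, Nat.mod_eq_of_lt s.2]
  · intro t _
    rfl

theorem card_dvd_fst {k : ℕ} (hk : 0 < k) :
    (Finset.univ.filter fun p : Fin k × Fin k => (k : ℤ) ∣ (p.1 : ℕ)).card = k := by
  have : (Finset.univ.filter fun p : Fin k × Fin k => (k : ℤ) ∣ (p.1 : ℕ)) =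
      {⟨0, hk⟩} ×ˢ Finset.univ := by
    ext ⟨s, t⟩
    simp only [Finset.mem_filter, Finset.mem_univ, true_and, Finset.mem_product,
      Finset.mem_singleton, and_true, Fin.ext_iff, Int.natCast_dvd_natCast]
    exact ⟨fun h => Nat.eq_zero_of_dvd_of_lt h s.2, fun h => by rw [h]; exact dvd_zero _⟩
  rw [this, Finset.card_product]
  simp

section Abelian

variable {k L m : ℕ}

/-- The datum of an abelian subgroup given by its reduced coordinates. -/
def abelianDatum (x : (Fin k × Fin k) × Fin L) : ℤ × ℤ × ℤ :=
  ((x.1.1 : ℕ), (x.1.2 : ℕ), 2 * ((x.2 : ℕ) : ℤ))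

theorem isGood_abelianDatum (hm0 : 0 < m) (x : (Fin k × Fin k) × Fin L) :
    IsGood k (2 * L) m (abelianDatum x) :=
  isGood_of_even (Nat.zero_lt_of_lt x.1.1.2) (by have := x.2.2; omega) hm0 (by simp)
    (by rw [sg_even (even_two_mul _)]; simp)

theorem map_conj_sub_abelian_iff (hm0 : 0 < m) (hm : Even (m : ℤ))
    (x x' : (Fin k × Fin k) × Fin L) (g : Model) :
    (sub k (2 * L) m (abelianDatum x)).map (MulAut.conj g).toMonoidHom =
        sub k (2 * L) m (abelianDatum x') ↔
      (k : ℤ) ∣ sg g.b * (x.1.1 : ℕ) - (x'.1.1 : ℕ) ∧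
      ∃ j : ℤ, sg g.c * (x.2 : ℕ) = (x'.2 : ℕ) + j * L ∧
        (k : ℤ) ∣ sg g.b * sg g.c * (x.1.2 : ℕ) - j * (x'.1.1 : ℕ) - (x'.1.2 : ℕ) := by
  rw [(isGood_abelianDatum hm0 x).conj_iff_of_even_even_even (isGood_abelianDatum hm0 x')
    (by simp) hm (even_two_mul _)]
  refine and_congr_right fun _ => exists_congr fun j => and_congr_left fun _ => ?_
  simp only [abelianDatum]
  push_cast
  constructor <;> intro h <;> linarith

theorem exists_abelianDatum (hk0 : 0 < k) (hL0 : 0 < L) (hm0 : 0 < m) (hm : Even (m : ℤ))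
    {d : ℤ × ℤ × ℤ} (hd : IsGood k (2 * L) m d) (hu : Even d.2.2) (g : Model) :
    ∃ x : (Fin k × Fin k) × Fin L, (sub k (2 * L) m d).map (MulAut.conj g).toMonoidHom =
      sub k (2 * L) m (abelianDatum x) := by
  obtain ⟨a, ha⟩ := hu.two_dvd
  obtain ⟨s, hs, i, hi⟩ := exists_rep hk0 (sg g.b * d.1)
  obtain ⟨v, hv, j, hj⟩ := exists_rep hL0 (sg g.c * a)
  obtain ⟨t, ht, i', hi'⟩ := exists_rep hk0 (sg g.b * sg g.c * d.2.1 - j * s)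
  refine ⟨((⟨s, hs⟩, ⟨t, ht⟩), ⟨v, hv⟩), (hd.conj_iff_of_even_even_even
    (isGood_abelianDatum hm0 _) (by simp) hm hu g).2 ⟨⟨i, ?_⟩, j, ?_, ⟨i', ?_⟩⟩⟩
  · rw [hi]; simp only [abelianDatum]; ring
  · rw [ha]; simp only [abelianDatum]; push_cast; linear_combination 2 * hj
  · simp only [abelianDatum]; rw [hi']; ring

theorem sub_abelianDatum_injective (hm0 : 0 < m) (hm : Even (m : ℤ)) :
    Function.Injective fun x : (Fin k × Fin k) × Fin L => sub k (2 * L) m (abelianDatum x) := by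
  intro x x' h
  have h1 : (sub k (2 * L) m (abelianDatum x)).map (MulAut.conj (1 : Model)).toMonoidHom =
      sub k (2 * L) m (abelianDatum x') := by
    simp only at h
    rw [← h]
    ext w
    simp
  obtain ⟨hs, j, hj, ht⟩ := (map_conj_sub_abelian_iff hm0 hm x x' 1).1 h1
  simp only [one_b, one_c, sg_zero, one_mul] at hs hj ht
  obtain ⟨i, hi⟩ := exists_eq_add_mul hs
  have e1 := rep_unique x.1.1.2 x'.1.1.2 hi
  obtain ⟨e2, rfl⟩ := rep_unique x.2.2 x'.2.2 hj
  rw [zero_mul, sub_zero] at ht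
  obtain ⟨i', hi'⟩ := exists_eq_add_mul ht
  have e3 := rep_unique x.1.2.2 x'.1.2.2 hi'
  exact Prod.ext (Prod.ext (Fin.ext e1.1) (Fin.ext e3.1)) (Fin.ext e2)

/-- Conjugation depends only on the signs of `g`, so it acts on the `k ^ 2 * L` reduced data through
the Klein four-group generated by y and z. The terms of the formula are the numbers of fixed points
of the identity, of y, and, with the factor 2, of z and of the product of y and z. -/
theorem transversal_abelian {H : Type*} [Group H] (hk0 : 0 < k) (hL0 : 0 < L) (hm0 : 0 < m)
    (hm : Even (m : ℤ))
    (hp : ∀ d, IsGood k (2 * L) m d → (Nonempty (sub k (2 * L) m d ≃* H) ↔ Even d.2.2)) :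
    ∃ T, IsTransversal H k (2 * L) m T ∧ 4 * T.card = k ^ 2 * L + numHalves k ^ 2 * L +
      2 * (k * numHalves k + if Even L then k else 0) := by
  have hex : ∀ (g : Model) (x : (Fin k × Fin k) × Fin L), ∃ x' : (Fin k × Fin k) × Fin L,
      (sub k (2 * L) m (abelianDatum x)).map (MulAut.conj g).toMonoidHom =
        sub k (2 * L) m (abelianDatum x') := fun g x =>
    exists_abelianDatum hk0 hL0 hm0 hm (isGood_abelianDatum hm0 x) (even_two_mul _) g
  choose act hact using hex
  have inj := sub_abelianDatum_injective (k := k) (L := L) hm0 hm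
  have act_eq : ∀ g x x', act g x = x' ↔
      (sub k (2 * L) m (abelianDatum x)).map (MulAut.conj g).toMonoidHom =
        sub k (2 * L) m (abelianDatum x') := by
    intro g x x'
    rw [hact]
    exact ⟨fun h => by rw [h], fun h => inj h⟩
  have act_congr : ∀ g g' x, sg g.b = sg g'.b → sg g.c = sg g'.c → act g x = act g' x := by
    intro g g' x hb hc
    rw [act_eq, map_conj_sub_abelian_iff hm0 hm, hb, hc, ← map_conj_sub_abelian_iff hm0 hm,
      ← act_eq]
  have act_mul : ∀ g g' x, act g (act g' x) = act (g * g') x := by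
    intro g g' x
    rw [eq_comm, act_eq, ← hact, ← hact, Subgroup.map_map]
    congr 1
    ext w : 1
    simp [mul_assoc]
  have act_one : ∀ x, act 1 x = x := by
    intro x
    rw [act_eq]
    ext w
    simp
  have sg_two : sg 2 = 1 := sg_even even_two
  obtain ⟨T, hT1, hT2, hT3⟩ := exists_transversal_involutions (act (Q 0 1)) (act (R 0 0 1))
    (fun x => by rw [act_mul, act_congr _ 1 x (by simp [sg_two]) (by simp), act_one])
    (fun x => by rw [act_mul, act_congr _ 1 x (by simp) (by simp [sg_two]), act_one])
    (fun x => by rw [act_mul, act_mul]; exact act_congr _ _ x (by simp) (by simp))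
  have hact_cases : ∀ g x, act g x = x ∨ act g x = act (Q 0 1) x ∨ act g x = act (R 0 0 1) x ∨
      act g x = act (Q 0 1) (act (R 0 0 1) x) := by
    intro g x
    rw [act_mul]
    rcases sg_eq_one_or g.b with hb | hb <;> rcases sg_eq_one_or g.c with hc | hc
    · left; rw [act_congr g 1 x (by simp [hb]) (by simp [hc]), act_one]
    · right; right; left; exact act_congr _ _ x (by simp [hb]) (by simp [hc])
    · right; left; exact act_congr _ _ x (by simp [hb]) (by simp [hc])
    · right; right; right; exact act_congr _ _ x (by simp [hb]) (by simp [hc])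
  have hdinj : Function.Injective (abelianDatum (k := k) (L := L)) := by
    intro x x' h
    exact inj (by simp only [h])
  refine ⟨T.image abelianDatum, isTransversal_of hp ?_ ?_ ?_ ?_, ?_⟩
  · simp only [Finset.mem_image]
    rintro _ ⟨x, -, rfl⟩
    exact isGood_abelianDatum hm0 x
  · simp only [Finset.mem_image]
    rintro _ ⟨x, -, rfl⟩
    exact even_two_mul _
  · intro d hd hu
    obtain ⟨x, hx⟩ := exists_abelianDatum hk0 hL0 hm0 hm hd hu 1
    obtain ⟨r, hr, h⟩ := hT1 x
    refine ⟨_, Finset.mem_image_of_mem _ hr, ?_⟩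
    obtain ⟨g, rfl⟩ : ∃ g, r = act g x := by
      rcases h with h | h | h | h
      · exact ⟨1, by rw [act_one, h]⟩
      · exact ⟨_, h⟩
      · exact ⟨_, h⟩
      · exact ⟨_, by rw [h, act_mul]⟩
    refine ⟨g, ?_⟩
    rw [← hact, ← hx, Subgroup.map_map]
    congr 1
    ext w : 1
    simp
  · simp only [Finset.mem_image]
    rintro _ ⟨x, hx, rfl⟩ _ ⟨x', hx', rfl⟩ ⟨g, hg⟩
    rw [← act_eq] at hg
    subst hg
    rw [← hT2 x hx _ hx' (hact_cases g x)]
  · rw [Finset.card_image_of_injective _ hdinj, hT3]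
    have hL : (0 : ℤ) < L := by exact_mod_cast hL0
    -- Negation modulo `L` fixes 0 and, for even `L`, also `L / 2`. At the latter the reduction uses
    -- `j = -1`, which adds `s` to the condition on `t`.
    have hv : ∀ (v : Fin L) (j : ℤ), -1 * ((v : ℕ) : ℤ) = (v : ℕ) + j * L ↔
        ((v : ℕ) = 0 ∧ j = 0) ∨ (2 * (v : ℕ) = L ∧ j = -1) := by
      intro v j
      constructor
      · intro h
        have h1 := v.2
        have h2 : -2 < j := by
          by_contra hc
          have := mul_le_mul_of_nonneg_right (not_lt.1 hc) hL.le
          omega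
        have h3 : j < 1 := by
          by_contra hc
          have := mul_le_mul_of_nonneg_right (not_lt.1 hc) hL.le
          omega
        interval_cases j <;> omega
      · rintro (⟨h, rfl⟩ | ⟨h, rfl⟩)
        · rw [h]; simp
        · have : (2 * (v : ℕ) : ℤ) = L := by exact_mod_cast h
          linarith
    have dc : ∀ a b : ℤ, a = b → (k : ℤ) ∣ a → (k : ℤ) ∣ b := fun a b e h => e ▸ h
    have f1 : ∀ x, act (Q 0 1) x = x ↔
        ((k : ℤ) ∣ 2 * (x.1.1 : ℕ) ∧ (k : ℤ) ∣ 2 * (x.1.2 : ℕ)) := by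
      intro x
      rw [act_eq, map_conj_sub_abelian_iff hm0 hm]
      simp only [Q_b, Q_c, sg_one, sg_zero, one_mul, mul_one, left_eq_add, mul_eq_zero, hL.ne',
        or_false, exists_eq_left, zero_mul, sub_zero]
      rw [show ∀ a : ℤ, -1 * a - a = -(2 * a) by intro a; ring, dvd_neg,
        show ∀ a : ℤ, -1 * a - a = -(2 * a) by intro a; ring, dvd_neg]
    have f2 : ∀ x, act (R 0 0 1) x = x ↔ ((k : ℤ) ∣ 2 * (x.1.2 : ℕ) ∧ (x.2 : ℕ) = 0) ∨
        ((k : ℤ) ∣ 2 * (x.1.2 : ℕ) - (x.1.1 : ℕ) ∧ 2 * (x.2 : ℕ) = L) := by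
      intro x
      rw [act_eq, map_conj_sub_abelian_iff hm0 hm]
      simp only [R_b, R_c, sg_one, sg_zero, one_mul, sub_self, dvd_zero, true_and, hv]
      constructor
      · rintro ⟨j, ⟨h, rfl⟩ | ⟨h, rfl⟩, h2⟩
        · exact .inl ⟨dc _ _ (by ring) h2.neg_right, h⟩
        · exact .inr ⟨dc _ _ (by ring) h2.neg_right, h⟩
      · rintro (⟨h2, h⟩ | ⟨h2, h⟩)
        · exact ⟨0, .inl ⟨h, rfl⟩, dc _ _ (by ring) h2.neg_right⟩
        · exact ⟨-1, .inr ⟨h, rfl⟩, dc _ _ (by ring) h2.neg_right⟩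
    have f3 : ∀ x, act (Q 0 1) (act (R 0 0 1) x) = x ↔
        ((k : ℤ) ∣ 2 * (x.1.1 : ℕ) ∧ (x.2 : ℕ) = 0) ∨
        ((k : ℤ) ∣ (x.1.1 : ℕ) ∧ 2 * (x.2 : ℕ) = L) := by
      intro x
      rw [act_mul, act_eq, map_conj_sub_abelian_iff hm0 hm]
      simp only [mul_b, mul_c, Q_b, Q_c, R_b, R_c, sg_zero, mul_zero, add_zero, zero_add, sg_one,
        hv]
      rw [show ∀ a : ℤ, -1 * a - a = -(2 * a) by intro a; ring, dvd_neg]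
      constructor
      · rintro ⟨h1, j, ⟨h, rfl⟩ | ⟨h, rfl⟩, h2⟩
        · exact .inl ⟨h1, h⟩
        · exact .inr ⟨dc _ _ (by ring) h2, h⟩
      · rintro (⟨h2, h⟩ | ⟨h2, h⟩)
        · exact ⟨h2, 0, .inl ⟨h, rfl⟩, by simp⟩
        · exact ⟨h2.mul_left 2, -1, .inr ⟨h, rfl⟩, dc _ _ (by ring) h2⟩
    have c1 : (Finset.univ.filter fun x => act (Q 0 1) x = x).card = numHalves k ^ 2 * L := by
      have : (Finset.univ.filter fun x => act (Q 0 1) x = x) =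
          ((Finset.univ.filter fun s : Fin k => (k : ℤ) ∣ 2 * (s : ℕ)) ×ˢ
            (Finset.univ.filter fun s : Fin k => (k : ℤ) ∣ 2 * (s : ℕ))) ×ˢ
            (Finset.univ : Finset (Fin L)) := by
        ext x
        simp [f1]
      rw [this, Finset.card_product, Finset.card_product, card_dvd_two_mul hk0]
      simp [pow_two]
    have disj : ∀ A B : Finset (Fin k × Fin k), Disjoint
        (A ×ˢ (Finset.univ.filter fun v : Fin L => (v : ℕ) = 0))
        (B ×ˢ (Finset.univ.filter fun v : Fin L => 2 * (v : ℕ) = L)) := by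
      intro A B
      rw [Finset.disjoint_left]
      intro x h1 h2
      simp only [Finset.mem_product, Finset.mem_filter, Finset.mem_univ, true_and] at h1 h2
      omega
    have cL : ∀ a b : ℕ, a * 1 + b * (if Even L then 1 else 0) = a + if Even L then b else 0 := by
      intro a b
      split_ifs <;> simp
    have c2 : (Finset.univ.filter fun x => act (R 0 0 1) x = x).card =
        k * numHalves k + if Even L then k else 0 := by
      have : (Finset.univ.filter fun x => act (R 0 0 1) x = x) =
          ((Finset.univ : Finset (Fin k)) ×ˢ
            (Finset.univ.filter fun s : Fin k => (k : ℤ) ∣ 2 * (s : ℕ))) ×ˢ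
            (Finset.univ.filter fun v : Fin L => (v : ℕ) = 0) ∪
          (Finset.univ.filter fun p : Fin k × Fin k => (k : ℤ) ∣ 2 * (p.2 : ℕ) - (p.1 : ℕ)) ×ˢ
            (Finset.univ.filter fun v : Fin L => 2 * (v : ℕ) = L) := by
        ext x
        simp [f2]
      rw [this, Finset.card_union_of_disjoint (disj _ _), Finset.card_product,
        Finset.card_product, Finset.card_product, card_dvd_two_mul hk0, card_eq_zero hL0,
        card_two_mul_eq hL0, card_dvd_two_mul_sub hk0, cL]
      simp
    have c3 : (Finset.univ.filter fun x => act (Q 0 1) (act (R 0 0 1) x) = x).card =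
        k * numHalves k + if Even L then k else 0 := by
      have : (Finset.univ.filter fun x => act (Q 0 1) (act (R 0 0 1) x) = x) =
          ((Finset.univ.filter fun s : Fin k => (k : ℤ) ∣ 2 * (s : ℕ)) ×ˢ
            (Finset.univ : Finset (Fin k))) ×ˢ
            (Finset.univ.filter fun v : Fin L => (v : ℕ) = 0) ∪
          (Finset.univ.filter fun p : Fin k × Fin k => (k : ℤ) ∣ (p.1 : ℕ)) ×ˢ
            (Finset.univ.filter fun v : Fin L => 2 * (v : ℕ) = L) := by
        ext x
        simp [f3]
      rw [this, Finset.card_union_of_disjoint (disj _ _), Finset.card_product,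
        Finset.card_product, Finset.card_product, card_dvd_two_mul hk0, card_eq_zero hL0,
        card_two_mul_eq hL0, card_dvd_fst hk0, cL]
      simp [mul_comm]
    rw [c1, c2, c3]
    simp only [Fintype.card_prod, Fintype.card_fin]
    ring

end Abelian

/-! ### Sums over factorizations into three factors -/

/-- The indicator function of the multiples of `d`. -/
def ind (d a : ℕ) : ℚ := if d ∣ a then 1 else 0

theorem ind_one (a : ℕ) : ind 1 a = 1 := if_pos (one_dvd a)

theorem ind_two_of_even {a : ℕ} (h : Even a) : ind 2 a = 1 := if_pos h.two_dvd

theorem ind_two_of_odd {a : ℕ} (h : Odd a) : ind 2 a = 0 :=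
  if_neg fun h' => Nat.not_even_iff_odd.2 h (even_iff_two_dvd.2 h')

theorem ind_four_of_odd {a : ℕ} (h : Odd a) : ind 4 a = 0 :=
  if_neg fun h' => Nat.not_even_iff_odd.2 h (even_iff_two_dvd.2 (dvd_trans (by norm_num) h'))

theorem ind_four_two_mul (a : ℕ) : ind 4 (2 * a) = ind 2 a := by
  have : 4 ∣ 2 * a ↔ 2 ∣ a := Nat.mul_dvd_mul_iff_left (a := 2) (b := 2) two_pos
  simp only [ind, this]

/-- Writing the rounding through an indicator makes the orbit counts accessible to `ring`. -/
theorem cast_add_one_div_two (a : ℕ) : (((a + 1) / 2 : ℕ) : ℚ) = (a + 1 - ind 2 a) / 2 := by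
  rcases Nat.even_or_odd' a with ⟨b, rfl | rfl⟩
  · rw [ind_two_of_even (even_two_mul b), show (2 * b + 1) / 2 = b by omega]
    push_cast
    ring
  · rw [ind_two_of_odd (odd_two_mul_add_one b), show (2 * b + 1 + 1) / 2 = b + 1 by omega]
    push_cast
    ring

section Sums

variable {n p q r : ℕ}

theorem mul_dvd_of_mem_finMulAntidiag {f : Fin 3 → ℕ} (hf : f ∈ Nat.finMulAntidiag 3 n)
    (h0 : p ∣ f 0) (h1 : q ∣ f 1) (h2 : r ∣ f 2) : p * q * r ∣ n := by
  rw [← Nat.prod_eq_of_mem_finMulAntidiag hf, Fin.prod_univ_three]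
  exact mul_dvd_mul (mul_dvd_mul h0 h1) h2

/-- Dividing the factors by `p`, `q`, `r` is a bijection from the factorizations selected by the
indicators onto those of `n / (p * q * r)`. -/
theorem sum_ind_mul (hn : n ≠ 0) (F : ℕ → ℕ → ℕ → ℚ) :
    ∑ f ∈ Nat.finMulAntidiag 3 n, ind p (f 0) * ind q (f 1) * ind r (f 2) * F (f 0) (f 1) (f 2) =
      if p * q * r ∣ n then
        ∑ f ∈ Nat.finMulAntidiag 3 (n / (p * q * r)), F (p * f 0) (q * f 1) (r * f 2)
      else 0 := by
  have e : ∀ f : Fin 3 → ℕ, ind p (f 0) * ind q (f 1) * ind r (f 2) * F (f 0) (f 1) (f 2) =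
      if p ∣ f 0 ∧ q ∣ f 1 ∧ r ∣ f 2 then F (f 0) (f 1) (f 2) else 0 := by
    intro f
    by_cases h0 : p ∣ f 0 <;> by_cases h1 : q ∣ f 1 <;> by_cases h2 : r ∣ f 2 <;>
      simp [ind, h0, h1, h2]
  simp_rw [e]
  rw [← Finset.sum_filter]
  split_ifs with h
  · obtain ⟨N, rfl⟩ := h
    have hpqr : p * q * r ≠ 0 := left_ne_zero_of_mul hn
    have hr : 0 < r := Nat.pos_of_ne_zero (right_ne_zero_of_mul hpqr)
    have hq : 0 < q := Nat.pos_of_ne_zero (right_ne_zero_of_mul (left_ne_zero_of_mul hpqr))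
    have hp : 0 < p := Nat.pos_of_ne_zero (left_ne_zero_of_mul (left_ne_zero_of_mul hpqr))
    rw [Nat.mul_div_cancel_left _ (Nat.pos_of_ne_zero hpqr)]
    refine Finset.sum_nbij' (fun f => ![f 0 / p, f 1 / q, f 2 / r])
      (fun f => ![p * f 0, q * f 1, r * f 2]) ?_ ?_ ?_ ?_ ?_
    · intro f hf
      simp only [Finset.mem_filter, Nat.mem_finMulAntidiag, Fin.prod_univ_three] at hf ⊢
      obtain ⟨⟨h, -⟩, ⟨a, ha⟩, ⟨b, hb⟩, ⟨c, hc⟩⟩ := hf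
      refine ⟨?_, right_ne_zero_of_mul hn⟩
      rw [ha, hb, hc] at h
      simp only [Matrix.cons_val_zero, Matrix.cons_val_one, Matrix.cons_val, ha, hb, hc,
        Nat.mul_div_cancel_left _ hp, Nat.mul_div_cancel_left _ hq, Nat.mul_div_cancel_left _ hr]
      refine Nat.eq_of_mul_eq_mul_left (Nat.pos_of_ne_zero hpqr) ?_
      rw [← h]
      ring
    · intro f hf
      simp only [Finset.mem_filter, Nat.mem_finMulAntidiag, Fin.prod_univ_three] at hf ⊢
      refine ⟨⟨?_, hn⟩, by simp, by simp, by simp⟩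
      rw [← hf.1]
      simp only [Matrix.cons_val_zero, Matrix.cons_val_one, Matrix.cons_val]
      ring
    · intro f hf
      simp only [Finset.mem_filter] at hf
      obtain ⟨-, h0, h1, h2⟩ := hf
      ext i
      fin_cases i
      exacts [Nat.mul_div_cancel' h0, Nat.mul_div_cancel' h1, Nat.mul_div_cancel' h2]
    · intro f _
      ext i
      fin_cases i
      exacts [Nat.mul_div_cancel_left _ hp, Nat.mul_div_cancel_left _ hq,
        Nat.mul_div_cancel_left _ hr]
    · intro f hf
      simp only [Finset.mem_filter] at hf
      obtain ⟨-, h0, h1, h2⟩ := hf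
      simp only [Matrix.cons_val_zero, Matrix.cons_val_one, Matrix.cons_val,
        Nat.mul_div_cancel' h0, Nat.mul_div_cancel' h1, Nat.mul_div_cancel' h2]
  · refine Finset.sum_eq_zero fun f hf => ?_
    simp only [Finset.mem_filter] at hf
    exact absurd (mul_dvd_of_mem_finMulAntidiag hf.1 hf.2.1 hf.2.2.1 hf.2.2.2) h

theorem sum_ind (hn : n ≠ 0) :
    ∑ f ∈ Nat.finMulAntidiag 3 n, ind p (f 0) * ind q (f 1) * ind r (f 2) =
      atQuot d3 n (p * q * r) := by
  have h := sum_ind_mul (p := p) (q := q) (r := r) hn fun _ _ _ => 1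
  simp only [mul_one] at h
  rw [h, atQuot, d3]
  push_cast
  rfl

theorem sum_ind_fst (hn : n ≠ 0) :
    ∑ f ∈ Nat.finMulAntidiag 3 n, ind p (f 0) * ind q (f 1) * ind r (f 2) * (f 0 : ℚ) =
      p * atQuot sigma2 n (p * q * r) := by
  rw [sum_ind_mul hn fun a _ _ => a, atQuot, sigma2, mul_ite, mul_zero]
  push_cast
  rw [Finset.mul_sum]

/-- Exchanging the first two factors is a symmetry of the set of factorizations, so `sigma2` also
serves for sums weighted by the second factor. -/
theorem sum_swap (N : ℕ) :
    ∑ f ∈ Nat.finMulAntidiag 3 N, (f 1 : ℚ) = ∑ f ∈ Nat.finMulAntidiag 3 N, (f 0 : ℚ) := by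
  have h : ∀ f ∈ Nat.finMulAntidiag 3 N, ![f 1, f 0, f 2] ∈ Nat.finMulAntidiag 3 N := by
    intro f hf
    simp only [Nat.mem_finMulAntidiag, Fin.prod_univ_three] at hf ⊢
    refine ⟨?_, hf.2⟩
    rw [← hf.1]
    simp only [Matrix.cons_val_zero, Matrix.cons_val_one, Matrix.cons_val]
    ring
  have h' : ∀ f : Fin 3 → ℕ, ![f 0, f 1, f 2] = f := by
    intro f
    ext i
    fin_cases i <;> rfl
  exact Finset.sum_nbij' (fun f => ![f 1, f 0, f 2]) (fun f => ![f 1, f 0, f 2]) h h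
    (fun f _ => h' f) (fun f _ => h' f) (fun f _ => rfl)

theorem sum_ind_snd (hn : n ≠ 0) :
    ∑ f ∈ Nat.finMulAntidiag 3 n, ind p (f 0) * ind q (f 1) * ind r (f 2) * (f 1 : ℚ) =
      q * atQuot sigma2 n (p * q * r) := by
  rw [sum_ind_mul hn fun _ b _ => b, atQuot, sigma2, mul_ite, mul_zero]
  push_cast
  rw [← Finset.mul_sum, sum_swap]

theorem sum_ind_sq_mul (hn : n ≠ 0) :
    ∑ f ∈ Nat.finMulAntidiag 3 n,
        ind p (f 0) * ind q (f 1) * ind r (f 2) * ((f 0 : ℚ) ^ 2 * f 1) =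
      p ^ 2 * q * atQuot omega n (p * q * r) := by
  rw [sum_ind_mul hn fun a b _ => a ^ 2 * b, atQuot, omega, mul_ite, mul_zero]
  push_cast
  rw [Finset.mul_sum]
  congr 1
  exact Finset.sum_congr rfl fun f _ => by ring

end Sums

/-! ### The counting problem with rational weights -/

theorem numClasses_eq_sum {H : Type*} [Group H] {n : ℕ} (hn : n ≠ 0) {N : ℕ → ℕ → ℕ → ℚ}
    (h : ∀ k l m, 0 < k → 0 < l → 0 < m →
      ∃ T, IsTransversal H k l m T ∧ (T.card : ℚ) = N k l m) :
    (conjClassesOfType H PiB4 n).Finite ∧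
      (numClasses H PiB4 n : ℚ) = ∑ f ∈ Nat.finMulAntidiag 3 n, N (f 0) (f 1) (f 2) := by
  have h' : ∀ k l m, ∃ c : ℕ, 0 < k → 0 < l → 0 < m →
      (c : ℚ) = N k l m ∧ ∃ T, IsTransversal H k l m T ∧ T.card = c := by
    intro k l m
    by_cases hp : 0 < k ∧ 0 < l ∧ 0 < m
    · obtain ⟨T, hT, e⟩ := h k l m hp.1 hp.2.1 hp.2.2
      exact ⟨T.card, fun _ _ _ => ⟨e, T, hT, rfl⟩⟩
    · exact ⟨0, fun h0 h1 h2 => absurd ⟨h0, h1, h2⟩ hp⟩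
  choose c hc using h'
  obtain ⟨h1, h2⟩ := numClasses_eq hn fun k l m h0 h1 h2 => (hc k l m h0 h1 h2).2
  refine ⟨h1, ?_⟩
  rw [h2, Nat.cast_sum]
  refine Finset.sum_congr rfl fun f hf => (hc _ _ _ ?_ ?_ ?_).1
  exacts [Nat.pos_of_ne_zero (Nat.ne_zero_of_mem_finMulAntidiag hf 0),
    Nat.pos_of_ne_zero (Nat.ne_zero_of_mem_finMulAntidiag hf 1),
    Nat.pos_of_ne_zero (Nat.ne_zero_of_mem_finMulAntidiag hf 2)]

theorem isTransversal_empty {H : Type*} [Group H] {k l m : ℕ}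
    (h : ∀ d, IsGood k l m d → ¬ Nonempty (sub k l m d ≃* H)) : IsTransversal H k l m ∅ where
  good := by simp
  iso := by simp
  exists_conj d hd hd' := absurd hd' (h d hd)
  eq_of_conj := by simp

/-! ### Numbers of conjugacy classes with given parameters, and their sums -/

theorem atQuot_one (f : ℕ → ℕ) (n : ℕ) : atQuot f n 1 = f n := by
  simp [atQuot]

/-- The number of conjugacy classes of subgroups of type `PiG1` with parameters `k, l, m`. -/
def weightG1 (k l m : ℕ) : ℚ :=
  ind 2 m * (ind 2 l * (k ^ 2 * l / 2 + (1 + 3 * ind 2 k) * (l / 2) + 2 * k * (1 + ind 2 k)) +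
    ind 4 l * (2 * k)) / 4

theorem sum_weightG1 {n : ℕ} (hn : n ≠ 0) :
    ∑ f ∈ Nat.finMulAntidiag 3 n, weightG1 (f 0) (f 1) (f 2) =
      1 / 4 * (atQuot omega n 4 + 3 * atQuot sigma2 n 4 + 9 * atQuot sigma2 n 8) := by
  -- The weight is expanded into products of three indicators with a monomial; `ind 1` stands for no
  -- condition, so that each product has the shape required by the summation lemmas.
  have e : ∀ f : Fin 3 → ℕ, weightG1 (f 0) (f 1) (f 2) =
      (1/2) * (ind 2 (f 0) * ind 2 (f 1) * ind 2 (f 2) * (f 0 : ℚ)) +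
      (1/2) * (ind 1 (f 0) * ind 2 (f 1) * ind 2 (f 2) * (f 0 : ℚ)) +
      (1/2) * (ind 1 (f 0) * ind 4 (f 1) * ind 2 (f 2) * (f 0 : ℚ)) +
      (3/8) * (ind 2 (f 0) * ind 2 (f 1) * ind 2 (f 2) * (f 1 : ℚ)) +
      (1/8) * (ind 1 (f 0) * ind 2 (f 1) * ind 2 (f 2) * (f 1 : ℚ)) +
      (1/8) * (ind 1 (f 0) * ind 2 (f 1) * ind 2 (f 2) * ((f 0 : ℚ) ^ 2 * f 1)) := by
    intro f
    simp only [weightG1, ind_one]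
    ring
  simp only [e, Finset.sum_add_distrib, ← Finset.mul_sum,
    sum_ind_fst hn, sum_ind_snd hn, sum_ind_sq_mul hn]
  norm_num
  ring

/-- The number of conjugacy classes of subgroups of type `PiG2` with parameters `k, l, m`. -/
def weightG2 (k l m : ℕ) : ℚ :=
  (1 - ind 2 m) * (ind 4 l * ((1 - ind 2 k) * k + ind 2 k * (3 * k / 2)) +
    (ind 2 l - ind 4 l) * ((1 - ind 2 k) * ((k + 1) / 2) + ind 2 k * k + (ind 2 k - ind 4 k)))

theorem sum_weightG2 {n : ℕ} (hn : n ≠ 0) :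
    ∑ f ∈ Nat.finMulAntidiag 3 n, weightG2 (f 0) (f 1) (f 2) =
      1 / 2 * (atQuot sigma2 n 2 + 2 * atQuot sigma2 n 4 - 3 * atQuot sigma2 n 8
        + atQuot d3 n 2 - atQuot d3 n 4 - 3 * atQuot d3 n 8 + 5 * atQuot d3 n 16
        - 2 * atQuot d3 n 32) := by
  -- The products of the indicators 4, 4 and 2 are the source of the values at `n / 32`.
  have e : ∀ f : Fin 3 → ℕ, weightG2 (f 0) (f 1) (f 2) =
      (1/2) * (ind 2 (f 0) * ind 2 (f 1) * ind 1 (f 2)) +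
      (-1/2) * (ind 2 (f 0) * ind 2 (f 1) * ind 2 (f 2)) +
      (-1/2) * (ind 2 (f 0) * ind 4 (f 1) * ind 1 (f 2)) +
      (1/2) * (ind 2 (f 0) * ind 4 (f 1) * ind 2 (f 2)) +
      (-1) * (ind 4 (f 0) * ind 2 (f 1) * ind 1 (f 2)) +
      (1) * (ind 4 (f 0) * ind 2 (f 1) * ind 2 (f 2)) +
      (1) * (ind 4 (f 0) * ind 4 (f 1) * ind 1 (f 2)) +
      (-1) * (ind 4 (f 0) * ind 4 (f 1) * ind 2 (f 2)) +
      (1/2) * (ind 1 (f 0) * ind 2 (f 1) * ind 1 (f 2)) +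
      (-1/2) * (ind 1 (f 0) * ind 2 (f 1) * ind 2 (f 2)) +
      (-1/2) * (ind 1 (f 0) * ind 4 (f 1) * ind 1 (f 2)) +
      (1/2) * (ind 1 (f 0) * ind 4 (f 1) * ind 2 (f 2)) +
      (1/2) * (ind 2 (f 0) * ind 2 (f 1) * ind 1 (f 2) * (f 0 : ℚ)) +
      (-1/2) * (ind 2 (f 0) * ind 2 (f 1) * ind 2 (f 2) * (f 0 : ℚ)) +
      (1/2) * (ind 1 (f 0) * ind 2 (f 1) * ind 1 (f 2) * (f 0 : ℚ)) +
      (-1/2) * (ind 1 (f 0) * ind 2 (f 1) * ind 2 (f 2) * (f 0 : ℚ)) +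
      (1/2) * (ind 1 (f 0) * ind 4 (f 1) * ind 1 (f 2) * (f 0 : ℚ)) +
      (-1/2) * (ind 1 (f 0) * ind 4 (f 1) * ind 2 (f 2) * (f 0 : ℚ)) := by
    intro f
    simp only [weightG2, ind_one]
    ring
  simp only [e, Finset.sum_add_distrib, ← Finset.mul_sum,
    sum_ind hn, sum_ind_fst hn]
  norm_num
  ring

/-- The number of conjugacy classes of subgroups of type `PiB1` with parameters `k, l, m`. -/
def weightB1 (k l m : ℕ) : ℚ :=
  ind 2 m * ((1 - ind 2 k) * (ind 2 l * l / 4 + (ind 2 l - ind 4 l) / 2) +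
      ind 2 k * (ind 2 l * l / 2) + (1 - ind 2 l) * ((1 - ind 2 k) * ((l + 1) / 2) + ind 2 k * l)) +
    (1 - ind 2 m) * (ind 4 l * k + (ind 2 l - ind 4 l) * ((k + 1 - ind 2 k) / 2))

theorem sum_weightB1 {n : ℕ} (hn : n ≠ 0) :
    ∑ f ∈ Nat.finMulAntidiag 3 n, weightB1 (f 0) (f 1) (f 2) =
      atQuot sigma2 n 2 - atQuot sigma2 n 8 + atQuot d3 n 2 - 2 * atQuot d3 n 4
        + atQuot d3 n 8 := by
  have e : ∀ f : Fin 3 → ℕ, weightB1 (f 0) (f 1) (f 2) =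
      (-1/2) * (ind 2 (f 0) * ind 2 (f 1) * ind 1 (f 2)) +
      (1/2) * (ind 2 (f 0) * ind 2 (f 1) * ind 2 (f 2)) +
      (1/2) * (ind 2 (f 0) * ind 4 (f 1) * ind 1 (f 2)) +
      (-1/2) * (ind 2 (f 0) * ind 1 (f 1) * ind 2 (f 2)) +
      (1/2) * (ind 1 (f 0) * ind 2 (f 1) * ind 1 (f 2)) +
      (-1/2) * (ind 1 (f 0) * ind 2 (f 1) * ind 2 (f 2)) +
      (-1/2) * (ind 1 (f 0) * ind 4 (f 1) * ind 1 (f 2)) +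
      (1/2) * (ind 1 (f 0) * ind 1 (f 1) * ind 2 (f 2)) +
      (1/2) * (ind 1 (f 0) * ind 2 (f 1) * ind 1 (f 2) * (f 0 : ℚ)) +
      (-1/2) * (ind 1 (f 0) * ind 2 (f 1) * ind 2 (f 2) * (f 0 : ℚ)) +
      (1/2) * (ind 1 (f 0) * ind 4 (f 1) * ind 1 (f 2) * (f 0 : ℚ)) +
      (-1/2) * (ind 1 (f 0) * ind 4 (f 1) * ind 2 (f 2) * (f 0 : ℚ)) +
      (-1/4) * (ind 2 (f 0) * ind 2 (f 1) * ind 2 (f 2) * (f 1 : ℚ)) +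
      (1/2) * (ind 2 (f 0) * ind 1 (f 1) * ind 2 (f 2) * (f 1 : ℚ)) +
      (-1/4) * (ind 1 (f 0) * ind 2 (f 1) * ind 2 (f 2) * (f 1 : ℚ)) +
      (1/2) * (ind 1 (f 0) * ind 1 (f 1) * ind 2 (f 2) * (f 1 : ℚ)) := by
    intro f
    simp only [weightB1, ind_one]
    ring
  simp only [e, Finset.sum_add_distrib, ← Finset.mul_sum,
    sum_ind hn, sum_ind_fst hn, sum_ind_snd hn]
  norm_num
  ring

/-- The number of conjugacy classes of subgroups of type `PiB2` with parameters `k, l, m`. -/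
def weightB2 (k l m : ℕ) : ℚ :=
  ind 2 m * (ind 2 l * (ind 4 k * (l / 2)) + (ind 2 k - ind 4 k) * (ind 2 l * (l / 2) +
      (ind 2 l - ind 4 l)) + (1 - ind 2 l) * (ind 2 k * l)) +
    (1 - ind 2 m) * (ind 4 l * (ind 2 k * (k / 2)) +
      (ind 2 l - ind 4 l) * (ind 2 k * (k / 2) + (ind 2 k - ind 4 k)))

theorem sum_weightB2 {n : ℕ} (hn : n ≠ 0) :
    ∑ f ∈ Nat.finMulAntidiag 3 n, weightB2 (f 0) (f 1) (f 2) =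
      2 * atQuot sigma2 n 4 - 2 * atQuot sigma2 n 8 + atQuot d3 n 4 - 2 * atQuot d3 n 8
        + atQuot d3 n 16 := by
  have e : ∀ f : Fin 3 → ℕ, weightB2 (f 0) (f 1) (f 2) =
      (1) * (ind 2 (f 0) * ind 2 (f 1) * ind 1 (f 2)) +
      (-1) * (ind 2 (f 0) * ind 4 (f 1) * ind 1 (f 2)) +
      (-1) * (ind 4 (f 0) * ind 2 (f 1) * ind 1 (f 2)) +
      (1) * (ind 4 (f 0) * ind 4 (f 1) * ind 1 (f 2)) +
      (1/2) * (ind 2 (f 0) * ind 2 (f 1) * ind 1 (f 2) * (f 0 : ℚ)) +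
      (-1/2) * (ind 2 (f 0) * ind 2 (f 1) * ind 2 (f 2) * (f 0 : ℚ)) +
      (-1/2) * (ind 2 (f 0) * ind 2 (f 1) * ind 2 (f 2) * (f 1 : ℚ)) +
      (1) * (ind 2 (f 0) * ind 1 (f 1) * ind 2 (f 2) * (f 1 : ℚ)) := by
    intro f
    simp only [weightB2, ind_one]
    ring
  simp only [e, Finset.sum_add_distrib, ← Finset.mul_sum,
    sum_ind hn, sum_ind_fst hn, sum_ind_snd hn]
  norm_num
  ring

/-- The number of conjugacy classes of subgroups of type `PiB4` with parameters `k, l, m`. -/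
def weightB4 (k l m : ℕ) : ℚ :=
  (1 - ind 2 k) * (1 - ind 2 l) * (1 - ind 2 m)

theorem sum_weightB4 {n : ℕ} (hn : n ≠ 0) :
    ∑ f ∈ Nat.finMulAntidiag 3 n, weightB4 (f 0) (f 1) (f 2) =
      (d3 n : ℚ) - 3 * atQuot d3 n 2 + 3 * atQuot d3 n 4 - atQuot d3 n 8 := by
  have e : ∀ f : Fin 3 → ℕ, weightB4 (f 0) (f 1) (f 2) =
      (1) * (ind 1 (f 0) * ind 1 (f 1) * ind 1 (f 2)) +
      (-1) * (ind 2 (f 0) * ind 1 (f 1) * ind 1 (f 2)) +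
      (1) * (ind 2 (f 0) * ind 2 (f 1) * ind 1 (f 2)) +
      (-1) * (ind 2 (f 0) * ind 2 (f 1) * ind 2 (f 2)) +
      (1) * (ind 2 (f 0) * ind 1 (f 1) * ind 2 (f 2)) +
      (-1) * (ind 1 (f 0) * ind 2 (f 1) * ind 1 (f 2)) +
      (1) * (ind 1 (f 0) * ind 2 (f 1) * ind 2 (f 2)) +
      (-1) * (ind 1 (f 0) * ind 1 (f 1) * ind 2 (f 2)) := by
    intro f
    simp only [weightB4, ind_one]
    ring
  simp only [e, Finset.sum_add_distrib, ← Finset.mul_sum,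
    sum_ind hn]
  norm_num [atQuot_one]
  ring

/-! ### Identification of the weights with the sizes of the transversals -/

section Counts

variable {k l m : ℕ}

theorem odd_coe {a : ℕ} (h : Odd a) : Odd (a : ℤ) := (Int.odd_coe_nat a).2 h

theorem even_coe {a : ℕ} (h : Even a) : Even (a : ℤ) := (Int.even_coe_nat a).2 h

theorem exists_transversal_piB4 (hk0 : 0 < k) (hl0 : 0 < l) (hm0 : 0 < m) :
    ∃ T, IsTransversal PiB4 k l m T ∧ (T.card : ℚ) = weightB4 k l m := by
  by_cases h : Odd k ∧ Odd l ∧ Odd m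
  · obtain ⟨hk, hl, hm⟩ := h
    obtain ⟨T, hT, e⟩ := transversal_odd_odd (H := PiB4) hk0 hl0 hm0 (odd_coe hl) (odd_coe hm) hk
      fun d hd => hd.piB4_iff.2 ⟨Nat.not_even_iff_odd.2 hl, Nat.not_even_iff_odd.2 hm⟩
    refine ⟨T, hT, ?_⟩
    simp [e, weightB4, ind_two_of_odd, hk, hl, hm]
  · refine ⟨∅, isTransversal_empty fun d hd hd' => h ?_, ?_⟩
    · obtain ⟨hl, hm⟩ := hd.piB4_iff.1 hd'
      rw [Nat.not_even_iff_odd] at hl hm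
      refine ⟨?_, hl, hm⟩
      -- Goodness makes `k` divide the odd number `2 * t + 1 - 2 * s`, so `k` cannot be even.
      by_contra hk
      have h1 := (hd.of_odd (odd_coe hl)).2
      rw [Int.odd_iff.1 (odd_coe hm), sg_odd (odd_coe hm)] at h1
      have h2 := ((even_coe (Nat.not_odd_iff_even.1 hk)).two_dvd).trans h1
      omega
    · have : Even k ∨ Even l ∨ Even m := by
        simp only [← Nat.not_odd_iff_even]
        tauto
      rcases this with h | h | h <;> simp [weightB4, ind_two_of_even h]

theorem exists_transversal_piG1 (hk0 : 0 < k) (hl0 : 0 < l) (hm0 : 0 < m) :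
    ∃ T, IsTransversal PiG1 k l m T ∧ (T.card : ℚ) = weightG1 k l m := by
  by_cases h : Even l ∧ Even m
  · obtain ⟨hl, hm⟩ := h
    obtain ⟨L, rfl⟩ := hl.exists_two_nsmul
    rw [smul_eq_mul] at *
    obtain ⟨T, hT, e⟩ := transversal_abelian (H := PiG1) hk0 (L := L) (by omega) hm0 (even_coe hm)
      fun d hd => by rw [hd.piG1_iff]; simp [hm]
    refine ⟨T, hT, ?_⟩
    have e' := congrArg (Nat.cast (R := ℚ)) e
    have hk : (numHalves k : ℚ) = 1 + ind 2 k := by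
      rcases Nat.even_or_odd k with hk | hk
      · rw [numHalves, if_pos hk, ind_two_of_even hk]
        norm_num
      · rw [numHalves, if_neg (Nat.not_even_iff_odd.2 hk), ind_two_of_odd hk]
        norm_num
    -- Idempotence turns the square of `numHalves k = 1 + ind 2 k` into the factor `1 + 3 * ind 2 k`
    -- of `weightG1`.
    have hk' : ind 2 k ^ 2 = ind 2 k := by
      rcases Nat.even_or_odd k with hk | hk
      · rw [ind_two_of_even hk, one_pow]
      · rw [ind_two_of_odd hk, zero_pow two_ne_zero]
    have hL : (if Even L then (k : ℚ) else 0) = ind 2 L * k := by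
      rcases Nat.even_or_odd L with hL | hL
      · rw [if_pos hL, ind_two_of_even hL, one_mul]
      · rw [if_neg (Nat.not_even_iff_odd.2 hL), ind_two_of_odd hL, zero_mul]
    push_cast at e'
    rw [hL, hk] at e'
    rw [weightG1, ind_two_of_even hm, ind_two_of_even hl, ind_four_two_mul]
    push_cast
    linear_combination e' / 4 + (L : ℚ) / 4 * hk'
  · refine ⟨∅, isTransversal_empty fun d hd hd' => h ?_, ?_⟩
    · obtain ⟨hl, hm, -⟩ := hd.piG1_iff.1 hd'
      exact ⟨hl, hm⟩
    · have : Odd l ∨ Odd m := by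
        simp only [← Nat.not_even_iff_odd]
        tauto
      rcases this with h | h
      · simp [weightG1, ind_two_of_odd h, ind_four_of_odd h]
      · simp [weightG1, ind_two_of_odd h]

theorem exists_transversal_piG2 (hk0 : 0 < k) (hl0 : 0 < l) (hm0 : 0 < m) :
    ∃ T, IsTransversal PiG2 k l m T ∧ (T.card : ℚ) = weightG2 k l m := by
  by_cases h : Even l ∧ Odd m
  · obtain ⟨hl, hm⟩ := h
    obtain ⟨L, rfl⟩ := hl.exists_two_nsmul
    rw [smul_eq_mul] at *
    have hL0 : 0 < L := by omega
    have hp : ∀ d, IsGood k (2 * L) m d →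
        (Nonempty (sub k (2 * L) m d ≃* PiG2) ↔ Even d.2.2) := fun d hd => by
      rw [hd.piG2_iff]
      simp [hm]
    rcases Nat.even_or_odd k with hk | hk
    · obtain ⟨h, rfl⟩ := hk.exists_two_nsmul
      rw [smul_eq_mul] at *
      have hh0 : 0 < h := by omega
      rcases Nat.even_or_odd L with hL | hL
      · obtain ⟨T, hT, e⟩ := transversal_even_odd_even_two_mul hh0 hL0 hm0 (odd_coe hm) hL hp
        refine ⟨T, hT, ?_⟩
        simp only [e, weightG2, ind_two_of_odd hm, ind_two_of_even hl, ind_two_of_even hk,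
          ind_four_two_mul, ind_two_of_even hL]
        push_cast
        ring
      · obtain ⟨T, hT, e⟩ :=
          transversal_even_odd_even_two_mul_of_odd hh0 hL0 hm0 (odd_coe hm) hL hp
        refine ⟨T, hT, ?_⟩
        rw [e, Nat.cast_add, Nat.cast_mul, cast_add_one_div_two]
        simp only [weightG2, ind_two_of_odd hm, ind_two_of_even hl, ind_two_of_even hk,
          ind_four_two_mul, ind_two_of_odd hL]
        push_cast
        ring
    · rcases Nat.even_or_odd L with hL | hL
      · obtain ⟨T, hT, e⟩ := transversal_even_odd_even hk0 hL0 hm0 (odd_coe hm) hk hL hp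
        refine ⟨T, hT, ?_⟩
        simp only [e, weightG2, ind_two_of_odd hm, ind_two_of_even hl, ind_two_of_odd hk,
          ind_four_of_odd hk, ind_four_two_mul, ind_two_of_even hL]
        ring
      · obtain ⟨T, hT, e⟩ := transversal_even_odd_even_of_odd hk0 hL0 hm0 (odd_coe hm) hk hL hp
        refine ⟨T, hT, ?_⟩
        rw [e, cast_add_one_div_two]
        simp only [weightG2, ind_two_of_odd hm, ind_two_of_even hl, ind_two_of_odd hk,
          ind_four_of_odd hk, ind_four_two_mul, ind_two_of_odd hL]
        ring
  · refine ⟨∅, isTransversal_empty fun d hd hd' => h ?_, ?_⟩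
    · obtain ⟨hl, hm, -⟩ := hd.piG2_iff.1 hd'
      exact ⟨hl, Nat.not_even_iff_odd.1 hm⟩
    · have : Odd l ∨ Even m := by
        simp only [← Nat.not_even_iff_odd] at h ⊢
        tauto
      rcases this with h | h
      · simp [weightG2, ind_two_of_odd h, ind_four_of_odd h]
      · simp [weightG2, ind_two_of_even h]

/-- The type `PiB1` belongs to the residue zero (`s₀ = 0` or `t₀ = 0`) in the general transversals,
and `PiB2` to the residue `k / 2`. -/
theorem exists_transversal_piB1 (hk0 : 0 < k) (hl0 : 0 < l) (hm0 : 0 < m) :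
    ∃ T, IsTransversal PiB1 k l m T ∧ (T.card : ℚ) = weightB1 k l m := by
  rcases Nat.even_or_odd l with hl | hl
  · obtain ⟨L, rfl⟩ := hl.exists_two_nsmul
    rw [smul_eq_mul] at *
    have hL0 : 0 < L := by omega
    have hp : ∀ d, IsGood k (2 * L) m d →
        (Nonempty (sub k (2 * L) m d ≃* PiB1) ↔ Odd d.2.2 ∧ (k : ℤ) ∣ d.1) := fun d hd => by
      rw [hd.piB1_iff]
      simp
    rcases Nat.even_or_odd m with hm | hm
    · rcases Nat.even_or_odd k with hk | hk
      · obtain ⟨T, hT, e⟩ := transversal_even_even_odd (s₀ := 0) hk0 hL0 hm0 (even_coe hm) hk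
          Even.zero (by simp) (by simpa only [sub_zero] using hp)
        refine ⟨T, hT, ?_⟩
        simp only [e, weightB1, ind_two_of_even hm, ind_two_of_even hl, ind_two_of_even hk]
        push_cast
        ring
      · obtain ⟨T, hT, e⟩ := transversal_even_even_odd_of_odd hk0 hL0 hm0 (even_coe hm) hk hp
        refine ⟨T, hT, ?_⟩
        rw [e, cast_add_one_div_two]
        simp only [weightB1, ind_two_of_even hm, ind_two_of_even hl, ind_two_of_odd hk,
          ind_four_two_mul]
        push_cast
        ring
    · rcases Nat.even_or_odd L with hL | hL
      · obtain ⟨T, hT, e⟩ := transversal_even_odd_odd hk0 hL0 hm0 (odd_coe hm) hL hp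
        refine ⟨T, hT, ?_⟩
        simp only [e, weightB1, ind_two_of_odd hm, ind_two_of_even hl, ind_four_two_mul,
          ind_two_of_even hL]
        ring
      · obtain ⟨T, hT, e⟩ := transversal_even_odd_odd_of_odd hk0 hL0 hm0 (odd_coe hm) hL hp
        refine ⟨T, hT, ?_⟩
        rw [e, cast_add_one_div_two]
        simp only [weightB1, ind_two_of_odd hm, ind_two_of_even hl, ind_four_two_mul,
          ind_two_of_odd hL]
        ring
  · have hl' := Nat.not_even_iff_odd.2 hl
    rcases Nat.even_or_odd m with hm | hm
    · have hp : ∀ d, IsGood k l m d →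
          (Nonempty (sub k l m d ≃* PiB1) ↔ (k : ℤ) ∣ d.2.1) := fun d hd => by
        rw [hd.piB1_iff]
        simp [hl', hm]
      rcases Nat.even_or_odd k with hk | hk
      · obtain ⟨T, hT, e⟩ := transversal_odd_even (t₀ := 0) hk0 hl0 hm0 (odd_coe hl)
          (even_coe hm) hk (by simp) (by simpa only [sub_zero] using hp)
        refine ⟨T, hT, ?_⟩
        simp only [e, weightB1, ind_two_of_even hm, ind_two_of_odd hl, ind_two_of_even hk]
        ring
      · obtain ⟨T, hT, e⟩ :=
          transversal_odd_even_of_odd hk0 hl0 hm0 (odd_coe hl) (even_coe hm) hk hp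
        refine ⟨T, hT, ?_⟩
        rw [e, cast_add_one_div_two]
        simp only [weightB1, ind_two_of_even hm, ind_two_of_odd hl, ind_four_of_odd hl,
          ind_two_of_odd hk]
        ring
    · refine ⟨∅, isTransversal_empty fun d hd => ?_, ?_⟩
      · rw [hd.piB1_iff]
        simp [hl', Nat.not_even_iff_odd.2 hm]
      · simp [weightB1, ind_two_of_odd hm, ind_two_of_odd hl, ind_four_of_odd hl]

/-- The only residues modulo `2 * h` killed by doubling are 0 and `h`. -/
theorem not_dvd_iff_dvd_sub_half {h : ℕ} (hh : 0 < h) {s : ℤ} (hs : ((2 * h : ℕ) : ℤ) ∣ 2 * s) :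
    ¬ ((2 * h : ℕ) : ℤ) ∣ s ↔ ((2 * h : ℕ) : ℤ) ∣ s - h := by
  push_cast at *
  constructor
  · intro hs'
    obtain ⟨j, hj⟩ := Int.dvd_of_mul_dvd_mul_left two_ne_zero hs
    rcases Int.even_or_odd' j with ⟨i, rfl | rfl⟩
    · exact absurd ⟨i, by rw [hj]; ring⟩ hs'
    · exact ⟨i, by rw [hj]; ring⟩
  · rintro ⟨i, hi⟩ ⟨j, hj⟩
    have h1 : (h : ℤ) * (2 * (j - i)) = h * 1 := by linarith
    have := mul_left_cancel₀ (by positivity) h1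
    omega

theorem dvd_of_odd_of_dvd_two_mul {s : ℤ} (hk : Odd k) (hs : (k : ℤ) ∣ 2 * s) : (k : ℤ) ∣ s :=
  (Int.isCoprime_iff_gcd_eq_one.2 (by
    simpa [Int.gcd] using hk : Int.gcd (k : ℤ) 2 = 1)).dvd_of_dvd_mul_left hs

theorem exists_transversal_piB2 (hk0 : 0 < k) (hl0 : 0 < l) (hm0 : 0 < m) :
    ∃ T, IsTransversal PiB2 k l m T ∧ (T.card : ℚ) = weightB2 k l m := by
  rcases Nat.even_or_odd k with hk | hk
  · obtain ⟨h, rfl⟩ := hk.exists_two_nsmul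
    rw [smul_eq_mul] at *
    have hh0 : 0 < h := by omega
    have hhk : ((2 * h : ℕ) : ℤ) ∣ 2 * (h : ℤ) := by simp
    rcases Nat.even_or_odd l with hl | hl
    · obtain ⟨L, rfl⟩ := hl.exists_two_nsmul
      rw [smul_eq_mul] at *
      have hL0 : 0 < L := by omega
      have hp : ∀ d, IsGood (2 * h) (2 * L) m d → (Nonempty (sub (2 * h) (2 * L) m d ≃* PiB2) ↔
          Odd d.2.2 ∧ ((2 * h : ℕ) : ℤ) ∣ d.1 - h) := fun d hd => by
        rw [hd.piB2_iff, ← Int.not_even_iff_odd]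
        simp only [hl, true_and, not_true_eq_false, false_and, or_false]
        exact and_congr_right fun hu => not_dvd_iff_dvd_sub_half hh0
          (hd.dvd_two_mul_s (even_coe hl) (Int.not_even_iff_odd.1 hu))
      rcases Nat.even_or_odd m with hm | hm
      · rcases Nat.even_or_odd h with hh | hh
        · obtain ⟨T, hT, e⟩ := transversal_even_even_odd hk0 hL0 hm0 (even_coe hm) hk
            (even_coe hh) hhk hp
          refine ⟨T, hT, ?_⟩
          simp only [e, weightB2, ind_two_of_even hm, ind_two_of_even hl, ind_two_of_even hk,
            ind_four_two_mul, ind_two_of_even hh]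
          push_cast
          ring
        · obtain ⟨T, hT, e⟩ := transversal_even_even_odd_of_odd_s hk0 hL0 hm0 (even_coe hm) hk
            (odd_coe hh) hhk hp
          refine ⟨T, hT, ?_⟩
          rw [e, Nat.cast_mul, cast_add_one_div_two]
          simp only [weightB2, ind_two_of_even hm, ind_two_of_even hl, ind_two_of_even hk,
            ind_four_two_mul, ind_two_of_odd hh]
          push_cast
          ring
      · rcases Nat.even_or_odd L with hL | hL
        · obtain ⟨T, hT, e⟩ := transversal_even_odd_odd_half hh0 hL0 hm0 (odd_coe hm) hL hp
          refine ⟨T, hT, ?_⟩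
          simp only [e, weightB2, ind_two_of_odd hm, ind_two_of_even hl, ind_two_of_even hk,
            ind_four_two_mul, ind_two_of_even hL]
          push_cast
          ring
        · obtain ⟨T, hT, e⟩ := transversal_even_odd_odd_half_of_odd hh0 hL0 hm0 (odd_coe hm) hL hp
          refine ⟨T, hT, ?_⟩
          rw [e, Nat.cast_mul, cast_add_one_div_two]
          simp only [weightB2, ind_two_of_odd hm, ind_two_of_even hl, ind_two_of_even hk,
            ind_four_two_mul, ind_two_of_odd hL]
          push_cast
          ring
    · have hl' := Nat.not_even_iff_odd.2 hl
      rcases Nat.even_or_odd m with hm | hm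
      · obtain ⟨T, hT, e⟩ := transversal_odd_even (H := PiB2) (t₀ := h) hk0 hl0 hm0 (odd_coe hl)
          (even_coe hm) hk hhk fun d hd => by
            rw [hd.piB2_iff]
            simp only [hl', hm, false_and, not_false_eq_true, true_and, false_or]
            exact not_dvd_iff_dvd_sub_half hh0 (hd.dvd_two_mul_t (odd_coe hl) (even_coe hm))
        refine ⟨T, hT, ?_⟩
        simp only [e, weightB2, ind_two_of_even hm, ind_two_of_odd hl, ind_four_of_odd hl,
          ind_two_of_even hk]
        ring
      · refine ⟨∅, isTransversal_empty fun d hd => ?_, ?_⟩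
        · rw [hd.piB2_iff]
          simp [hl', Nat.not_even_iff_odd.2 hm]
        · simp [weightB2, ind_two_of_odd hm, ind_two_of_odd hl, ind_four_of_odd hl]
  -- For odd `k` there is no nonzero 2-torsion residue modulo `k`, so the type `PiB2` does not
  -- occur.
  · refine ⟨∅, isTransversal_empty fun d hd => ?_, ?_⟩
    · rw [hd.piB2_iff]
      rintro (⟨hl, hu, hs⟩ | ⟨hl, hm, ht⟩)
      · exact hs (dvd_of_odd_of_dvd_two_mul hk
          (hd.dvd_two_mul_s (even_coe hl) (Int.not_even_iff_odd.1 hu)))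
      · exact ht (dvd_of_odd_of_dvd_two_mul hk
          (hd.dvd_two_mul_t (odd_coe (Nat.not_even_iff_odd.1 hl)) (even_coe hm)))
    · simp [weightB2, ind_two_of_odd hk, ind_four_of_odd hk]

end Counts

end FlatCoverings

open FlatCoverings in
theorem theorem4 (n : ℕ) (hn : 1 ≤ n) :
    -- the five isomorphism types below are all that occur in index `n`
    (∀ Δ : Subgroup PiB4, Δ.index = n →
      Nonempty (Δ ≃* PiG1) ∨ Nonempty (Δ ≃* PiG2) ∨ Nonempty (Δ ≃* PiB1) ∨
        Nonempty (Δ ≃* PiB2) ∨ Nonempty (Δ ≃* PiB4)) ∧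
    -- the sets of conjugacy classes that are counted are finite
    ((conjClassesOfType PiG1 PiB4 n).Finite ∧ (conjClassesOfType PiG2 PiB4 n).Finite ∧
      (conjClassesOfType PiB1 PiB4 n).Finite ∧ (conjClassesOfType PiB2 PiB4 n).Finite ∧
      (conjClassesOfType PiB4 PiB4 n).Finite) ∧
    -- (i)
    (numClasses PiG1 PiB4 n : ℚ) =
      1 / 4 * (atQuot omega n 4 + 3 * atQuot sigma2 n 4 + 9 * atQuot sigma2 n 8) ∧
    -- (ii)
    (numClasses PiG2 PiB4 n : ℚ) =
      1 / 2 * (atQuot sigma2 n 2 + 2 * atQuot sigma2 n 4 - 3 * atQuot sigma2 n 8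
        + atQuot d3 n 2 - atQuot d3 n 4 - 3 * atQuot d3 n 8 + 5 * atQuot d3 n 16
        - 2 * atQuot d3 n 32) ∧
    -- (iii)
    (numClasses PiB1 PiB4 n : ℚ) =
      atQuot sigma2 n 2 - atQuot sigma2 n 8 + atQuot d3 n 2 - 2 * atQuot d3 n 4
        + atQuot d3 n 8 ∧
    -- (iv)
    (numClasses PiB2 PiB4 n : ℚ) =
      2 * atQuot sigma2 n 4 - 2 * atQuot sigma2 n 8 + atQuot d3 n 4 - 2 * atQuot d3 n 8
        + atQuot d3 n 16 ∧
    -- (v)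
    (numClasses PiB4 PiB4 n : ℚ) =
      (d3 n : ℚ) - 3 * atQuot d3 n 2 + 3 * atQuot d3 n 4 - atQuot d3 n 8 := by

  have hn0 : n ≠ 0 := Nat.one_le_iff_ne_zero.1 hn
  obtain ⟨f1, e1⟩ := numClasses_eq_sum hn0 fun k l m => exists_transversal_piG1 (k := k)
  obtain ⟨f2, e2⟩ := numClasses_eq_sum hn0 fun k l m => exists_transversal_piG2 (k := k)
  obtain ⟨f3, e3⟩ := numClasses_eq_sum hn0 fun k l m => exists_transversal_piB1 (k := k)
  obtain ⟨f4, e4⟩ := numClasses_eq_sum hn0 fun k l m => exists_transversal_piB2 (k := k)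
  obtain ⟨f5, e5⟩ := numClasses_eq_sum hn0 fun k l m => exists_transversal_piB4 (k := k)
  exact ⟨fun Δ hΔ => type_of_index_ne_zero Δ (hΔ ▸ hn0), ⟨f1, f2, f3, f4, f5⟩,
    e1.trans (sum_weightG1 hn0), e2.trans (sum_weightG2 hn0), e3.trans (sum_weightB1 hn0),
    e4.trans (sum_weightB2 hn0), e5.trans (sum_weightB4 hn0)⟩
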